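/- Work over $\mathbb{C}$. Let $P=\mathrm{Bl}_0\mathbb{P}^5=\{([x],[y])\in\mathbb{P}^5\times\mathbb{P}^4 : (x_1,\dots,x_5)=\lambda y \text{ for some } \lambda\in\mathbb{C}\}$ be the blow-up of $\mathbb{P}^5$ at the point $0=[1:0:0:0:0:0]$, with exceptional divisor $e=\{\lambda=0\}$, and let $\rho\colon P\to\mathbb{P}^4$, $([x],[y])\mapsto[y]$. Let $V=H^0(P,\mathcal{O}(3)(-2e))$ be the space of cubic forms on $\mathbb{P}^5$ with multiplicity at least $2$ at $0$, i.e. of the forms $F=x_0\,q(x_1,\dots,x_5)+c(x_1,\dots,x_5)$ with $q$ a quadratic and $c$ a cubic form; as a section of $\mathcal{O}(3)(-2e)$, such an $F$ defines the divisor $\{x_0\,q(y)+\lambda\,c(y)=0\}\subset P$. For a pair $F_0=x_0q_0+c_0$, $F_\infty=x_0q_\infty+c_\infty$ in $V$ let $X\subset P$ be the base locus of the pencil spanned by $F_0,F_\infty$, let $$Y=\{([y],[u:t]) : u\,q_0(y)+t\,q_\infty(y)=0=u\,c_0(y)+t\,c_\infty(y)\}\subset\mathbb{P}^4\times\mathbb{P}^1,$$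 and let $Q=\{q_0c_\infty-q_\infty c_0=0\}\subset\mathbb{P}^4$, where $q_0c_\infty-q_\infty c_0$ is homogeneous of degree $5$. 1. For all $F_0,F_\infty\in V$, the maps $X\hookrightarrow P\xrightarrow{\rho}\mathbb{P}^4$ and $Y\hookrightarrow\mathbb{P}^4\times\mathbb{P}^1\to\mathbb{P}^4$ both have image $Q$. If $X$ is smooth of dimension $3$ (in particular for a generic pencil), then $q_0c_\infty-q_\infty c_0\neq0$, so $Q$ is a quintic threefold. 2. For generic $(F_0,F_\infty)$ (in a nonempty Zariski open subset of $V\times V$), $Q$ has exactly $36$ singular points, all of them ordinary double points. 3. Whenever $Q$ has exactly $36$ singular points, all of them ordinary double points, $X$ and $Y$ are smooth projective threefolds, $X\to Q$ and $Y\to Q$ are isomorphisms away from the $36$ nodes and have fibre $\mathbb{P}^1$ over each node, and $Y\to Q$ is obtained from $X\to Q$ by flopping all $36$ exceptional curves. That is, writing $C_p\subset X$ and $C_p'\subset Y$ for the fibres over the nodes $p$, there is a common blow-up $W\subset X\times Y$, compatible with the maps to $Q$, whose projections are the blow-up of $X$ along $\bigcup_pC_p$ and the blow-up of $Y$ along $\bigcup_pC_p'$,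 and whose exceptional divisor over each $p$ is $C_p\times C_p'$. -/

import Mathlib

open scoped LinearAlgebra.Projectivization

noncomputable section

namespace CubicPencil

/-! ### Subvarieties of products of complex projective spaces -/

/-- The product of the complex projective spaces `ℙ^(d i)`. -/
abbrev MP {ι : Type} (d : ι → ℕ) : Type :=
  (i : ι) → ℙ ℂ (Fin (d i + 1) → ℂ)

/-- The multihomogeneous coordinate ring of `MP d`. -/
abbrev CoordRing {ι : Type} (d : ι → ℕ) : Type :=
  MvPolynomial (Σ i : ι, Fin (d i + 1)) ℂ

/-- `G` is multihomogeneous of multidegree `m`. -/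
def IsMultihomogeneous {ι : Type} [DecidableEq ι] {d : ι → ℕ}
    (G : CoordRing d) (m : ι → ℕ) : Prop :=
  MvPolynomial.IsWeightedHomogeneous
    (fun s : Σ i : ι, Fin (d i + 1) => (Pi.single s.1 1 : ι → ℕ)) G m

/-- A choice of multihomogeneous coordinates of a point. -/
def coords {ι : Type} {d : ι → ℕ} (a : MP d) : (Σ i : ι, Fin (d i + 1)) → ℂ :=
  fun s => (a s.1).rep s.2

/-- The value of `G` at the chosen coordinates of `a`. For multihomogeneous `G` its vanishing
does not depend on the choice of coordinates. -/
def value {ι : Type} {d : ι → ℕ} (G : CoordRing d) (a : MP d) : ℂ :=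
  MvPolynomial.eval (coords a) G

/-- The gradient of `G` at the chosen coordinates of `a`. -/
def grad {ι : Type} {d : ι → ℕ} (G : CoordRing d) (a : MP d) :
    (Σ i : ι, Fin (d i + 1)) → ℂ :=
  fun s => MvPolynomial.eval (coords a) (MvPolynomial.pderiv s G)

/-- Zariski closed subsets. -/
def IsZariskiClosed {ι : Type} [DecidableEq ι] {d : ι → ℕ} (A : Set (MP d)) : Prop :=
  ∃ T : Set (CoordRing d), (∀ G ∈ T, ∃ m, IsMultihomogeneous G m) ∧
    A = {a | ∀ G ∈ T, value G a = 0}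

/-- `f` restricts to a regular map on `A`: Zariski locally on `A`, each component of `f` is given
by multihomogeneous polynomials of equal multidegree without common zero. -/
def RegularOn {ι κ : Type} [DecidableEq ι] {d : ι → ℕ} {e : κ → ℕ}
    (f : MP d → MP e) (A : Set (MP d)) : Prop :=
  ∀ a ∈ A, ∀ j : κ, ∃ (m : ι → ℕ) (G : Fin (e j + 1) → CoordRing d),
    (∀ k, IsMultihomogeneous (G k) m) ∧
    (fun k => value (G k) a) ≠ 0 ∧
    ∀ x ∈ A, ∀ hx : (fun k => value (G k) x) ≠ 0,
      f x j = Projectivization.mk ℂ (fun k => value (G k) x) hx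

/-- `f` restricts to an isomorphism of varieties from `A` onto `B`. -/
def IsIsoOn {ι κ : Type} [DecidableEq ι] [DecidableEq κ] {d : ι → ℕ} {e : κ → ℕ}
    (f : MP d → MP e) (A : Set (MP d)) (B : Set (MP e)) : Prop :=
  RegularOn f A ∧ Set.MapsTo f A B ∧
    ∃ g : MP e → MP d, RegularOn g B ∧ Set.MapsTo g B A ∧ Set.InvOn g f A B

/-- `A` and `B` are isomorphic varieties. -/
def IsIsomorphic {ι κ : Type} [DecidableEq ι] [DecidableEq κ] {d : ι → ℕ} {e : κ → ℕ}
    (A : Set (MP d)) (B : Set (MP e)) : Prop :=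
  ∃ f : MP d → MP e, IsIsoOn f A B

/-- On the open set `H ≠ 0` the set `A` is the zero locus of the multihomogeneous
polynomials `g k`. -/
def CutsOutOn {ι κ : Type} [DecidableEq ι] {d : ι → ℕ}
    (H : CoordRing d) (g : κ → CoordRing d) (A : Set (MP d)) : Prop :=
  (∀ k, ∃ m, IsMultihomogeneous (g k) m) ∧
    ∀ x, value H x ≠ 0 → (x ∈ A ↔ ∀ k, value (g k) x = 0)

/-- `A` is smooth of pure dimension `n`: near each of its points it is the zero locus of
`dim (MP d) - n` equations with linearly independent differentials. (By Euler's relation, the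
differentials on `MP d` are independent exactly if the gradients in coordinates are.) -/
def IsSmoothOfDim {ι : Type} [Fintype ι] [DecidableEq ι] {d : ι → ℕ}
    (A : Set (MP d)) (n : ℕ) : Prop :=
  ∀ a ∈ A, ∃ (r : ℕ) (H : CoordRing d) (g : Fin r → CoordRing d),
    r + n = ∑ i, d i ∧ (∃ m, IsMultihomogeneous H m) ∧ value H a ≠ 0 ∧
    CutsOutOn H g A ∧ LinearIndependent ℂ (fun k => grad (g k) a)

/-- The product `MP d × MP e`, again as a product of projective spaces. -/
abbrev MPProd {ι κ : Type} (d : ι → ℕ) (e : κ → ℕ) : Type :=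
  MP (Sum.elim d e)

/-- First projection. -/
def fstMap {ι κ : Type} {d : ι → ℕ} {e : κ → ℕ} (w : MPProd d e) : MP d :=
  fun i => w (Sum.inl i)

/-- Second projection. -/
def sndMap {ι κ : Type} {d : ι → ℕ} {e : κ → ℕ} (w : MPProd d e) : MP e :=
  fun j => w (Sum.inr j)

/-- `ℙ^n` as a product with a single factor. -/
abbrev PSpace (n : ℕ) : Type := MP (fun _ : Fin 1 => n)

/-- The local model of the blow-up of `X` along the locus `G 0 = G 1 = 0` over the open set
`H ≠ 0`: the pairs `(x, [s : t])` with `s * G 1 (x) = t * G 0 (x)`. -/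
def blowUpModel {ι : Type} {d : ι → ℕ} (X : Set (MP d)) (H : CoordRing d)
    (G : Fin 2 → CoordRing d) : Set (MPProd d (fun _ : Fin 1 => 1)) :=
  {w | fstMap w ∈ X ∧ value H (fstMap w) ≠ 0 ∧
    (sndMap w 0).rep 0 * value (G 1) (fstMap w) = (sndMap w 0).rep 1 * value (G 0) (fstMap w)}

/-- `b : W → X` is the blow-up of `X` along `C`, where `X` and `C` are smooth near `C` and `C` has
codimension two in `X`: it is an isomorphism away from `C`, and near each point of `C` there are
local equations `G 0, G 1` of `C` in `X` (of equal multidegree, so that `G 0 / G 1` is a rational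
function) for which `W` is, over `X`, the model `s * G 1 = t * G 0`. -/
structure IsBlowUp {ι κ : Type} [DecidableEq ι] [DecidableEq κ] {d : ι → ℕ} {e : κ → ℕ}
    (b : MP e → MP d) (W : Set (MP e)) (X C : Set (MP d)) : Prop where
  regular : RegularOn b W
  mapsTo : Set.MapsTo b W X
  iso_away : IsIsoOn b (W \ b ⁻¹' C) (X \ C)
  local_model : ∀ a ∈ C, ∃ (r : ℕ) (H : CoordRing d) (g : Fin r → CoordRing d)
    (G : Fin 2 → CoordRing d) (φ : MP e → MPProd d (fun _ : Fin 1 => 1)),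
    (∃ m, IsMultihomogeneous H m) ∧ value H a ≠ 0 ∧
    (∃ m, ∀ k, IsMultihomogeneous (G k) m) ∧
    CutsOutOn H g X ∧ CutsOutOn H (Sum.elim g G) C ∧
    LinearIndependent ℂ (fun k => grad (Sum.elim g G k) a) ∧
    IsIsoOn φ {w ∈ W | value H (b w) ≠ 0} (blowUpModel X H G) ∧
    ∀ w ∈ W, value H (b w) ≠ 0 → fstMap (φ w) = b w

/-- `g : Y → Q` is obtained from `f : X → Q` by flopping the curves of `X` over the points of `S`
(Atiyah flop). Here `X` and `Y` are smooth projective threefolds, `f` and `g` are isomorphisms away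
from `S`, over each `p ∈ S` the fibres `C_p` of `f` and `C'_p` of `g` are smooth rational curves, and
there is a common blow-up `W` of `X` along the union of the `C_p` and of `Y` along the union of
the `C'_p`, compatible with `f` and `g`, whose exceptional divisor over `p` is `C_p × C'_p`, with
the two blow-downs being the two projections. (This forces the curves to have normal bundle
`O(-1) ⊕ O(-1)`.) -/
structure IsFlop {ι κ τ : Type} [Fintype ι] [DecidableEq ι] [Fintype κ] [DecidableEq κ]
    [DecidableEq τ] {d : ι → ℕ} {e : κ → ℕ} {n : τ → ℕ}
    (X : Set (MP d)) (f : MP d → MP n) (Y : Set (MP e)) (g : MP e → MP n)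
    (Q S : Set (MP n)) : Prop where
  closed_X : IsZariskiClosed X
  closed_Y : IsZariskiClosed Y
  smooth_X : IsSmoothOfDim X 3
  smooth_Y : IsSmoothOfDim Y 3
  regular_f : RegularOn f X
  regular_g : RegularOn g Y
  image_f : f '' X = Q
  image_g : g '' Y = Q
  subset : S ⊆ Q
  iso_f : IsIsoOn f (X \ f ⁻¹' S) (Q \ S)
  iso_g : IsIsoOn g (Y \ g ⁻¹' S) (Q \ S)
  curve_f : ∀ p ∈ S, IsIsomorphic (Set.univ : Set (PSpace 1)) (X ∩ f ⁻¹' {p})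
  curve_g : ∀ p ∈ S, IsIsomorphic (Set.univ : Set (PSpace 1)) (Y ∩ g ⁻¹' {p})
  common_blowUp : ∃ W : Set (MPProd d e),
    IsBlowUp fstMap W X (X ∩ f ⁻¹' S) ∧
    IsBlowUp sndMap W Y (Y ∩ g ⁻¹' S) ∧
    (∀ w ∈ W, f (fstMap w) = g (sndMap w)) ∧
    ∀ p ∈ S, {w ∈ W | f (fstMap w) = p} =
      {w | fstMap w ∈ X ∩ f ⁻¹' {p} ∧ sndMap w ∈ Y ∩ g ⁻¹' {p}}

/-! ### Nodal hypersurfaces -/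

/-- The hypersurface `h = 0` in `ℙ^n`. -/
def hypersurface {n : ℕ} (h : MvPolynomial (Fin (n + 1)) ℂ) : Set (PSpace n) :=
  {p | MvPolynomial.eval (p 0).rep h = 0}

/-- The singular points of the hypersurface `h = 0`. -/
def singularPoints {n : ℕ} (h : MvPolynomial (Fin (n + 1)) ℂ) : Set (PSpace n) :=
  {p ∈ hypersurface h | ∀ i, MvPolynomial.eval (p 0).rep (MvPolynomial.pderiv i h) = 0}

/-- `p` is an ordinary double point of `h = 0`: a singular point at which the Hessian in affine
coordinates is nondegenerate, that is, at which the homogeneous Hessian (which kills the vector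
`p` itself) has rank `n`. -/
def IsODP {n : ℕ} (h : MvPolynomial (Fin (n + 1)) ℂ) (p : PSpace n) : Prop :=
  p ∈ singularPoints h ∧
    (Matrix.of fun i j : Fin (n + 1) =>
      MvPolynomial.eval (p 0).rep (MvPolynomial.pderiv i (MvPolynomial.pderiv j h))).rank = n

/-- The hypersurface `h = 0` has exactly `N` singular points, all of them ordinary double
points. -/
def HasExactlyODPs {n : ℕ} (h : MvPolynomial (Fin (n + 1)) ℂ) (N : ℕ) : Prop :=
  (singularPoints h).Finite ∧ (singularPoints h).ncard = N ∧ ∀ p ∈ singularPoints h, IsODP h p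

/-! ### Pencils of cubics with a double point -/

/-- The cubic forms on `ℙ^5` with multiplicity at least two at `0 = [1 : 0 : 0 : 0 : 0 : 0]`, that
is, the space `H⁰(Bl_0 ℙ^5, O(3)(-2e))`. -/
def doublePointCubics : Submodule ℂ (MvPolynomial (Fin 6) ℂ) :=
  MvPolynomial.homogeneousSubmodule (Fin 6) ℂ 3 ⊓
    Submodule.restrictScalars ℂ
      ((Ideal.span (Set.range fun i : Fin 5 => (MvPolynomial.X i.succ : MvPolynomial (Fin 6) ℂ))) ^ 2)

/-- The quadric `q` in `F = x₀ q(x₁,…,x₅) + c(x₁,…,x₅)`. -/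
def quadricPart (F : MvPolynomial (Fin 6) ℂ) : MvPolynomial (Fin 5) ℂ :=
  (MvPolynomial.finSuccEquiv ℂ 5 F).coeff 1

/-- The cubic `c` in `F = x₀ q(x₁,…,x₅) + c(x₁,…,x₅)`. -/
def cubicPart (F : MvPolynomial (Fin 6) ℂ) : MvPolynomial (Fin 5) ℂ :=
  (MvPolynomial.finSuccEquiv ℂ 5 F).coeff 0

/-- The divisor on `P = Bl_0 ℙ^5 = {([x], [y]) ∈ ℙ^5 × ℙ^4 : (x₁,…,x₅) = l y for some l}` defined by
`F` as a section of `O(3)(-2e)`: as `e` is given by `l = 0` and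
`F(x₀, l y) = l² (x₀ q(y) + l c(y))`, its equation is `x₀ q(y) + l c(y) = 0`. -/
def divisorOf (F : MvPolynomial (Fin 6) ℂ) : Set (MP ![5, 4]) :=
  {a | ∃ l : ℂ, (∀ i : Fin 5, (a 0).rep i.succ = l * (a 1).rep i) ∧
    (a 0).rep 0 * MvPolynomial.eval (a 1).rep (quadricPart F) +
      l * MvPolynomial.eval (a 1).rep (cubicPart F) = 0}

/-- `X`: the base locus in `P` of the pencil spanned by `F₀` and `F₁`. -/
def baseLocus (F₀ F₁ : MvPolynomial (Fin 6) ℂ) : Set (MP ![5, 4]) :=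
  {a | ∀ F ∈ Submodule.span ℂ {F₀, F₁}, a ∈ divisorOf F}

/-- `Y`: the intersection in `ℙ^4 × ℙ^1` of the `(2,1)` divisor `u q₀ + t q₁ = 0` and the `(3,1)`
divisor `u c₀ + t c₁ = 0`. -/
def dualThreefold (F₀ F₁ : MvPolynomial (Fin 6) ℂ) : Set (MP ![4, 1]) :=
  {b | (b 1).rep 0 * MvPolynomial.eval (b 0).rep (quadricPart F₀) +
        (b 1).rep 1 * MvPolynomial.eval (b 0).rep (quadricPart F₁) = 0 ∧
      (b 1).rep 0 * MvPolynomial.eval (b 0).rep (cubicPart F₀) +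
        (b 1).rep 1 * MvPolynomial.eval (b 0).rep (cubicPart F₁) = 0}

/-- The bundle projection `ρ : P → ℙ^4`. -/
def rhoMap (a : MP ![5, 4]) : PSpace 4 := fun _ => a 1

/-- The projection `ℙ^4 × ℙ^1 → ℙ^4`. -/
def projMap (b : MP ![4, 1]) : PSpace 4 := fun _ => b 0

/-- The polynomial `q₀ c₁ - q₁ c₀`. -/
def quintic (F₀ F₁ : MvPolynomial (Fin 6) ℂ) : MvPolynomial (Fin 5) ℂ :=
  quadricPart F₀ * cubicPart F₁ - quadricPart F₁ * cubicPart F₀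

/-- `R` holds for the generic pencil: for all pairs of generators in some nonempty Zariski open
subset of the space of pairs of cubics with a double point at `0`. -/
def ForGenericPencil
    (R : MvPolynomial (Fin 6) ℂ → MvPolynomial (Fin 6) ℂ → Prop) : Prop :=
  ∃ D : MvPolynomial (Fin 2 × (Fin 6 →₀ ℕ)) ℂ,
    (∃ F ∈ doublePointCubics, ∃ F' ∈ doublePointCubics,
      MvPolynomial.eval (fun s => MvPolynomial.coeff s.2 (![F, F'] s.1)) D ≠ 0) ∧
    ∀ F ∈ doublePointCubics, ∀ F' ∈ doublePointCubics,
      MvPolynomial.eval (fun s => MvPolynomial.coeff s.2 (![F, F'] s.1)) D ≠ 0 → R F F'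

end CubicPencil

end

open scoped LinearAlgebra.Projectivization

noncomputable section

namespace CubicPencil

open MvPolynomial

/-! ### Elimination of variables on products of projective spaces -/

section Elimination

variable {P σ κ r : Type*} [DecidableEq κ]

/-! Everything is governed by the 2×2 matrix M(y) with rows (q₀, q∞) and (c₀, c∞), whose determinant
is the quintic. A point of X over y is a vector (α : β) with α q_k + β c_k = 0 for both k, placed in
P as [α : βy]. A point of Y over y is a vector (u : t) killed by M(y) from the other side. Such
vectors exist exactly where det M = 0, are unique where M has rank one and fill a ℙ¹ where M = 0.
Hence both images are Q, both maps are isomorphisms away from the base points q₀ = q∞ = c₀ = c∞ = 0,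
and the fibres over the base points are lines. If det M vanished identically, there would be a
kernel vector with polynomial entries and X would contain a fourfold, so it could not be smooth of
dimension three (`not_isSmoothOfDim_of_kernel`).

A base point is always singular on Q. As the determinant is a nondegenerate quadratic form in the
four entries, it is a node exactly if the gradients of the four entries are independent there
(`rank_hessian_eq_four_iff`). A singular point of Q elsewhere yields a critical triple (y, γ, a):
kernel vectors γ, a of M(y) on the two sides for which the contraction of dM with γ ⊗ a vanishes.
The absence of critical triples also makes X and Y smooth.

Both the absence of critical triples and the transversality of the four forms are Zariski open
conditions on the pencil, by elimination theory on products of projective spaces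
(`exists_eval_ne_zero_of_forall_zero`). One example of each is therefore enough: a diagonal pencil
(`exists_noCriticalTriple`) and a Fermat system. For the generic pencil the singular points of Q are
thus the transverse common zeros of forms of degrees 2, 2, 3, 3, and Bézout's theorem counts 36.
Bézout's theorem itself comes from joining a transverse system to a Fermat system by a pencil: the
number of zeros is locally constant along the good parameters, which form the complement of a finite
set in ℂ and hence a connected set.

Conversely, suppose that Q has exactly 36 singular points, all nodes. The base points are among
them, so they are finite in number and transverse; by Bézout there are 36, so there are no other
singular points and no critical triples. The common blow-up W is the fibre product of X and Y over
ℙ⁴. On X the rows of M are proportional, so locally one row generates the ideal of the exceptional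
curves, and the equation satisfied by (u : t) is that of the blow-up (`isBlowUp_fstMap`). On Y the
same holds with columns (`isBlowUp_sndMap`). Over a base point the fibre product is the product of
the two fibres. -/

/-- The block weight attached to a partition of the variables. -/
abbrev blockWeight (π : σ → κ) (s : σ) : κ → ℕ := Pi.single (π s) 1

lemma weight_blockWeight_apply [Fintype σ] (π : σ → κ) (b : σ →₀ ℕ) (k : κ) :
    Finsupp.weight (blockWeight π) b k = ∑ s, if π s = k then b s else 0 := by
  classical
  rw [Finsupp.weight_apply, Finsupp.sum_fintype _ _ (by simp), Finset.sum_apply]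
  refine Finset.sum_congr rfl fun s _ => ?_
  by_cases h : π s = k
  · subst h; simp
  · simp [h]

/-- Each exponent is bounded by the degree of its block. The monomials of a fixed multidegree can
therefore index a square matrix. -/
lemma finite_setOf_weight_eq [Fintype σ] (π : σ → κ) (m : κ → ℕ) :
    {b : σ →₀ ℕ | Finsupp.weight (blockWeight π) b = m}.Finite := by
  classical
  refine (Set.finite_Iic (Finsupp.equivFunOnFinite.symm fun s => m (π s))).subset ?_
  intro b hb s
  rw [Set.mem_ofPred_eq] at hb
  rw [← hb, Finsupp.equivFunOnFinite_symm_apply_apply, weight_blockWeight_apply]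
  exact (le_of_eq (by simp)).trans (Finset.single_le_sum
    (f := fun t => if π t = π s then b t else 0) (fun _ _ => Nat.zero_le _) (Finset.mem_univ s))

/-- Rescaling the blocks of variables multiplies the value of a multihomogeneous polynomial. -/
lemma eval_blockScale [Fintype σ] [Fintype κ] {π : σ → κ} {p : MvPolynomial σ ℂ} {m : κ → ℕ}
    (hp : IsWeightedHomogeneous (blockWeight π) p m) (c : κ → ℂ) (z : σ → ℂ) :
    eval (fun s => c (π s) * z s) p = (∏ k, c k ^ m k) * eval z p := by
  rw [eval_eq', eval_eq', Finset.mul_sum]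
  refine Finset.sum_congr rfl fun b hb => ?_
  have hm := hp (mem_support_iff.1 hb)
  have h1 : ∏ s, c (π s) ^ b s = ∏ k, c k ^ m k := by
    rw [← Finset.prod_fiberwise Finset.univ π]
    refine Finset.prod_congr rfl fun k _ => ?_
    rw [← hm, weight_blockWeight_apply, ← Finset.sum_filter, ← Finset.prod_pow_eq_pow_sum]
    exact Finset.prod_congr rfl fun s hs => by rw [(Finset.mem_filter.1 hs).2]
  simp only [mul_pow, Finset.prod_mul_distrib]
  rw [h1]
  ring

/-- If every common zero of `f` has a vanishing block, then the ideal generated by `f` contains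
all monomials of large multidegree `(d, …, d)`. -/
lemma exists_monomial_mem_span [Fintype σ] [Finite r] [Fintype κ] (π : σ → κ) (f : r → MvPolynomial σ ℂ)
    (h0 : ∀ z : σ → ℂ, (∀ i, eval z (f i) = 0) → ∃ k, ∀ s, π s = k → z s = 0) :
    ∃ d : ℕ, ∀ b : σ →₀ ℕ, Finsupp.weight (blockWeight π) b = (fun _ => d) →
      monomial b 1 ∈ Ideal.span (Set.range f) := by
  classical
  set I := Ideal.span (Set.range f)
  -- By the Nullstellensatz: a product of one variable from each block vanishes at every common
  -- zero, so a power of it lies in the ideal.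
  have key : ∀ c : κ → σ, ∃ N : ℕ, (∀ k, π (c k) = k) → (∏ k, (X (c k) : MvPolynomial σ ℂ)) ^ N ∈ I := by
    intro c
    by_cases hc : ∀ k, π (c k) = k
    · have : (∏ k, (X (c k) : MvPolynomial σ ℂ)) ∈ I.radical := by
        rw [← vanishingIdeal_zeroLocus_eq_radical (K := ℂ) I, mem_vanishingIdeal_iff]
        intro z hz
        rw [mem_zeroLocus_iff] at hz
        obtain ⟨k, hk⟩ := h0 z fun i => by
          simpa [aeval_eq_eval] using hz (f i) (Ideal.subset_span ⟨i, rfl⟩)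
        rw [map_prod]
        exact Finset.prod_eq_zero (Finset.mem_univ k) (by simpa using hk _ (hc k))
      obtain ⟨N, hN⟩ := this
      exact ⟨N, fun _ => hN⟩
    · exact ⟨0, fun h => absurd h hc⟩
  choose N hN using key
  set M := ∑ c, N c
  -- Pigeonhole: with this degree in every block, each block contains a variable of exponent at
  -- least M, and M exceeds all the Nullstellensatz exponents.
  refine ⟨M * Fintype.card σ + 1, fun b hb => ?_⟩
  have hex : ∀ k, ∃ s, π s = k ∧ M ≤ b s := by
    intro k
    by_contra! hcon
    have h1 := congrFun hb k
    rw [weight_blockWeight_apply] at h1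
    have h2 : ∑ s, (if π s = k then b s else 0) ≤ ∑ s : σ, M := by
      refine Finset.sum_le_sum fun s _ => ?_
      split_ifs with h
      · exact (hcon s h).le
      · exact Nat.zero_le _
    simp only [Finset.sum_const, Finset.card_univ, smul_eq_mul] at h2
    rw [h1, mul_comm] at h2
    omega
  choose c hc hcM using hex
  have hinj : Function.Injective c := fun x y hxy => by rw [← hc x, hxy, hc y]
  have hmem : (∏ k, (X (c k) : MvPolynomial σ ℂ)) ^ M ∈ I := by
    have : N c ≤ M := Finset.single_le_sum (f := N) (fun _ _ => Nat.zero_le _) (Finset.mem_univ c)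
    exact Ideal.mem_of_dvd I (pow_dvd_pow _ this) (hN c hc)
  have hdvd : (∏ k, (X (c k) : MvPolynomial σ ℂ)) ^ M ∣ monomial b 1 := by
    rw [← Finset.prod_pow]
    simp only [X_pow_eq_monomial]
    rw [← monomial_sum_one]
    rw [monomial_dvd_monomial]
    refine ⟨Or.inr ?_, one_dvd _⟩
    intro s
    rw [Finsupp.finsetSum_apply]
    by_cases hs : ∃ k, c k = s
    · obtain ⟨k, rfl⟩ := hs
      rw [Finset.sum_eq_single k]
      · simpa using hcM k
      · intro j _ hj
        exact Finsupp.single_eq_of_ne (fun h => hj (hinj h.symm))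
      · simp
    · push Not at hs
      rw [Finset.sum_eq_zero]
      · exact Nat.zero_le _
      · intro k _
        exact Finsupp.single_eq_of_ne (hs k).symm
  exact Ideal.mem_of_dvd I hdvd hmem

/-- Multiplication by a homogeneous polynomial shifts homogeneous components. -/
lemma coeff_mul_filter {R M : Type*} [CommSemiring R] [AddCommMonoid M] [DecidableEq M]
    [IsCancelAdd M]
    (w : σ → M) {e : M} {f : MvPolynomial σ R} (hf : IsWeightedHomogeneous w f e)
    (g g' : MvPolynomial σ R) (m : M)
    (hg : ∀ x, coeff x g' = if Finsupp.weight w x + e = m then coeff x g else 0)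
    (b : σ →₀ ℕ) :
    coeff b (g' * f) = if Finsupp.weight w b = m then coeff b (g * f) else 0 := by
  classical
  rw [coeff_mul, coeff_mul]
  have : ∀ p ∈ Finset.HasAntidiagonal.antidiagonal b, coeff p.1 g' * coeff p.2 f =
      if Finsupp.weight w b = m then coeff p.1 g * coeff p.2 f else 0 := by
    rintro ⟨x, y⟩ hp
    rw [Finset.HasAntidiagonal.mem_antidiagonal] at hp
    dsimp only at hp ⊢
    by_cases hy : coeff y f = 0
    · simp [hy]
    · have hye := hf hy
      rw [hg, ← hp, map_add, hye]
      split_ifs <;> simp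
  rw [Finset.sum_congr rfl this]
  split_ifs <;> simp

/-- The main theorem of elimination theory for products of projective spaces, in the form needed to
show that conditions are open. At p₀ every monomial of some large multidegree is a combination of
the equations. With the multipliers frozen, the combinations at a general p have a square
coefficient matrix that is the identity at p₀; D is its determinant. Where D ≠ 0, all these
monomials still vanish at each common zero. -/
theorem exists_eval_ne_zero_of_forall_zero [Fintype σ] [Fintype r] [Fintype κ] (π : σ → κ)
    (f : r → MvPolynomial σ (MvPolynomial P ℂ)) (e : r → κ → ℕ)
    (hf : ∀ i, IsWeightedHomogeneous (blockWeight π) (f i) (e i)) (p₀ : P → ℂ)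
    (h0 : ∀ z : σ → ℂ, (∀ i, eval z (map (eval p₀) (f i)) = 0) → ∃ k, ∀ s, π s = k → z s = 0) :
    ∃ D : MvPolynomial P ℂ, eval p₀ D ≠ 0 ∧ ∀ p : P → ℂ, eval p D ≠ 0 →
      ∀ z : σ → ℂ, (∀ i, eval z (map (eval p) (f i)) = 0) → ∃ k, ∀ s, π s = k → z s = 0 := by
  classical
  obtain ⟨d, hd⟩ := exists_monomial_mem_span π _ h0
  set m : κ → ℕ := fun _ => d
  set w := blockWeight π
  set B := (finite_setOf_weight_eq π m).toFinset with hB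
  have memB : ∀ b, b ∈ B ↔ Finsupp.weight w b = m := fun b => by simp [hB, w]
  have hg : ∀ b : B, ∃ g : r → MvPolynomial σ ℂ,
      ∑ i, g i * map (eval p₀) (f i) = monomial b.1 1 := by
    intro b
    exact Ideal.mem_span_range_iff_exists_fun.1 (hd b.1 ((memB _).1 b.2))
  choose g hg using hg
  -- The multipliers are cut down to the component of complementary multidegree, so that the
  -- combination is homogeneous of multidegree m for every p and not only at p₀.
  have hfilt : ∀ (b : B) (i : r), ∃ g' : MvPolynomial σ ℂ, ∀ x, coeff x g' =
      if Finsupp.weight w x + e i = m then coeff x (g b i) else 0 := by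
    intro b i
    refine ⟨∑ x ∈ (g b i).support.filter (fun x => Finsupp.weight w x + e i = m),
      monomial x (coeff x (g b i)), fun x => ?_⟩
    rw [coeff_sum]
    simp only [coeff_monomial]
    rw [Finset.sum_ite_eq']
    simp only [Finset.mem_filter, mem_support_iff]
    by_cases h1 : Finsupp.weight w x + e i = m <;> by_cases h2 : coeff x (g b i) = 0 <;>
      simp [h1, h2]
  choose g' hg' using hfilt
  let V : B → MvPolynomial σ (MvPolynomial P ℂ) := fun b => ∑ i, map C (g' b i) * f i
  have hmap : ∀ p b, map (eval p) (V b) = ∑ i, g' b i * map (eval p) (f i) := by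
    intro p b
    simp only [V, map_sum, map_mul, map_map]
    refine Finset.sum_congr rfl fun i _ => ?_
    congr 1
    have : (eval p).comp (C : ℂ →+* MvPolynomial P ℂ) = RingHom.id ℂ := by ext; simp
    rw [this, map_id]
  have hfp : ∀ p i, IsWeightedHomogeneous w (map (eval p) (f i)) (e i) := by
    intro p i x hx
    refine hf i fun h => hx ?_
    rw [coeff_map, h, map_zero]
  have hcoeff : ∀ p (b : B) x, coeff x (map (eval p) (V b)) =
      if Finsupp.weight w x = m then ∑ i, coeff x (g b i * map (eval p) (f i)) else 0 := by
    intro p b x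
    rw [hmap, coeff_sum, Finset.sum_congr rfl fun i _ =>
      coeff_mul_filter w (hfp p i) (g b i) (g' b i) m (hg' b i) x]
    split_ifs <;> simp
  let A : Matrix B B (MvPolynomial P ℂ) := Matrix.of fun b b' => coeff b'.1 (V b)
  have hdet : ∀ p, eval p A.det = (Matrix.of fun b b' : B => coeff b'.1 (map (eval p) (V b))).det := by
    intro p
    rw [RingHom.map_det]
    congr 1
  refine ⟨A.det, ?_, fun p hp z hz => ?_⟩
  · rw [hdet]
    have : (Matrix.of fun b b' : B => coeff b'.1 (map (eval p₀) (V b))) = 1 := by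
      ext b b'
      rw [Matrix.of_apply, hcoeff, if_pos ((memB _).1 b'.2), ← coeff_sum, hg, coeff_monomial,
        Matrix.one_apply]
      exact if_congr Subtype.ext_iff.symm rfl rfl
    rw [this, Matrix.det_one]
    exact one_ne_zero
  · rw [hdet] at hp
    -- The vector of monomials evaluated at a common zero is killed by an invertible matrix.
    have hz0 : Matrix.mulVec (Matrix.of fun b b' : B => coeff b'.1 (map (eval p) (V b)))
        (fun b' => ∏ s, z s ^ b'.1 s) = 0 := by
      ext b
      have h1 : eval z (map (eval p) (V b)) = 0 := by
        rw [hmap, map_sum]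
        exact Finset.sum_eq_zero fun i _ => by rw [map_mul, hz i, mul_zero]
      rw [eval_eq'] at h1
      rw [Matrix.mulVec, dotProduct, Pi.zero_apply, ← h1]
      simp only [Matrix.of_apply]
      rw [Finset.sum_coe_sort B (fun b' => coeff b' (map (eval p) (V b)) * ∏ s, z s ^ b' s)]
      symm
      refine Finset.sum_subset (fun x hx => ?_) (fun x _ hx => ?_)
      · rw [memB]
        by_contra hne
        rw [mem_support_iff, hcoeff, if_neg hne] at hx
        exact hx rfl
      · rw [notMem_support_iff.1 hx, zero_mul]
    have hz1 := Matrix.eq_zero_of_mulVec_eq_zero hp hz0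
    by_contra! hcon
    choose c hc hcz using hcon
    have hinj : Function.Injective c := fun x y hxy => by rw [← hc x, hxy, hc y]
    -- If no block of z vanished, this product of d-th powers of nonzero coordinates, one from each
    -- block, would be a nonvanishing monomial of multidegree m.
    let b : σ →₀ ℕ := ∑ k, Finsupp.single (c k) d
    have hb : b ∈ B := by
      rw [memB]
      funext k
      simp only [b, map_sum, Finsupp.weight_single, Finset.sum_apply, w, blockWeight, hc]
      simp [m, Pi.single_apply]
    have := congrFun hz1 ⟨b, hb⟩
    simp only [Pi.zero_apply] at this
    obtain ⟨s, -, hs⟩ := Finset.prod_eq_zero_iff.1 this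
    obtain ⟨hs1, hs2⟩ := (pow_eq_zero_iff').1 hs
    have : ∃ k, c k = s := by
      by_contra! hne
      apply hs2
      simp only [b, Finsupp.finsetSum_apply]
      exact Finset.sum_eq_zero fun k _ => Finsupp.single_eq_of_ne (hne k).symm
    obtain ⟨k, rfl⟩ := this
    exact hcz k hs1

end Elimination

section

open Filter Topology

/-! ### Local constancy of the number of nondegenerate zeros -/

section LocalConstancy

variable {E : Type*} [NormedAddCommGroup E] [NormedSpace ℂ E] [CompleteSpace E]

/-- Near a nondegenerate zero, a family of equations has exactly one zero. -/
lemma exists_nhds_unique_zero {Ψ : ℂ × E → E} {s₀ : ℂ} {p : E}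
    (hΨ : ContDiff ℂ 1 Ψ) (h0 : Ψ (s₀, p) = 0) {B : E →L[ℂ] E}
    (hB : HasFDerivAt (fun y => Ψ (s₀, y)) B p) (hbij : Function.Bijective B)
    {W : Set E} (hW : W ∈ 𝓝 p) :
    ∃ V, V ⊆ W ∧ IsOpen V ∧ p ∈ V ∧ ∀ᶠ s in 𝓝 s₀, ∃! y, y ∈ V ∧ Ψ (s, y) = 0 := by
  set D := fderiv ℂ Ψ (s₀, p)
  have hD : HasStrictFDerivAt Ψ D (s₀, p) :=
    hΨ.contDiffAt.hasStrictFDerivAt one_ne_zero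
  have hDB : ∀ v, D (0, v) = B v := by
    intro v
    have h1 : HasFDerivAt (fun y : E => ((s₀, y) : ℂ × E)) (ContinuousLinearMap.inr ℂ ℂ E) p :=
      hasFDerivAt_prodMk_right s₀ p
    have h2 := (hD.hasFDerivAt.comp p h1).unique hB
    rw [← h2]; simp
  -- The inverse function theorem is applied to this map over the parameter line. Zeros of the
  -- equation at parameter s are its preimages of (s, 0).
  let G : ℂ × E → ℂ × E := fun q => (q.1, Ψ q)
  let L : ℂ × E →L[ℂ] ℂ × E := (ContinuousLinearMap.fst ℂ ℂ E).prod D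
  have hker : L.ker = ⊥ := by
    rw [LinearMap.ker_eq_bot']
    rintro ⟨a, v⟩ hav
    have h1 : a = 0 := congrArg Prod.fst hav
    have h2 : D (a, v) = 0 := congrArg Prod.snd hav
    subst h1
    rw [hDB] at h2
    have : v = 0 := hbij.1 (by rw [h2, map_zero])
    rw [this]; rfl
  have hrange : L.range = ⊤ := by
    rw [LinearMap.range_eq_top]
    rintro ⟨a, v⟩
    obtain ⟨u, hu⟩ := hbij.2 (v - D (a, 0))
    refine ⟨(a, u), Prod.ext rfl ?_⟩
    change D (a, u) = v
    have : ((a, u) : ℂ × E) = (a, 0) + (0, u) := by simp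
    rw [this, map_add, hDB, hu]; abel
  let Le := ContinuousLinearEquiv.ofBijective L hker hrange
  have hG : HasStrictFDerivAt G (Le : ℂ × E →L[ℂ] ℂ × E) (s₀, p) := by
    rw [ContinuousLinearEquiv.coe_ofBijective]
    exact (hasStrictFDerivAt_fst).prodMk hD
  let e := hG.toOpenPartialHomeomorph G
  have he : ∀ q, e q = G q := fun q => rfl
  have hmem : (s₀, p) ∈ e.source := hG.mem_toOpenPartialHomeomorph_source
  have hsrc : e.source ∩ (Prod.snd ⁻¹' W) ∈ 𝓝 (s₀, p) :=
    inter_mem (e.open_source.mem_nhds hmem) (continuous_snd.continuousAt.preimage_mem_nhds hW)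
  obtain ⟨A, hA, V₀, hV₀, hAV₀⟩ := mem_nhds_prod_iff.1 hsrc
  obtain ⟨V, hVV₀, hVo, hpV⟩ := mem_nhds_iff.1 hV₀
  have hAV : A ×ˢ V ⊆ e.source ∩ (Prod.snd ⁻¹' W) :=
    (Set.prod_mono_right hVV₀).trans hAV₀
  have hsA : s₀ ∈ A := mem_of_mem_nhds hA
  refine ⟨V, fun v hv => (hAV (Set.mk_mem_prod hsA hv)).2, hVo, hpV, ?_⟩
  have hG0 : e (s₀, p) = (s₀, 0) := by rw [he]; simp [G, h0]
  have hcont : ContinuousAt e.symm (s₀, 0) := by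
    rw [← hG0]; exact e.continuousAt_symm (e.map_source hmem)
  have hline : Tendsto (fun s : ℂ => ((s, 0) : ℂ × E)) (𝓝 s₀) (𝓝 (s₀, 0)) :=
    (Continuous.prodMk_left (0 : E)).tendsto s₀
  have h1 : ∀ᶠ s in 𝓝 s₀, e.symm (s, 0) ∈ A ×ˢ V := by
    refine (hcont.tendsto.comp hline).eventually_mem ?_
    rw [← hG0, e.left_inv hmem]
    exact prod_mem_nhds hA (hVo.mem_nhds hpV)
  have h2 : ∀ᶠ s in 𝓝 s₀, ((s, 0) : ℂ × E) ∈ e.target := by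
    refine hline.eventually_mem (e.open_target.mem_nhds ?_)
    rw [← hG0]; exact e.map_source hmem
  filter_upwards [h1, h2, hA] with s hs1 hs2 hsA
  have h3 := e.right_inv hs2
  rw [he] at h3
  have h4 : (e.symm (s, 0)).1 = s := congrArg Prod.fst h3
  have h5 : Ψ (e.symm (s, 0)) = 0 := congrArg Prod.snd h3
  refine ⟨(e.symm (s, 0)).2, ⟨hs1.2, ?_⟩, ?_⟩
  · have h6 : (s, (e.symm (s, 0)).2) = e.symm (s, 0) := Prod.ext h4.symm rfl
    rw [h6]; exact h5
  · rintro y ⟨hy, hy0⟩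
    have h6 : (s, y) ∈ e.source := (hAV (Set.mk_mem_prod hsA hy)).1
    have h7 : e (s, y) = (s, 0) := by rw [he]; simp [G, hy0]
    rw [← h7, e.left_inv h6]

/-- Each zero at s₀ continues to exactly one zero in a small neighbourhood. The uniform bound
confines all zeros to a compact ball, and on the part of the ball outside these neighbourhoods the
equation stays nonzero, so none appear elsewhere. -/
lemma eventually_ncard_zeros_eq [ProperSpace E] {Ψ : ℂ × E → E} {s₀ : ℂ}
    (hΨ : ContDiff ℂ 1 Ψ)
    (hB : ∀ p, Ψ (s₀, p) = 0 → ∃ B : E →L[ℂ] E, HasFDerivAt (fun y => Ψ (s₀, y)) B p ∧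
      Function.Bijective B)
    (hR : ∃ R : ℝ, ∀ᶠ s in 𝓝 s₀, ∀ y, Ψ (s, y) = 0 → ‖y‖ ≤ R) :
    {y | Ψ (s₀, y) = 0}.Finite ∧
      ∀ᶠ s in 𝓝 s₀, {y | Ψ (s, y) = 0}.ncard = {y | Ψ (s₀, y) = 0}.ncard := by
  obtain ⟨R, hR⟩ := hR
  set Z := {y | Ψ (s₀, y) = 0} with hZ
  have hcontp : ∀ s, Continuous fun y => Ψ (s, y) := fun s =>
    hΨ.continuous.comp (Continuous.prodMk_right s)
  have hZc : IsCompact Z := by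
    refine (isCompact_closedBall (0 : E) R).of_isClosed_subset
      (isClosed_singleton.preimage (hcontp s₀)) ?_
    intro y hy
    simpa using hR.self_of_nhds y hy
  have hloc : ∀ p ∈ Z, ∀ W ∈ 𝓝 p,
      ∃ V, V ⊆ W ∧ IsOpen V ∧ p ∈ V ∧ ∀ᶠ s in 𝓝 s₀, ∃! y, y ∈ V ∧ Ψ (s, y) = 0 := by
    intro p hp W hW
    obtain ⟨B, hB1, hB2⟩ := hB p hp
    exact exists_nhds_unique_zero hΨ hp hB1 hB2 hW
  have hfin : Z.Finite := by
    have : ∀ p ∈ Z, ∃ V ∈ 𝓝 p, ∀ y ∈ V, y ∈ Z → y = p := by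
      intro p hp
      obtain ⟨V, -, hVo, hpV, hV⟩ := hloc p hp Set.univ univ_mem
      exact ⟨V, hVo.mem_nhds hpV, fun y hy hyZ => hV.self_of_nhds.unique ⟨hy, hyZ⟩ ⟨hpV, hp⟩⟩
    choose! V hV hVu using this
    obtain ⟨t, ht, hcov⟩ := hZc.elim_nhds_subcover V hV
    refine t.finite_toSet.subset fun y hy => ?_
    obtain ⟨p, hp, hyp⟩ := Set.mem_iUnion₂.1 (hcov hy)
    rw [hVu p (ht p hp) y hyp hy]
    exact hp
  refine ⟨hfin, ?_⟩
  obtain ⟨U, hU, hUd⟩ := hfin.t2_separation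
  have : ∀ p ∈ Z, ∃ V, V ⊆ U p ∧ IsOpen V ∧ p ∈ V ∧ ∀ᶠ s in 𝓝 s₀, ∃! y, y ∈ V ∧ Ψ (s, y) = 0 :=
    fun p hp => hloc p hp _ ((hU p).2.mem_nhds (hU p).1)
  choose! V hVU hVo hpV hV using this
  have hK : IsCompact (Metric.closedBall (0 : E) R \ ⋃ p ∈ Z, V p) :=
    (isCompact_closedBall _ _).diff (isOpen_biUnion hVo)
  have hK0 : ∀ᶠ s in 𝓝 s₀, ∀ y ∈ Metric.closedBall (0 : E) R \ ⋃ p ∈ Z, V p, Ψ (s, y) ≠ 0 := by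
    refine hK.eventually_forall_of_forall_eventually fun y hy => ?_
    refine hΨ.continuous.continuousAt.eventually_ne fun h0 => hy.2 ?_
    exact Set.mem_biUnion (show y ∈ Z from h0) (hpV y h0)
  filter_upwards [hR, hK0, (hfin.eventually_all).2 hV] with s hsR hsK hsV
  choose! y hy hyu using hsV
  symm
  refine Set.ncard_congr (fun p _ => y p) (fun p hp => (hy p hp).2) ?_ ?_
  · intro p p' hp hp' hpp'
    by_contra hne
    refine Set.disjoint_left.1 (hUd hp hp' hne) (hVU p hp (hy p hp).1) ?_
    rw [hpp']
    exact hVU p' hp' (hy p' hp').1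
  · intro x hx
    have hxV : x ∈ ⋃ p ∈ Z, V p := by
      by_contra hcon
      exact hsK x ⟨by simpa using hsR x hx, hcon⟩ hx
    obtain ⟨p, hp, hxp⟩ := Set.mem_iUnion₂.1 hxV
    exact ⟨p, hp, (hyu p hp x ⟨hxp, hx⟩).symm⟩

end LocalConstancy

/-! ### Jacobians of systems of homogeneous polynomials -/

section Jacobian

/-- The determinant of the Jacobian matrix of `n` polynomials in `n + 1` variables, augmented by
the coefficients of a linear form `l`. -/
def jacDet {R : Type*} [CommRing R] {n : ℕ} (l : Fin (n + 1) → R)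
    (f : Fin n → MvPolynomial (Fin (n + 1)) R) : MvPolynomial (Fin (n + 1)) R :=
  (Matrix.of (Fin.cons (fun i => C (l i)) fun k i => pderiv i (f k) :
    Fin (n + 1) → Fin (n + 1) → MvPolynomial (Fin (n + 1)) R)).det

lemma map_jacDet {R S : Type*} [CommRing R] [CommRing S] {n : ℕ} (φ : R →+* S)
    (l : Fin (n + 1) → R) (f : Fin n → MvPolynomial (Fin (n + 1)) R) :
    map φ (jacDet l f) = jacDet (fun i => φ (l i)) (fun k => map φ (f k)) := by
  rw [jacDet, jacDet, RingHom.map_det]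
  congr 1
  ext1 i j
  refine Fin.cases ?_ (fun k => ?_) i <;> simp [pderiv_map]

lemma eval_jacDet {R : Type*} [CommRing R] {n : ℕ} (l : Fin (n + 1) → R)
    (f : Fin n → MvPolynomial (Fin (n + 1)) R) (y : Fin (n + 1) → R) :
    eval y (jacDet l f) = (Matrix.of (Fin.cons l fun k i => eval y (pderiv i (f k)) :
      Fin (n + 1) → Fin (n + 1) → R)).det := by
  rw [jacDet, RingHom.map_det]
  congr 1
  ext1 i j
  refine Fin.cases ?_ (fun k => ?_) i <;> simp

lemma isHomogeneous_jacDet {R : Type*} [CommRing R] {n : ℕ} (l : Fin (n + 1) → R)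
    {f : Fin n → MvPolynomial (Fin (n + 1)) R} {d : Fin n → ℕ}
    (hf : ∀ k, (f k).IsHomogeneous (d k)) :
    (jacDet l f).IsHomogeneous (∑ k, (d k - 1)) := by
  -- After transposing, the i-th factor of each term of the expansion comes from row i, whose degree
  -- does not depend on the permutation.
  rw [jacDet, ← Matrix.det_transpose, Matrix.det_apply]
  refine IsHomogeneous.sum _ _ _ fun σ _ => ?_
  have hsum : ∑ k, (d k - 1) = ∑ i : Fin (n + 1), (Fin.cons 0 (fun k => d k - 1) : Fin (n + 1) → ℕ) i := by
    simp [Fin.sum_univ_succ]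
  have : (∏ i, (Matrix.of (Fin.cons (fun i => C (l i)) fun k i => pderiv i (f k) :
      Fin (n + 1) → Fin (n + 1) → MvPolynomial (Fin (n + 1)) R)).transpose (σ i) i).IsHomogeneous
      (∑ k, (d k - 1)) := by
    rw [hsum]
    refine IsHomogeneous.prod _ _ _ fun i _ => ?_
    refine Fin.cases ?_ (fun k => ?_) i
    · simpa using isHomogeneous_C _ _
    · simpa using (hf k).pderiv
  rcases Int.units_eq_one_or (Equiv.Perm.sign σ) with h | h <;> rw [h]
  · simpa using this
  · simpa using this.neg

variable {n : ℕ} {l : Fin (n + 1) → ℂ} {f : Fin n → MvPolynomial (Fin (n + 1)) ℂ} {d : Fin n → ℕ}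
  {y : Fin (n + 1) → ℂ}

lemma isWeightedHomogeneous_blockWeight_unit {σ R : Type*} [Fintype σ] [CommRing R]
    {p : MvPolynomial σ R} {m : ℕ} (hp : p.IsHomogeneous m) :
    IsWeightedHomogeneous (blockWeight fun _ : σ => ()) p (fun _ => m) := by
  intro b hb
  funext k
  rw [weight_blockWeight_apply, ← hp hb]
  simp [Finsupp.weight_apply, Finsupp.sum_fintype]

lemma eval_smul_of_isHomogeneous {σ : Type*} [Fintype σ] {p : MvPolynomial σ ℂ} {m : ℕ}
    (hp : p.IsHomogeneous m) (c : ℂ) (y : σ → ℂ) : eval (c • y) p = c ^ m * eval y p :=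
  (eval_blockScale (isWeightedHomogeneous_blockWeight_unit hp) (fun _ => c) y).trans (by simp)

lemma euler_eval {σ : Type*} [Fintype σ] {p : MvPolynomial σ ℂ} {m : ℕ} (hp : p.IsHomogeneous m)
    (y : σ → ℂ) : ∑ i, y i * eval y (pderiv i p) = m * eval y p := by
  simpa using congrArg (eval y) hp.sum_X_mul_pderiv

/-- By Euler's relation the gradients at a common zero y all annihilate y. A linear form that does
not annihilate y is therefore independent of them. -/
lemma eval_jacDet_ne_zero (hf : ∀ k, (f k).IsHomogeneous (d k)) (h0 : ∀ k, eval y (f k) = 0)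
    (hl : ∑ i, l i * y i ≠ 0)
    (hli : LinearIndependent ℂ (fun k i => eval y (pderiv i (f k)))) :
    eval y (jacDet l f) ≠ 0 := by
  rw [eval_jacDet]
  refine IsUnit.ne_zero ((Matrix.isUnit_iff_isUnit_det _).1 ?_)
  rw [← Matrix.linearIndependent_rows_iff_isUnit]
  refine linearIndependent_finCons.2 ⟨hli, fun hmem => hl ?_⟩
  have : Submodule.span ℂ (Set.range fun k i => eval y (pderiv i (f k))) ≤
      LinearMap.ker (Fintype.linearCombination ℂ y) := by
    rw [Submodule.span_le]
    rintro _ ⟨k, rfl⟩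
    have := euler_eval (hf k) y
    rw [h0 k, mul_zero] at this
    simpa [Fintype.linearCombination_apply, mul_comm] using this
  simpa [Fintype.linearCombination_apply] using this hmem

lemma linearIndependent_of_eval_jacDet_ne_zero (h : eval y (jacDet l f) ≠ 0) :
    LinearIndependent ℂ (fun k i => eval y (pderiv i (f k))) := by
  rw [eval_jacDet] at h
  have := Matrix.linearIndependent_rows_iff_isUnit.2
    ((Matrix.isUnit_iff_isUnit_det _).2 (isUnit_iff_ne_zero.2 h))
  exact (linearIndependent_finCons.1 this).1

/-- Otherwise y itself lies in the kernel of the Jacobian matrix. So nonvanishing of `jacDet` at the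
common zeros expresses both transversality and the absence of zeros on the hyperplane l = 0. -/
lemma linearForm_ne_zero_of_eval_jacDet_ne_zero (hf : ∀ k, (f k).IsHomogeneous (d k))
    (h0 : ∀ k, eval y (f k) = 0) (hy : y ≠ 0) (h : eval y (jacDet l f) ≠ 0) :
    ∑ i, l i * y i ≠ 0 := by
  intro hl
  rw [eval_jacDet] at h
  refine hy (Matrix.eq_zero_of_mulVec_eq_zero h ?_)
  funext i
  refine Fin.cases ?_ (fun k => ?_) i
  · simpa [Matrix.mulVec, dotProduct] using hl
  · have := euler_eval (hf k) y
    rw [h0 k, mul_zero] at this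
    simpa [Matrix.mulVec, dotProduct, mul_comm] using this

/-- Transversality of the zeros of a homogeneous system is a Zariski open condition. -/
theorem exists_eval_ne_zero_transverse {P : Type*}
    {f : Fin n → MvPolynomial (Fin (n + 1)) (MvPolynomial P ℂ)}
    (hf : ∀ k, (f k).IsHomogeneous (d k)) (l : Fin (n + 1) → ℂ) (p₀ : P → ℂ)
    (h0 : ∀ y ≠ 0, (∀ k, eval y (map (eval p₀) (f k)) = 0) →
      eval y (jacDet l fun k => map (eval p₀) (f k)) ≠ 0) :
    ∃ D : MvPolynomial P ℂ, eval p₀ D ≠ 0 ∧ ∀ p : P → ℂ, eval p D ≠ 0 →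
      ∀ y ≠ 0, (∀ k, eval y (map (eval p) (f k)) = 0) →
        eval y (jacDet l fun k => map (eval p) (f k)) ≠ 0 := by
  have hj : ∀ p : P → ℂ, map (eval p) (jacDet (fun i => C (l i)) f) =
      jacDet l fun k => map (eval p) (f k) := by
    intro p
    rw [map_jacDet]
    simp
  -- Non-transverse zeros are the common zeros of the system enlarged by its Jacobian determinant,
  -- which is again homogeneous; elimination is used with a single block of variables.
  obtain ⟨D, hD0, hD⟩ := exists_eval_ne_zero_of_forall_zero (fun _ : Fin (n + 1) => ())
    (fun o : Option (Fin n) => o.elim (jacDet (fun i => C (l i)) f) f)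
    (fun o _ => o.elim (∑ k, (d k - 1)) d)
    (by
      rintro (_ | k)
      · exact isWeightedHomogeneous_blockWeight_unit (isHomogeneous_jacDet _ hf)
      · exact isWeightedHomogeneous_blockWeight_unit (hf k)) p₀
    (by
      intro y hy
      refine ⟨(), fun s _ => ?_⟩
      by_contra hs
      refine h0 y (fun h => hs (by rw [h]; rfl)) (fun k => hy (some k)) ?_
      rw [← hj]; exact hy none)
  refine ⟨D, hD0, fun p hp y hy hfy hjy => hy ?_⟩
  obtain ⟨_, hk⟩ := hD p hp y (by
    rintro (_ | k)
    · simp only [Option.elim]; rw [hj]; exact hjy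
    · exact hfy k)
  funext s
  exact hk s rfl

end Jacobian

/-! ### Counting transverse zeros of homogeneous systems -/

section Calculus

variable {σ : Type*} [Fintype σ]

lemma hasFDerivAt_eval (p : MvPolynomial σ ℂ) (y : σ → ℂ) :
    HasFDerivAt (fun y : σ → ℂ => eval y p)
      (∑ i, eval y (pderiv i p) • ContinuousLinearMap.proj (R := ℂ) (φ := fun _ : σ => ℂ) i) y := by
  classical
  induction p using MvPolynomial.induction_on with
  | C a =>
    simp only [eval_C]
    refine (hasFDerivAt_const (𝕜 := ℂ) a y).congr_fderiv ?_
    ext v; simp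
  | add p q hp hq =>
    simp only [map_add]
    refine (hp.add hq).congr_fderiv ?_
    ext v
    simp [add_mul, Finset.sum_add_distrib]
  | mul_X p j hp =>
    simp only [map_mul, eval_X]
    refine (hp.mul (hasFDerivAt_apply (𝕜 := ℂ) j y)).congr_fderiv ?_
    ext v
    simp only [Derivation.leibniz, pderiv_X, smul_eq_mul, map_add, map_mul, eval_X,
      _root_.sum_apply, _root_.smul_apply, ContinuousLinearMap.proj_apply,
      _root_.add_apply, Finset.mul_sum, add_mul, Finset.sum_add_distrib]
    congr 1
    · rw [Finset.sum_eq_single j]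
      · simp
      · intro i _ hi; simp [hi.symm]
      · simp
    · exact Finset.sum_congr rfl fun i _ => by ring

lemma contDiff_eval (p : MvPolynomial σ ℂ) : ContDiff ℂ 1 (fun y : σ → ℂ => eval y p) := by
  induction p using MvPolynomial.induction_on with
  | C a => simpa using contDiff_const
  | add p q hp hq => simpa using hp.add hq
  | mul_X p j hp => simpa using hp.mul (contDiff_apply ℂ ℂ j)

end Calculus

/-! ### Deformation of a system along a pencil -/

section Bezout

variable {n : ℕ}

/-- The points of the affine hyperplane `l = 1` at which all the `f k` vanish. -/
def affineZeros (l : Fin (n + 1) → ℂ) (f : Fin n → MvPolynomial (Fin (n + 1)) ℂ) :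
    Set (Fin (n + 1) → ℂ) :=
  {y | (∀ k, eval y (f k) = 0) ∧ ∑ i, l i * y i = 1}

/-- The pencil of systems through `g` and `f`. -/
def pencilAt (g f : Fin n → MvPolynomial (Fin (n + 1)) ℂ) (s : ℂ) (k : Fin n) :
    MvPolynomial (Fin (n + 1)) ℂ :=
  C (1 - s) * g k + C s * f k

/-- The system `f = 0`, `l = 1` for the members of a pencil, as a self-map of the affine space. -/
def pencilMap (l : Fin (n + 1) → ℂ) (g f : Fin n → MvPolynomial (Fin (n + 1)) ℂ)
    (q : ℂ × (Fin (n + 1) → ℂ)) : Fin (n + 1) → ℂ :=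
  Fin.cons (∑ i, l i * q.2 i - 1) fun k => eval q.2 (pencilAt g f q.1 k)

lemma pencilMap_eq_zero_iff (l : Fin (n + 1) → ℂ) (g f : Fin n → MvPolynomial (Fin (n + 1)) ℂ)
    (s : ℂ) (y : Fin (n + 1) → ℂ) :
    pencilMap l g f (s, y) = 0 ↔ y ∈ affineZeros l (pencilAt g f s) := by
  rw [funext_iff, Fin.forall_fin_succ, affineZeros, Set.mem_ofPred_eq, and_comm]
  simp [pencilMap, sub_eq_zero]

lemma contDiff_pencilMap (l : Fin (n + 1) → ℂ) (g f : Fin n → MvPolynomial (Fin (n + 1)) ℂ) :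
    ContDiff ℂ 1 (pencilMap l g f) := by
  rw [contDiff_pi]
  intro i
  refine Fin.cases ?_ (fun k => ?_) i
  · simp only [pencilMap, Fin.cons_zero]
    fun_prop
  · simp only [pencilMap, Fin.cons_succ, pencilAt, map_add, map_mul, eval_C]
    have h := fun p : MvPolynomial (Fin (n + 1)) ℂ =>
      (contDiff_eval p).comp (contDiff_snd (𝕜 := ℂ) (E := ℂ))
    exact ((contDiff_const.sub contDiff_fst).mul (h _)).add (contDiff_fst.mul (h _))

lemma isHomogeneous_pencilAt {g f : Fin n → MvPolynomial (Fin (n + 1)) ℂ} {d : Fin n → ℕ}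
    (hg : ∀ k, (g k).IsHomogeneous (d k)) (hf : ∀ k, (f k).IsHomogeneous (d k)) (s : ℂ) (k : Fin n) :
    (pencilAt g f s k).IsHomogeneous (d k) :=
  ((hg k).C_mul _).add ((hf k).C_mul _)

lemma exists_bijective_hasFDerivAt_pencilMap {l : Fin (n + 1) → ℂ}
    {g f : Fin n → MvPolynomial (Fin (n + 1)) ℂ} {s : ℂ} {y : Fin (n + 1) → ℂ}
    (h : eval y (jacDet l (pencilAt g f s)) ≠ 0) :
    ∃ B : (Fin (n + 1) → ℂ) →L[ℂ] (Fin (n + 1) → ℂ),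
      HasFDerivAt (fun y => pencilMap l g f (s, y)) B y ∧ Function.Bijective B := by
  rw [eval_jacDet] at h
  set A := (Matrix.of (Fin.cons l fun k i => eval y (pderiv i (pencilAt g f s k)) :
      Fin (n + 1) → Fin (n + 1) → ℂ))
  refine ⟨A.mulVecLin.toContinuousLinearMap, ?_, ?_⟩
  · rw [hasFDerivAt_pi']
    intro i
    refine Fin.cases ?_ (fun k => ?_) i
    · simp only [pencilMap, Fin.cons_zero]
      refine HasFDerivAt.sub_const 1 ?_
      have : HasFDerivAt (fun y : Fin (n + 1) → ℂ => ∑ i, l i * y i)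
          (∑ i, l i • ContinuousLinearMap.proj (R := ℂ) (φ := fun _ : Fin (n + 1) => ℂ) i) y :=
        HasFDerivAt.fun_sum fun i _ => (hasFDerivAt_apply (𝕜 := ℂ) i y).const_mul (l i)
      refine this.congr_fderiv ?_
      ext v
      simp [A, Matrix.mulVec, dotProduct]
    · simp only [pencilMap, Fin.cons_succ]
      refine (hasFDerivAt_eval (pencilAt g f s k) y).congr_fderiv ?_
      ext v
      simp [A, Matrix.mulVec, dotProduct]
  · have hinj : Function.Injective A.mulVecLin :=
      Matrix.mulVec_injective_of_isUnit
        ((Matrix.isUnit_iff_isUnit_det _).2 (isUnit_iff_ne_zero.2 h))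
    exact ⟨hinj, LinearMap.injective_iff_surjective.1 hinj⟩

/-- Zeros in the hyperplane `l = 1` stay bounded as long as no zeros approach `l = 0`. -/
lemma eventually_bounded_pencilMap {l : Fin (n + 1) → ℂ}
    {g f : Fin n → MvPolynomial (Fin (n + 1)) ℂ} {d : Fin n → ℕ}
    (hg : ∀ k, (g k).IsHomogeneous (d k)) (hf : ∀ k, (f k).IsHomogeneous (d k)) {s₀ : ℂ}
    (h : ∀ y ≠ 0, (∀ k, eval y (pencilAt g f s₀ k) = 0) → ∑ i, l i * y i ≠ 0) :
    ∃ R : ℝ, ∀ᶠ s in 𝓝 s₀, ∀ y, pencilMap l g f (s, y) = 0 → ‖y‖ ≤ R := by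
  have hcl : Continuous fun y : Fin (n + 1) → ℂ => ‖∑ i, l i * y i‖ := by fun_prop
  -- On the compact unit sphere, |l| is bounded below on the zeros, uniformly for parameters near
  -- s₀. The real component of q plays the role of the lower bound.
  have key : ∀ᶠ q : ℂ × ℝ in 𝓝 (s₀, 0), ∀ y ∈ Metric.sphere (0 : Fin (n + 1) → ℂ) 1,
      (∀ k, eval y (pencilAt g f q.1 k) = 0) → q.2 < ‖∑ i, l i * y i‖ := by
    refine (isCompact_sphere _ _).eventually_forall_of_forall_eventually fun y hy => ?_
    have hy0 : y ≠ 0 := by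
      rintro rfl
      simp at hy
    by_cases h0 : ∀ k, eval y (pencilAt g f s₀ k) = 0
    · have hlt : ∀ᶠ z : (ℂ × ℝ) × (Fin (n + 1) → ℂ) in 𝓝 ((s₀, 0), y),
          z.1.2 < ‖∑ i, l i * z.2 i‖ := by
        refine ContinuousAt.eventually_lt (by fun_prop) (by fun_prop) ?_
        exact norm_pos_iff.2 (h y hy0 h0)
      filter_upwards [hlt] with z hz _ using hz
    · push Not at h0
      obtain ⟨k, hk⟩ := h0
      have hne : ∀ᶠ z : (ℂ × ℝ) × (Fin (n + 1) → ℂ) in 𝓝 ((s₀, 0), y),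
          eval z.2 (pencilAt g f z.1.1 k) ≠ 0 := by
        have hc : Continuous fun z : (ℂ × ℝ) × (Fin (n + 1) → ℂ) =>
            eval z.2 (pencilAt g f z.1.1 k) := by
          simp only [pencilAt, map_add, map_mul, eval_C]
          have h := fun p : MvPolynomial (Fin (n + 1)) ℂ =>
            (contDiff_eval p).continuous.comp (continuous_snd (X := ℂ × ℝ))
          exact ((continuous_const.sub continuous_fst.fst).mul (h _)).add
            (continuous_fst.fst.mul (h _))
        exact hc.continuousAt.eventually_ne hk
      filter_upwards [hne] with z hz hz0 using absurd (hz0 k) hz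
  obtain ⟨A, hA, J, hJ, hAJ⟩ := mem_nhds_prod_iff.1 key
  obtain ⟨ε, hε, hεJ⟩ := Metric.mem_nhds_iff.1 hJ
  refine ⟨(ε / 2)⁻¹, ?_⟩
  filter_upwards [hA] with s hs y hy
  rw [pencilMap_eq_zero_iff] at hy
  have hy0 : y ≠ 0 := by
    rintro rfl
    simpa using hy.2
  have hn : 0 < ‖y‖ := norm_pos_iff.2 hy0
  have hmem : (s, ε / 2) ∈ A ×ˢ J := by
    refine ⟨hs, hεJ ?_⟩
    simp [abs_of_pos hε, hε]
  -- Scaling a zero with l(y) = 1 to the unit sphere turns the value of l into 1/‖y‖.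
  have h1 := hAJ hmem ((‖y‖ : ℂ)⁻¹ • y) (by simp [norm_smul, hn.ne']) (fun k => by
    rw [eval_smul_of_isHomogeneous (isHomogeneous_pencilAt hg hf s k), hy.1 k, mul_zero])
  simp only [Pi.smul_apply, smul_eq_mul, mul_left_comm _ (‖y‖ : ℂ)⁻¹] at h1
  rw [← Finset.mul_sum, hy.2] at h1
  simp only [mul_one, norm_inv, Complex.norm_real, norm_norm] at h1
  exact ((lt_inv_comm₀ (by positivity) hn).1 h1).le

/-- Nondegenerate members of a pencil have the same number of zeros. -/
lemma ncard_affineZeros_eq {l : Fin (n + 1) → ℂ}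
    {g f : Fin n → MvPolynomial (Fin (n + 1)) ℂ} {d : Fin n → ℕ}
    (hg : ∀ k, (g k).IsHomogeneous (d k)) (hf : ∀ k, (f k).IsHomogeneous (d k))
    (htg : ∀ y ≠ 0, (∀ k, eval y (g k) = 0) → eval y (jacDet l g) ≠ 0)
    (htf : ∀ y ≠ 0, (∀ k, eval y (f k) = 0) → eval y (jacDet l f) ≠ 0) :
    (affineZeros l f).Finite ∧ (affineZeros l f).ncard = (affineZeros l g).ncard := by
  let T : ℂ → Prop := fun s => ∀ y ≠ 0, (∀ k, eval y (pencilAt g f s k) = 0) →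
    eval y (jacDet l (pencilAt g f s)) ≠ 0
  have hp0 : pencilAt g f 0 = g := by funext k; simp [pencilAt]
  have hp1 : pencilAt g f 1 = f := by funext k; simp [pencilAt]
  have hT0 : T 0 := by simpa only [T, hp0] using htg
  have hT1 : T 1 := by simpa only [T, hp1] using htf
  have hset : ∀ s, {y | pencilMap l g f (s, y) = 0} = affineZeros l (pencilAt g f s) := fun s =>
    Set.ext fun y => pencilMap_eq_zero_iff l g f s y
  have hloc : ∀ s, T s → (affineZeros l (pencilAt g f s)).Finite ∧
      ∀ᶠ t in 𝓝 s, (affineZeros l (pencilAt g f t)).ncard =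
        (affineZeros l (pencilAt g f s)).ncard := by
    intro s hs
    have := eventually_ncard_zeros_eq (contDiff_pencilMap l g f) (s₀ := s)
      (fun p hp => exists_bijective_hasFDerivAt_pencilMap (hs p (by
          rintro rfl
          rw [pencilMap_eq_zero_iff] at hp
          simpa using hp.2) ((pencilMap_eq_zero_iff _ _ _ _ _).1 hp).1))
      (eventually_bounded_pencilMap hg hf fun y hy h0 =>
        linearForm_ne_zero_of_eval_jacDet_ne_zero (isHomogeneous_pencilAt hg hf s) h0 hy (hs y hy h0))
    simpa only [hset] using this
  -- The good parameters form a set containing the nonvanishing locus of a one-variable polynomial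
  -- that is nonzero at s = 0.
  have hcof : {s | ¬ T s}.Finite := by
    let F : Fin n → MvPolynomial (Fin (n + 1)) (MvPolynomial Unit ℂ) := fun k =>
      C (1 - X ()) * map C (g k) + C (X ()) * map C (f k)
    have hmap : ∀ (s : Unit → ℂ) k, map (eval s) (F k) = pencilAt g f (s ()) k := by
      intro s k
      have : (eval s).comp (C : ℂ →+* MvPolynomial Unit ℂ) = RingHom.id ℂ := by ext; simp
      simp [F, pencilAt, MvPolynomial.map_map, this, MvPolynomial.map_id]
    have hF : ∀ k, (F k).IsHomogeneous (d k) := fun k =>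
      (((hg k).map _).C_mul _).add (((hf k).map _).C_mul _)
    obtain ⟨D, hD0, hD⟩ := exists_eval_ne_zero_transverse hF l (fun _ => 0) (by
      simpa only [hmap] using hT0)
    let D' : Polynomial ℂ := aeval (fun _ => Polynomial.X) D
    have hD' : ∀ s, D'.eval s = eval (fun _ => s) D := by
      intro s
      have : (Polynomial.evalRingHom s).comp
          ((aeval (fun _ : Unit => (Polynomial.X : Polynomial ℂ))) :
            MvPolynomial Unit ℂ →ₐ[ℂ] Polynomial ℂ).toRingHom = eval (fun _ => s) := by
        apply MvPolynomial.ringHom_ext <;> simp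
      exact congrArg (fun φ : MvPolynomial Unit ℂ →+* ℂ => φ D) this
    have hne : D' ≠ 0 := by
      intro h
      apply hD0
      rw [← hD', h, Polynomial.eval_zero]
    refine (Polynomial.finite_setOfPred_isRoot hne).subset fun s hs => ?_
    by_contra hroot
    refine hs ?_
    have := hD (fun _ => s) (by rw [← hD']; exact hroot)
    simpa only [hmap] using this
  -- Removing finitely many points does not disconnect the plane ℂ, so a locally constant count
  -- agrees at 0 and 1.
  have hconn : IsPreconnected {s | T s} := by
    have := (hcof.countable.isConnected_compl_of_one_lt_rank (by simp)).isPreconnected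
    convert this using 1
    ext s; simp
  have : PreconnectedSpace {s | T s} := isPreconnected_iff_preconnectedSpace.1 hconn
  have hlc : IsLocallyConstant fun s : {s | T s} => (affineZeros l (pencilAt g f s)).ncard := by
    rw [IsLocallyConstant.iff_eventually_eq]
    intro s
    exact (continuous_subtype_val.tendsto s).eventually (hloc s s.2).2
  have h01 := hlc.apply_eq_of_preconnectedSpace ⟨1, hT1⟩ ⟨0, hT0⟩
  have hfin := (hloc 1 hT1).1
  simp only [hp0, hp1] at h01 hfin
  exact ⟨hfin, h01⟩

end Bezout

end

section

/-! ### Bézout's theorem by comparison with a Fermat system -/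

section Bezout

variable {n : ℕ}

/-- The system `y_{k+1}^{d k} = y_0^{d k}`. -/
def fermatSystem (d : Fin n → ℕ) (k : Fin n) : MvPolynomial (Fin (n + 1)) ℂ :=
  X k.succ ^ d k - X 0 ^ d k

lemma isHomogeneous_fermatSystem (d : Fin n → ℕ) (k : Fin n) :
    (fermatSystem d k).IsHomogeneous (d k) :=
  (isHomogeneous_X_pow _ _).sub (isHomogeneous_X_pow _ _)

lemma eval_fermatSystem_eq_zero_iff {d : Fin n → ℕ} {y : Fin (n + 1) → ℂ} {k : Fin n} :
    eval y (fermatSystem d k) = 0 ↔ y k.succ ^ d k = y 0 ^ d k := by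
  simp [fermatSystem, sub_eq_zero]

lemma fermatSystem_zero_ne_zero {d : Fin n → ℕ} (hd : ∀ k, 0 < d k) {y : Fin (n + 1) → ℂ}
    (hy : y ≠ 0) (h0 : ∀ k, eval y (fermatSystem d k) = 0) : y 0 ≠ 0 := by
  intro h
  apply hy
  funext i
  refine Fin.cases h (fun k => ?_) i
  have := eval_fermatSystem_eq_zero_iff.1 (h0 k)
  rw [h, zero_pow (hd k).ne'] at this
  exact pow_eq_zero_iff (hd k).ne' |>.1 this

lemma linearIndependent_fermatSystem {d : Fin n → ℕ} (hd : ∀ k, 0 < d k) {y : Fin (n + 1) → ℂ}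
    (hy : y ≠ 0) (h0 : ∀ k, eval y (fermatSystem d k) = 0) :
    LinearIndependent ℂ (fun k i => eval y (pderiv i (fermatSystem d k))) := by
  have hy0 := fermatSystem_zero_ne_zero hd hy h0
  rw [Fintype.linearIndependent_iff]
  intro c hc k
  have h := congrFun hc k.succ
  simp only [Finset.sum_apply, Pi.smul_apply, smul_eq_mul, Pi.zero_apply] at h
  rw [Finset.sum_eq_single k] at h
  · have hyk : y k.succ ≠ 0 := by
      intro hk
      have := eval_fermatSystem_eq_zero_iff.1 (h0 k)
      rw [hk, zero_pow (hd k).ne'] at this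
      exact hy0 (pow_eq_zero_iff (hd k).ne' |>.1 this.symm)
    refine (mul_eq_zero.1 h).resolve_right ?_
    simp [fermatSystem, pderiv_X, (hd k).ne', hyk, (Fin.succ_ne_zero k).symm]
  · intro j _ hj
    simp [fermatSystem, pderiv_X, hj, (Fin.succ_ne_zero k).symm]
  · simp

/-- Normalised to y₀ = 1, the zeros are the tuples of d_k-th roots of unity. As l vanishes at none
of them, they can be normalised to l = 1 instead. -/
lemma ncard_affineZeros_fermatSystem {d : Fin n → ℕ} (hd : ∀ k, 0 < d k) {l : Fin (n + 1) → ℂ}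
    (hl : ∀ y ≠ 0, (∀ k, eval y (fermatSystem d k) = 0) → ∑ i, l i * y i ≠ 0) :
    (affineZeros l (fermatSystem d)).ncard = ∏ k, d k := by
  have hone : ∀ z : (k : Fin n) → {x : ℂ // x ^ d k = 1}, ∑ i, l i *
      (Fin.cons 1 (fun k => (z k : ℂ)) : Fin (n + 1) → ℂ) i ≠ 0 := by
    intro z
    refine hl _ (fun h => one_ne_zero (congrFun h 0)) fun k => ?_
    rw [eval_fermatSystem_eq_zero_iff]
    simpa using (z k).2
  have hy0 : ∀ y ∈ affineZeros l (fermatSystem d), y 0 ≠ 0 := by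
    intro y hy
    refine fermatSystem_zero_ne_zero hd ?_ hy.1
    rintro rfl
    simpa using hy.2
  let e : affineZeros l (fermatSystem d) ≃ ((k : Fin n) → {x : ℂ // x ^ d k = 1}) :=
    { toFun := fun y k => ⟨y.1 k.succ / y.1 0, by
        rw [div_pow, eval_fermatSystem_eq_zero_iff.1 (y.2.1 k)]
        exact div_self (pow_ne_zero _ (hy0 y y.2))⟩
      invFun := fun z => ⟨(∑ i, l i * (Fin.cons 1 (fun k => (z k : ℂ)) : Fin (n + 1) → ℂ) i)⁻¹ •
          Fin.cons 1 (fun k => (z k : ℂ)), by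
        constructor
        · intro k
          rw [eval_smul_of_isHomogeneous (isHomogeneous_fermatSystem d k),
            eval_fermatSystem_eq_zero_iff.2 (by simpa using (z k).2), mul_zero]
        · simp only [Pi.smul_apply, smul_eq_mul, mul_left_comm (l _)]
          rw [← Finset.mul_sum, inv_mul_cancel₀ (hone z)]⟩
      left_inv := by
        intro y
        have h0 := hy0 y y.2
        have hc : (Fin.cons 1 (fun k => y.1 k.succ / y.1 0) : Fin (n + 1) → ℂ) =
            (y.1 0)⁻¹ • y.1 := by
          funext i
          refine Fin.cases ?_ (fun k => ?_) i
          · simp [h0]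
          · simp [div_eq_inv_mul]
        apply Subtype.ext
        simp only [hc, Pi.smul_apply, smul_eq_mul, mul_left_comm (l _)]
        rw [← Finset.mul_sum, y.2.2, mul_one, inv_inv, smul_smul, mul_inv_cancel₀ h0, one_smul]
      right_inv := by
        intro z
        funext k
        apply Subtype.ext
        simp only [Pi.smul_apply, smul_eq_mul, Fin.cons_succ, Fin.cons_zero, mul_one]
        exact mul_div_cancel_left₀ _ (inv_ne_zero (hone z)) }
  rw [← Nat.card_coe_set_eq, Nat.card_congr e, Nat.card_pi]
  refine Finset.prod_congr rfl fun k _ => ?_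
  have hp := Complex.isPrimitiveRoot_exp (d k) (hd k).ne'
  have hcard : Nat.card {x : ℂ // x ^ d k = 1} = (Polynomial.nthRootsFinset (d k) (1 : ℂ)).card := by
    rw [← Nat.card_eq_finsetCard]
    exact Nat.card_congr (Equiv.subtypeEquivRight fun x =>
      (Polynomial.mem_nthRootsFinset (hd k) (1 : ℂ)).symm)
  rw [hcard, hp.card_nthRootsFinset]

/-- The zeros in projective space of a homogeneous system. -/
def projZeros (f : Fin n → MvPolynomial (Fin (n + 1)) ℂ) : Set (ℙ ℂ (Fin (n + 1) → ℂ)) :=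
  {p | ∀ k, eval p.rep (f k) = 0}

lemma eval_mk_rep_eq_zero_iff {σ : Type*} [Fintype σ] {p : MvPolynomial σ ℂ} {m : ℕ}
    (hp : p.IsHomogeneous m) {v : σ → ℂ} (hv : v ≠ 0) :
    eval (Projectivization.mk ℂ v hv).rep p = 0 ↔ eval v p = 0 := by
  obtain ⟨a, ha⟩ := Projectivization.exists_smul_eq_mk_rep ℂ v hv
  rw [← ha, Units.smul_def, eval_smul_of_isHomogeneous hp]
  simp

/-- The point of projective space with the given coordinates (the point `[1 : … : 1]` if all
coordinates vanish). -/
def toProj {n : ℕ} (v : Fin (n + 1) → ℂ) : ℙ ℂ (Fin (n + 1) → ℂ) :=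
  if h : v = 0 then Projectivization.mk ℂ (fun _ => 1) (fun h => one_ne_zero (congrFun h 0))
  else Projectivization.mk ℂ v h

lemma toProj_of_ne_zero {v : Fin (n + 1) → ℂ} (hv : v ≠ 0) :
    toProj v = Projectivization.mk ℂ v hv := dif_neg hv

/-- Every projective zero has exactly one representative on l = 1. -/
lemma projZeros_ncard_eq {f : Fin n → MvPolynomial (Fin (n + 1)) ℂ} {d : Fin n → ℕ}
    (hf : ∀ k, (f k).IsHomogeneous (d k)) {l : Fin (n + 1) → ℂ}
    (hl : ∀ y ≠ 0, (∀ k, eval y (f k) = 0) → ∑ i, l i * y i ≠ 0) :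
    projZeros f = toProj '' affineZeros l f ∧
      (projZeros f).ncard = (affineZeros l f).ncard := by
  have hne : ∀ y ∈ affineZeros l f, y ≠ 0 := by
    rintro y hy rfl
    simpa using hy.2
  have himg : projZeros f = toProj '' affineZeros l f := by
    ext p
    constructor
    · intro hp
      have h1 := hl p.rep p.rep_nonzero hp
      refine ⟨(∑ i, l i * p.rep i)⁻¹ • p.rep, ⟨fun k => ?_, ?_⟩, ?_⟩
      · rw [eval_smul_of_isHomogeneous (hf k), hp k, mul_zero]
      · simp only [Pi.smul_apply, smul_eq_mul, mul_left_comm (l _)]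
        rw [← Finset.mul_sum, inv_mul_cancel₀ h1]
      · have h2 : (∑ i, l i * p.rep i)⁻¹ • p.rep ≠ 0 := smul_ne_zero (inv_ne_zero h1) p.rep_nonzero
        rw [toProj_of_ne_zero h2]
        conv_rhs => rw [← p.mk_rep]
        rw [Projectivization.mk_eq_mk_iff']
        exact ⟨_, rfl⟩
    · rintro ⟨y, hy, rfl⟩ k
      rw [toProj_of_ne_zero (hne y hy), eval_mk_rep_eq_zero_iff (hf k)]
      exact hy.1 k
  refine ⟨himg, ?_⟩
  rw [himg]
  refine Set.InjOn.ncard_image fun y hy y' hy' h => ?_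
  rw [toProj_of_ne_zero (hne y hy), toProj_of_ne_zero (hne y' hy'),
    Projectivization.mk_eq_mk_iff'] at h
  obtain ⟨a, rfl⟩ := h
  have h1 := hy.2
  simp only [Pi.smul_apply, smul_eq_mul, mul_left_comm (l _)] at h1
  rw [← Finset.mul_sum, hy'.2, mul_one] at h1
  rw [h1, one_smul]

/-- **Bézout's theorem** for transverse intersections, relative to a linear form `l` that vanishes
at no point of the intersection. -/
theorem projZeros_finite_and_ncard {f : Fin n → MvPolynomial (Fin (n + 1)) ℂ} {d : Fin n → ℕ}
    (hd : ∀ k, 0 < d k) (hf : ∀ k, (f k).IsHomogeneous (d k)) {l : Fin (n + 1) → ℂ}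
    (hl : ∀ y ≠ 0, (∀ k, eval y (fermatSystem d k) = 0) → ∑ i, l i * y i ≠ 0)
    (htf : ∀ y ≠ 0, (∀ k, eval y (f k) = 0) → eval y (jacDet l f) ≠ 0) :
    (projZeros f).Finite ∧ (projZeros f).ncard = ∏ k, d k := by
  have h1 := ncard_affineZeros_eq (l := l) (isHomogeneous_fermatSystem d) hf
    (fun y hy h0 => eval_jacDet_ne_zero (isHomogeneous_fermatSystem d) h0 (hl y hy h0)
      (linearIndependent_fermatSystem hd hy h0)) htf
  have h2 := projZeros_ncard_eq hf (l := l) fun y hy h0 =>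
    linearForm_ne_zero_of_eval_jacDet_ne_zero hf h0 hy (htf y hy h0)
  refine ⟨h2.1 ▸ h1.1.image _, ?_⟩
  rw [h2.2, h1.2, ncard_affineZeros_fermatSystem hd hl]

/-- The product over T of the evaluations l ↦ l(t) would otherwise vanish at every l, hence be the
zero polynomial, and then one factor would be zero. -/
lemma exists_linearForm_ne_zero {m : ℕ} {T : Set (Fin m → ℂ)} (hT : T.Finite)
    (h0 : ∀ t ∈ T, t ≠ 0) : ∃ l : Fin m → ℂ, ∀ t ∈ T, ∑ i, l i * t i ≠ 0 := by
  by_contra! hcon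
  have hz : ∏ t ∈ hT.toFinset, (∑ i, C (t i) * X i : MvPolynomial (Fin m) ℂ) = 0 := by
    refine MvPolynomial.funext fun l => ?_
    obtain ⟨t, ht, htl⟩ := hcon l
    rw [map_prod, map_zero]
    refine Finset.prod_eq_zero (hT.mem_toFinset.2 ht) ?_
    simpa [mul_comm] using htl
  obtain ⟨t, ht, htz⟩ := Finset.prod_eq_zero_iff.1 hz
  refine h0 t (hT.mem_toFinset.1 ht) (funext fun i => ?_)
  simpa [Pi.single_apply] using congrArg (eval (Pi.single i 1)) htz

/-- **Bézout's theorem** for transverse intersections. -/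
theorem projZeros_ncard_of_transverse {f : Fin n → MvPolynomial (Fin (n + 1)) ℂ} {d : Fin n → ℕ}
    (hd : ∀ k, 0 < d k) (hf : ∀ k, (f k).IsHomogeneous (d k)) (hfin : (projZeros f).Finite)
    (htr : ∀ y ≠ 0, (∀ k, eval y (f k) = 0) →
      LinearIndependent ℂ (fun k i => eval y (pderiv i (f k)))) :
    (projZeros f).ncard = ∏ k, d k := by
  have hpf : (projZeros (fermatSystem d)).Finite := by
    have hl : ∀ y ≠ 0, (∀ k, eval y (fermatSystem d k) = 0) →
        ∑ i, (Pi.single 0 1 : Fin (n + 1) → ℂ) i * y i ≠ 0 := by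
      intro y hy h0
      simpa [Pi.single_apply] using fermatSystem_zero_ne_zero hd hy h0
    exact (projZeros_finite_and_ncard hd (isHomogeneous_fermatSystem d) hl fun y hy h0 =>
      eval_jacDet_ne_zero (isHomogeneous_fermatSystem d) h0 (hl y hy h0)
        (linearIndependent_fermatSystem hd hy h0)).1
  -- One hyperplane must avoid the zeros of both ends of the pencil.
  obtain ⟨l, hl⟩ := exists_linearForm_ne_zero
    (T := Projectivization.rep '' (projZeros f ∪ projZeros (fermatSystem d)))
    ((hfin.union hpf).image _) (by
      rintro _ ⟨p, -, rfl⟩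
      exact p.rep_nonzero)
  have key : ∀ g : Fin n → MvPolynomial (Fin (n + 1)) ℂ, (∀ k, (g k).IsHomogeneous (d k)) →
      projZeros g ⊆ projZeros f ∪ projZeros (fermatSystem d) →
      ∀ y ≠ 0, (∀ k, eval y (g k) = 0) → ∑ i, l i * y i ≠ 0 := by
    intro g hg hsub y hy h0 hly
    have hmem : Projectivization.mk ℂ y hy ∈ projZeros g := fun k =>
      (eval_mk_rep_eq_zero_iff (hg k) hy).2 (h0 k)
    refine hl _ ⟨_, hsub hmem, rfl⟩ ?_
    obtain ⟨a, ha⟩ := Projectivization.exists_smul_eq_mk_rep ℂ y hy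
    rw [← ha, Units.smul_def]
    simp only [Pi.smul_apply, smul_eq_mul, mul_left_comm (l _)]
    rw [← Finset.mul_sum, hly, mul_zero]
  exact (projZeros_finite_and_ncard hd hf
    (key _ (isHomogeneous_fermatSystem d) Set.subset_union_right)
    fun y hy h0 => eval_jacDet_ne_zero hf h0 (key f hf Set.subset_union_left y hy h0)
      (htr y hy h0)).2

end Bezout

end

/-! ### A pencil of diagonal cubics -/

section Diagonal

variable {ι : Type*} [DecidableEq ι]

/-- The rational function `(τ - a)³ / (τ - m)²`. -/
def cubeOverSquare (a m τ : ℂ) : ℂ := (τ - a) ^ 3 / (τ - m) ^ 2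

/-- The derivative of `cubeOverSquare`. -/
def cubeOverSquareDeriv (a m τ : ℂ) : ℂ :=
  (τ - a) ^ 2 * (3 * (τ - m) - 2 * (τ - a)) / (τ - m) ^ 3

/-- A combination of `cubeOverSquare`s with positive coefficients whose poles avoid `m` has only
finitely many critical points relative to a further such function. -/
lemma finite_wronskian_zeros {a m w : ι → ℝ} (hw : ∀ i, 0 < w i) (ham : ∀ i j, a i < m j)
    {S : Finset ι} (hS : S.Nonempty) {k : ι} (hk : ∀ i ∈ S, m i ≠ m k) :
    {τ : ℂ | (∀ i ∈ S, τ ≠ m i) ∧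
      (∑ i ∈ S, (w i : ℂ) * cubeOverSquareDeriv (a i) (m i) τ) * ((τ - a k) * (τ - m k)) -
        (∑ i ∈ S, (w i : ℂ) * cubeOverSquare (a i) (m i) τ) *
          (3 * (τ - m k) - 2 * (τ - a k)) = 0}.Finite := by
  let L : ℝ → Polynomial ℂ := fun r => Polynomial.X - Polynomial.C (r : ℂ)
  -- The logarithmic derivative of the k-th function is (3(τ - m_k) - 2(τ - a_k)) / ((τ - a_k)(τ -
  -- m_k)), so the expression is the Wronskian of the sum and the k-th function up to a factor. N is
  -- the result of clearing its denominators.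
  let N : Polynomial ℂ := ∑ i ∈ S, Polynomial.C (w i : ℂ) * (∏ j ∈ S.erase i, L (m j) ^ 3) *
    (L (a i) ^ 2 * (3 * L (m i) - 2 * L (a i)) * (L (a k) * L (m k)) -
      L (a i) ^ 3 * L (m i) * (3 * L (m k) - 2 * L (a k)))
  have hLe : ∀ r τ, (L r).eval τ = τ - r := fun r τ => by simp [L]
  have hNe : ∀ τ : ℂ, (∀ i ∈ S, τ ≠ m i) → N.eval τ = (∏ j ∈ S, (τ - m j) ^ 3) *
      ((∑ i ∈ S, (w i : ℂ) * cubeOverSquareDeriv (a i) (m i) τ) * ((τ - a k) * (τ - m k)) -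
        (∑ i ∈ S, (w i : ℂ) * cubeOverSquare (a i) (m i) τ) *
          (3 * (τ - m k) - 2 * (τ - a k))) := by
    intro τ hτ
    rw [Finset.sum_mul, Finset.sum_mul, ← Finset.sum_sub_distrib, Finset.mul_sum,
      Polynomial.eval_finsetSum]
    refine Finset.sum_congr rfl fun i hi => ?_
    have h1 : τ - m i ≠ 0 := sub_ne_zero.2 (hτ i hi)
    rw [← Finset.mul_prod_erase S _ hi]
    simp only [Polynomial.eval_mul, Polynomial.eval_sub, Polynomial.eval_pow, hLe,
      Polynomial.eval_C, Polynomial.eval_prod, Polynomial.eval_ofNat, cubeOverSquare,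
      cubeOverSquareDeriv]
    field_simp
  have hN : N ≠ 0 := by
    intro h0
    -- N is nonzero because it does not vanish at τ = m_k: only the second term survives there, and
    -- it is a nonzero multiple of a sum of positive reals.
    have h1 := hNe (m k : ℂ) fun i hi h => hk i hi (by exact_mod_cast h.symm)
    rw [h0, Polynomial.eval_zero] at h1
    have h2 : (∏ j ∈ S, (((m k : ℝ) : ℂ) - m j) ^ 3) ≠ 0 :=
      Finset.prod_ne_zero_iff.2 fun i hi => pow_ne_zero _ (sub_ne_zero.2 fun h =>
        hk i hi (by exact_mod_cast h.symm))
    have h3 := (mul_eq_zero.1 h1.symm).resolve_left h2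
    rw [sub_self, mul_zero, mul_zero, mul_zero, zero_sub, zero_sub, mul_neg, neg_neg] at h3
    have hak : ((m k : ℝ) : ℂ) - a k ≠ 0 := sub_ne_zero.2 fun h =>
      (ham k k).ne (by exact_mod_cast h.symm)
    have h4 := (mul_eq_zero.1 h3).resolve_right (mul_ne_zero two_ne_zero hak)
    have h5 : 0 < ∑ i ∈ S, w i * ((m k - a i) ^ 3 / (m k - m i) ^ 2) := by
      refine Finset.sum_pos (fun i hi => ?_) hS
      have := sub_pos.2 (ham i k)
      have : 0 < (m k - m i) ^ 2 := sq_pos_of_ne_zero (sub_ne_zero.2 (hk i hi).symm)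
      have := hw i
      positivity
    refine h5.ne' ?_
    have : ((∑ i ∈ S, w i * ((m k - a i) ^ 3 / (m k - m i) ^ 2) : ℝ) : ℂ) = 0 := by
      rw [← h4]; push_cast; rfl
    exact_mod_cast this
  refine (Polynomial.finite_setOfPred_isRoot hN).subset fun τ hτ => ?_
  change N.eval τ = 0
  rw [hNe τ hτ.1, hτ.2, mul_zero]

/-- Induction on T, choosing the weight x of the new index k last. Write R_S for the weighted sum
over S and R_k for the k-th function. A double zero of R_S + x R_k is a zero of the Wronskian of R_S
and R_k at which x = -R_S/R_k. There are finitely many subsets S and finitely many Wronskian zeros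
for each, so some positive real x is not excluded. -/
lemma exists_weights_no_double_zero [Fintype ι] {a m : ι → ℝ} (ham : ∀ i j, a i < m j)
    (hm : Function.Injective m) (T : Finset ι) :
    ∃ w : ι → ℝ, (∀ i, 0 < w i) ∧ ∀ S ⊆ T, S.Nonempty → ∀ τ : ℂ,
      (∀ i ∈ S, τ ≠ a i ∧ τ ≠ m i) →
      ∑ i ∈ S, (w i : ℂ) * cubeOverSquare (a i) (m i) τ = 0 →
      ∑ i ∈ S, (w i : ℂ) * cubeOverSquareDeriv (a i) (m i) τ ≠ 0 := by
  induction T using Finset.induction_on with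
  | empty => exact ⟨fun _ => 1, fun _ => one_pos, fun S hS hne => by
      rw [Finset.subset_empty.1 hS] at hne; exact absurd hne (by simp)⟩
  | insert k T hk ih =>
    obtain ⟨w, hw, hT⟩ := ih
    have hmk : ∀ S ⊆ T, ∀ i ∈ S, m i ≠ m k := fun S hS i hi h => hk (hm h ▸ hS hi)
    let Z : Finset ι → Set ℂ := fun S => {τ : ℂ | (∀ i ∈ S, τ ≠ m i) ∧
      (∑ i ∈ S, (w i : ℂ) * cubeOverSquareDeriv (a i) (m i) τ) * ((τ - a k) * (τ - m k)) -
        (∑ i ∈ S, (w i : ℂ) * cubeOverSquare (a i) (m i) τ) *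
          (3 * (τ - m k) - 2 * (τ - a k)) = 0}
    let bad : Set ℂ := ⋃ S ∈ {S : Finset ι | S ⊆ T ∧ S.Nonempty},
      (fun τ => -(∑ i ∈ S, (w i : ℂ) * cubeOverSquare (a i) (m i) τ) /
        cubeOverSquare (a k) (m k) τ) '' Z S
    have hbad : bad.Finite := by
      refine (Set.toFinite _).biUnion fun S hS => Set.Finite.image _ ?_
      exact finite_wronskian_zeros hw ham hS.2 (hmk S hS.1)
    obtain ⟨x, hx, hxbad⟩ : ∃ x : ℝ, 0 < x ∧ (x : ℂ) ∉ bad := by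
      have hfin : ((fun x : ℝ => (x : ℂ)) ⁻¹' bad).Finite :=
        hbad.preimage Complex.ofReal_injective.injOn
      obtain ⟨x, hx, hx'⟩ := (Set.Ioi_infinite (0 : ℝ)).exists_notMem_finite hfin
      exact ⟨x, hx, hx'⟩
    refine ⟨Function.update w k x, fun i => ?_, fun S hS hne τ hτ h0 h1 => ?_⟩
    · by_cases h : i = k
      · subst h; simpa using hx
      · simpa [h] using hw i
    have hupd : ∀ S' ⊆ T, ∀ F : ι → ℂ,
        ∑ i ∈ S', ((Function.update w k x i : ℝ) : ℂ) * F i = ∑ i ∈ S', (w i : ℂ) * F i := by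
      intro S' hS' F
      refine Finset.sum_congr rfl fun i hi => ?_
      rw [Function.update_of_ne]
      rintro rfl
      exact hk (hS' hi)
    by_cases hkS : k ∈ S
    · have hS' : S.erase k ⊆ T := by
        intro i hi
        exact (Finset.mem_insert.1 (hS (Finset.mem_of_mem_erase hi))).resolve_left
          (Finset.ne_of_mem_erase hi)
      rw [← Finset.add_sum_erase S _ hkS, hupd _ hS', Function.update_self] at h0 h1
      have hka : τ - a k ≠ 0 := sub_ne_zero.2 (hτ k hkS).1
      have hkm : τ - m k ≠ 0 := sub_ne_zero.2 (hτ k hkS).2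
      have hR : cubeOverSquare (a k) (m k) τ ≠ 0 :=
        div_ne_zero (pow_ne_zero _ hka) (pow_ne_zero _ hkm)
      have hxne : (x : ℂ) ≠ 0 := by exact_mod_cast hx.ne'
      rcases (S.erase k).eq_empty_or_nonempty with he | hne'
      · rw [he, Finset.sum_empty, add_zero] at h0
        exact mul_ne_zero hxne hR h0
      · refine hxbad (Set.mem_biUnion (x := S.erase k) ⟨hS', hne'⟩ ⟨τ, ⟨fun i hi =>
          (hτ i (Finset.mem_of_mem_erase hi)).2, ?_⟩, ?_⟩)
        · rw [eq_neg_of_add_eq_zero_right h0, eq_neg_of_add_eq_zero_right h1, cubeOverSquare,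
            cubeOverSquareDeriv]
          field_simp
          ring
        · simp only
          rw [← eq_neg_of_add_eq_zero_left h0]
          field_simp
    · have hST : S ⊆ T := fun i hi =>
        (Finset.mem_insert.1 (hS hi)).resolve_left fun h => hkS (h ▸ hi)
      rw [hupd _ hST] at h0 h1
      exact hT S hST hne τ hτ h0 h1

end Diagonal

/-! ### Critical triples -/

/-- A triple `(y, γ, a)` for which the point `(y, γ)` of the complete intersection
`γ 0 * q 0 + γ 1 * q 1 = γ 0 * c 0 + γ 1 * c 1 = 0` is singular, the differentials of the two
equations satisfying the relation `a`. -/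
structure IsCriticalTriple (q c : Fin 2 → MvPolynomial (Fin 5) ℂ) (y : Fin 5 → ℂ)
    (γ a : Fin 2 → ℂ) : Prop where
  quadric : ∑ k, γ k * eval y (q k) = 0
  cubic : ∑ k, γ k * eval y (c k) = 0
  fibre : ∀ k, a 0 * eval y (q k) + a 1 * eval y (c k) = 0
  grad : ∀ i, ∑ k, γ k * (a 0 * eval y (pderiv i (q k)) + a 1 * eval y (pderiv i (c k))) = 0

/-- There is no critical triple of nonzero vectors. -/
def NoCriticalTriple (q c : Fin 2 → MvPolynomial (Fin 5) ℂ) : Prop :=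
  ∀ y γ a, y ≠ 0 → γ ≠ 0 → a ≠ 0 → ¬ IsCriticalTriple q c y γ a

/-! ### A diagonal pencil without critical triples -/

section Diagonal

/-- At most one coordinate of y can be nonzero, so the sum has a single term. -/
lemma eq_zero_of_sum_mul_support {y w : Fin 5 → ℂ} {e : ℕ} (he : e ≠ 0) (hw : ∀ i, w i ≠ 0)
    (h1 : ∀ i j, y i ≠ 0 → y j ≠ 0 → i = j) (h2 : ∑ i, w i * y i ^ e = 0) : y = 0 := by
  by_contra hy
  obtain ⟨j, hj⟩ := Function.ne_iff.1 hy
  rw [Finset.sum_eq_single j] at h2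
  · exact mul_ne_zero (hw j) (pow_ne_zero _ hj) h2
  · intro i _ hij
    have : y i = 0 := by
      by_contra hi
      exact hij (h1 i j hi hj)
    rw [this, zero_pow he, mul_zero]
  · simp

/-- In the diagonal pencil Σ w_i (τ - a_i) y_i², Σ w_i (τ - m_i) y_i³ the gradient relation
decouples: each nonzero y_i is l (τ - a_i)/(τ - m_i) with a common l. The quadric equation then says
that R(τ) = Σ w_i (τ - a_i)³/(τ - m_i)², summed over the support of y, vanishes, and the fibre
relation says that R'(τ) = 0. The weights are chosen so that no such R has a double zero. -/
theorem exists_noCriticalTriple : ∃ q c : Fin 2 → MvPolynomial (Fin 5) ℂ,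
    (∀ k, (q k).IsHomogeneous 2) ∧ (∀ k, (c k).IsHomogeneous 3) ∧ NoCriticalTriple q c := by
  -- Any distinct a_i lying below all of the distinct m_j would do.
  let a : Fin 5 → ℝ := fun i => -(i + 1 : ℕ)
  let m : Fin 5 → ℝ := fun i => (i : ℕ)
  have ham : ∀ i j, a i < m j := by
    intro i j
    have h1 : (0 : ℝ) < ((i + 1 : ℕ) : ℝ) := by positivity
    have h2 : (0 : ℝ) ≤ ((j : ℕ) : ℝ) := by positivity
    simp only [a, m]
    linarith
  have hm : Function.Injective m := fun i j h => Fin.ext (by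
    simp only [m] at h
    exact_mod_cast h)
  have ha : Function.Injective a := fun i j h => Fin.ext (by
    have := neg_injective h
    have : (i : ℕ) + 1 = j + 1 := by exact_mod_cast this
    omega)
  obtain ⟨w, hw, hT⟩ := exists_weights_no_double_zero ham hm Finset.univ
  have hwc : ∀ i, (w i : ℂ) ≠ 0 := fun i => by exact_mod_cast (hw i).ne'
  obtain ⟨D, hD⟩ : ∃ D : (Fin 5 → ℝ) → ℕ → MvPolynomial (Fin 5) ℂ, ∀ v e,
      D v e = ∑ i, C ((w i : ℂ) * v i) * X i ^ e := ⟨_, fun _ _ => rfl⟩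
  have hDh : ∀ v e, (D v e).IsHomogeneous e := fun v e => hD v e ▸
    IsHomogeneous.sum _ _ _ fun i _ => (isHomogeneous_X_pow i e).C_mul _
  have hDe : ∀ v e y, eval y (D v e) = ∑ i, (w i : ℂ) * v i * y i ^ e := fun v e y => by simp [hD]
  have hDp : ∀ v e y i, eval y (pderiv i (D v (e + 1))) = w i * v i * ((e + 1) * y i ^ e) := by
    intro v e y i
    simp only [hD, map_sum, pderiv_C_mul, pderiv_pow]
    rw [Finset.sum_eq_single i]
    · simp
    · intro j _ hj; simp [pderiv_X, hj]
    · simp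
  have hDp2 : ∀ v y i, eval y (pderiv i (D v 2)) = w i * v i * (2 * y i) := by
    intro v y i
    have h := hDp v 1 y i
    rw [one_add_one_eq_two] at h
    rw [h]; push_cast; ring
  have hDp3 : ∀ v y i, eval y (pderiv i (D v 3)) = w i * v i * (3 * y i ^ 2) := by
    intro v y i
    have h := hDp v 2 y i
    rw [two_add_one_eq_three] at h
    rw [h]; push_cast; ring
  refine ⟨![D (fun i => -a i) 2, D (fun _ => 1) 2], ![D (fun i => -m i) 3, D (fun _ => 1) 3], ?_, ?_,
    ?_⟩
  · intro k; fin_cases k <;> exact hDh _ _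
  · intro k; fin_cases k <;> exact hDh _ _
  rintro y γ p hy hγ hp ⟨hq, hc, hf, hg⟩
  have hf1 := hf 1
  simp only [Fin.sum_univ_two, Fin.isValue, Matrix.cons_val_zero, Matrix.cons_val_one, hDe,
    Complex.ofReal_neg, Complex.ofReal_one, mul_one] at hq hc hf1
  have hg' : ∀ i, 2 * p 0 * (γ 1 - a i * γ 0) * y i + 3 * p 1 * (γ 1 - m i * γ 0) * y i ^ 2 = 0 := by
    intro i
    have h := hg i
    simp only [Fin.sum_univ_two, Fin.isValue, Matrix.cons_val_zero, Matrix.cons_val_one] at h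
    rw [hDp2, hDp2, hDp3, hDp3] at h
    refine (mul_eq_zero.1 (?_ : (w i : ℂ) * _ = 0)).resolve_left (hwc i)
    push_cast at h
    linear_combination h
  -- The member τ = ∞ of the pencil: all nonzero y_i coincide, and positivity of the weights
  -- contradicts Σ w_i y_i² = 0.
  by_cases hγ0 : γ 0 = 0
  · have hγ1 : γ 1 ≠ 0 := by
      intro h; apply hγ; funext k; fin_cases k <;> assumption
    simp only [hγ0, mul_zero, sub_zero, zero_mul, zero_add] at hg' hq
    have hq' : ∑ i, (w i : ℂ) * y i ^ 2 = 0 := (mul_eq_zero.1 hq).resolve_left hγ1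
    have hg2 : ∀ i, y i ≠ 0 → 2 * p 0 + 3 * p 1 * y i = 0 := by
      intro i hi
      refine (mul_eq_zero.1 (?_ : (γ 1 * y i) * _ = 0)).resolve_left (mul_ne_zero hγ1 hi)
      linear_combination hg' i
    have hp1 : p 1 ≠ 0 := by
      intro h1
      obtain ⟨j, hj⟩ := Function.ne_iff.1 hy
      have := hg2 j hj
      rw [h1] at this
      have h0 : p 0 = 0 := by linear_combination this / 2
      apply hp; funext k; fin_cases k <;> assumption
    obtain ⟨j, hj⟩ := Function.ne_iff.1 hy
    have hall : ∀ i, (w i : ℂ) * y i ^ 2 = (if y i = 0 then 0 else w i : ℝ) * y j ^ 2 := by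
      intro i
      split_ifs with hi
      · simp [hi]
      · have : y i = y j := by
          have h3 : (3 * p 1) * (y i - y j) = 0 := by linear_combination hg2 i hi - hg2 j hj
          exact sub_eq_zero.1 ((mul_eq_zero.1 h3).resolve_left (mul_ne_zero three_ne_zero hp1))
        rw [this]
    rw [Finset.sum_congr rfl fun i _ => hall i, ← Finset.sum_mul] at hq'
    have h4 := (mul_eq_zero.1 hq').resolve_right (pow_ne_zero _ hj)
    have h5 : (∑ i, if y i = 0 then 0 else w i : ℝ) = 0 := by exact_mod_cast h4
    have h6 := (Finset.sum_eq_zero_iff_of_nonneg (fun i _ => by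
      split_ifs
      · exact le_rfl
      · exact (hw i).le)).1 h5 j (Finset.mem_univ j)
    rw [if_neg (show y j ≠ 0 from hj)] at h6
    exact (hw j).ne' h6
  · set τ := γ 1 / γ 0 with hτ
    have hγ1 : γ 1 = τ * γ 0 := by rw [hτ]; field_simp
    have hg2 : ∀ i, y i ≠ 0 → 2 * p 0 * (τ - a i) + 3 * p 1 * (τ - m i) * y i = 0 := by
      intro i hi
      refine (mul_eq_zero.1 (?_ : (γ 0 * y i) * _ = 0)).resolve_left (mul_ne_zero hγ0 hi)
      have := hg' i
      rw [hγ1] at this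
      linear_combination this
    -- If p₁ = 0, every i in the support has a_i = τ, so the support is a single index. The case p₀
    -- = 0 is the same with m_i in place of a_i.
    have hp1 : p 1 ≠ 0 := by
      intro h1
      have hp0 : p 0 ≠ 0 := by
        intro h0; apply hp; funext k; fin_cases k <;> assumption
      have hy1 : ∀ i, y i ≠ 0 → τ = a i := by
        intro i hi
        have := hg2 i hi
        rw [h1, mul_zero, zero_mul, zero_mul, add_zero] at this
        exact sub_eq_zero.1 ((mul_eq_zero.1 this).resolve_left (mul_ne_zero two_ne_zero hp0))
      rw [h1, zero_mul, add_zero] at hf1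
      exact hy (eq_zero_of_sum_mul_support two_ne_zero hwc
        (fun i j hi hj => ha (by exact_mod_cast (hy1 i hi).symm.trans (hy1 j hj)))
        ((mul_eq_zero.1 hf1).resolve_left hp0))
    have hp0 : p 0 ≠ 0 := by
      intro h0
      have hy1 : ∀ i, y i ≠ 0 → τ = m i := by
        intro i hi
        have := hg2 i hi
        rw [h0, mul_zero, zero_mul, zero_add] at this
        exact sub_eq_zero.1 ((mul_eq_zero.1 ((mul_eq_zero.1 this).resolve_right hi)).resolve_left
          (mul_ne_zero three_ne_zero hp1))
      rw [h0, zero_mul, zero_add] at hf1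
      exact hy (eq_zero_of_sum_mul_support three_ne_zero hwc
        (fun i j hi hj => hm (by exact_mod_cast (hy1 i hi).symm.trans (hy1 j hj)))
        ((mul_eq_zero.1 hf1).resolve_left hp1))
    have ham' : ∀ i, ((m i : ℝ) : ℂ) - a i ≠ 0 := fun i => sub_ne_zero.2 fun h =>
      (ham i i).ne (by exact_mod_cast h.symm)
    have hτm : ∀ i, y i ≠ 0 → τ - m i ≠ 0 := by
      intro i hi h
      have h1 := hg2 i hi
      rw [h, mul_zero, zero_mul, add_zero, sub_eq_zero.1 h] at h1
      exact mul_ne_zero (mul_ne_zero two_ne_zero hp0) (ham' i) h1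
    have hτa : ∀ i, y i ≠ 0 → τ - a i ≠ 0 := by
      intro i hi h
      have h1 := hg2 i hi
      rw [h, mul_zero, zero_add] at h1
      exact mul_ne_zero (mul_ne_zero (mul_ne_zero three_ne_zero hp1) (hτm i hi)) hi h1
    set l : ℂ := -(2 * p 0) / (3 * p 1) with hl
    have hl0 : l ≠ 0 := div_ne_zero (neg_ne_zero.2 (mul_ne_zero two_ne_zero hp0))
      (mul_ne_zero three_ne_zero hp1)
    have hp0l : p 0 = -(3 * p 1 * l) / 2 := by rw [hl]; field_simp
    have hyi : ∀ i, y i ≠ 0 → y i = l * ((τ - a i) / (τ - m i)) := by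
      intro i hi
      have h1 := hg2 i hi
      have h2 := hτm i hi
      have h3 : (3 * p 1) * (y i * (τ - m i) - l * (τ - a i)) = 0 := by
        rw [hp0l] at h1; linear_combination h1
      rw [← mul_div_assoc, eq_div_iff h2]
      exact sub_eq_zero.1 ((mul_eq_zero.1 h3).resolve_left (mul_ne_zero three_ne_zero hp1))
    set S := Finset.univ.filter fun i => y i ≠ 0 with hS
    have memS : ∀ i, i ∈ S ↔ y i ≠ 0 := fun i => by simp [hS]
    have hsumS : ∀ (F : Fin 5 → ℂ), (∀ i, y i = 0 → F i = 0) → ∑ i, F i = ∑ i ∈ S, F i := by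
      intro F hF
      symm
      refine Finset.sum_subset (Finset.subset_univ S) fun i _ hi => hF i ?_
      by_contra h
      exact hi ((memS i).2 h)
    have hne : S.Nonempty := by
      obtain ⟨j, hj⟩ := Function.ne_iff.1 hy
      exact ⟨j, (memS j).2 hj⟩
    refine hT S (Finset.subset_univ S) hne τ (fun i hi =>
      ⟨sub_ne_zero.1 (hτa i ((memS i).1 hi)), sub_ne_zero.1 (hτm i ((memS i).1 hi))⟩) ?_ ?_
    · have h1 : γ 0 * ∑ i, (w i : ℂ) * (τ - a i) * y i ^ 2 = 0 := by
        rw [hγ1] at hq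
        rw [← hq, Finset.mul_sum, Finset.mul_sum, Finset.mul_sum, ← Finset.sum_add_distrib]
        exact Finset.sum_congr rfl fun i _ => by ring
      have h2 := (mul_eq_zero.1 h1).resolve_left hγ0
      rw [hsumS _ fun i hi => by rw [hi]; ring] at h2
      have h3 : l ^ 2 * ∑ i ∈ S, (w i : ℂ) * cubeOverSquare (a i) (m i) τ = 0 := by
        rw [← h2, Finset.mul_sum]
        refine Finset.sum_congr rfl fun i hi => ?_
        have h4 := hτm i ((memS i).1 hi)
        rw [hyi i ((memS i).1 hi), cubeOverSquare]
        field_simp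
      exact (mul_eq_zero.1 h3).resolve_left (pow_ne_zero _ hl0)
    -- Twice the fibre relation for k = 1. Substituting the values of y_i turns the sum into -l³
    -- R'(τ).
    · have h1 : p 1 * ∑ i, (w i : ℂ) * (2 * y i ^ 3 - 3 * l * y i ^ 2) = 0 := by
        rw [hp0l] at hf1
        have : 2 * (-(3 * p 1 * l) / 2 * ∑ i, (w i : ℂ) * y i ^ 2 + p 1 * ∑ i, (w i : ℂ) * y i ^ 3) = 0 := by
          rw [hf1, mul_zero]
        rw [← this, mul_add, Finset.mul_sum, Finset.mul_sum, Finset.mul_sum, Finset.mul_sum,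
          Finset.mul_sum, ← Finset.sum_add_distrib]
        exact Finset.sum_congr rfl fun i _ => by ring
      have h2 := (mul_eq_zero.1 h1).resolve_left hp1
      rw [hsumS _ fun i hi => by rw [hi]; ring] at h2
      have h3 : -l ^ 3 * ∑ i ∈ S, (w i : ℂ) * cubeOverSquareDeriv (a i) (m i) τ = 0 := by
        rw [← h2, Finset.mul_sum]
        refine Finset.sum_congr rfl fun i hi => ?_
        have h4 := hτm i ((memS i).1 hi)
        rw [hyi i ((memS i).1 hi), cubeOverSquareDeriv]
        field_simp
        ring
      exact (mul_eq_zero.1 h3).resolve_left (neg_ne_zero.2 (pow_ne_zero _ hl0))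

end Diagonal

/-! ### Openness of the absence of critical triples -/

section GenericNoCritical

/-- The variables `y`, `γ`, `x` of the system describing critical triples. -/
abbrev TripleVars : Type := Fin 5 ⊕ (Fin 2 ⊕ Fin 6)

/-- The partition of the variables of `TripleVars` into three blocks. -/
def tripleBlock : TripleVars → Fin 3 :=
  Sum.elim (fun _ => 0) (Sum.elim (fun _ => 1) fun _ => 2)

lemma isWeightedHomogeneous_rename_inl {A : Type*} [CommRing A] {p : MvPolynomial (Fin 5) A} {m : ℕ}
    (hp : p.IsHomogeneous m) :
    IsWeightedHomogeneous (blockWeight tripleBlock)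
      (rename Sum.inl p : MvPolynomial TripleVars A) (Pi.single 0 m) := by
  intro b hb
  obtain ⟨u, rfl, hu⟩ := coeff_rename_ne_zero _ _ _ hb
  have h := hp hu
  rw [Finsupp.weight_apply, Finsupp.sum_fintype _ _ (by simp)] at h
  rw [Finsupp.weight_apply, Finsupp.sum_mapDomain_index (by simp) (by intros; rw [add_smul]),
    Finsupp.sum_fintype _ _ (by simp), ← h]
  funext k
  rw [Finset.sum_apply]
  fin_cases k <;> simp [tripleBlock, blockWeight]

/-- The equations of critical triples, with the relation `a` replaced by a vector `x` for which
`(x 1, …, x 5)` is proportional to `y`. -/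
def tripleSystem {A : Type*} [CommRing A] (q c : Fin 2 → MvPolynomial (Fin 5) A) :
    Bool ⊕ ((Fin 5 × Fin 5) ⊕ ((Fin 2 × Fin 5) ⊕ (Fin 5 × Fin 5))) → MvPolynomial TripleVars A :=
  Sum.elim
    (fun b => ∑ k, X (Sum.inr (Sum.inl k)) * rename Sum.inl (bif b then q k else c k))
    (Sum.elim
      (fun ij => X (Sum.inr (Sum.inr ij.1.succ)) * X (Sum.inl ij.2) -
        X (Sum.inr (Sum.inr ij.2.succ)) * X (Sum.inl ij.1))
      (Sum.elim
        (fun kj => X (Sum.inr (Sum.inr 0)) * (rename Sum.inl (q kj.1) * X (Sum.inl kj.2)) +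
          X (Sum.inr (Sum.inr kj.2.succ)) * rename Sum.inl (c kj.1))
        (fun ij => ∑ k, X (Sum.inr (Sum.inl k)) *
          (X (Sum.inr (Sum.inr 0)) * (rename Sum.inl (pderiv ij.1 (q k)) * X (Sum.inl ij.2)) +
            X (Sum.inr (Sum.inr ij.2.succ)) * rename Sum.inl (pderiv ij.1 (c k))))))

lemma exists_isWeightedHomogeneous_tripleSystem {A : Type*} [CommRing A]
    {q c : Fin 2 → MvPolynomial (Fin 5) A} (hq : ∀ k, (q k).IsHomogeneous 2)
    (hc : ∀ k, (c k).IsHomogeneous 3) (i) :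
    ∃ e, IsWeightedHomogeneous (blockWeight tripleBlock) (tripleSystem q c i) e := by
  have hX : ∀ s, IsWeightedHomogeneous (blockWeight tripleBlock) (X s : MvPolynomial TripleVars A)
      (Pi.single (tripleBlock s) 1) := fun s => isWeightedHomogeneous_X _ _ s
  have h0 : ∀ m, (Pi.single 0 m + Pi.single 0 1 : Fin 3 → ℕ) = Pi.single 0 (m + 1) := fun m =>
    (Pi.single_add _ _ _).symm
  rcases i with b | ⟨i, j⟩ | ⟨k, j⟩ | ⟨i, j⟩
  · cases b
    · refine ⟨Pi.single 1 1 + Pi.single 0 3, ?_⟩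
      rw [tripleSystem, Sum.elim_inl]
      exact IsWeightedHomogeneous.sum _ _ _ fun k _ =>
        (hX (Sum.inr (Sum.inl k))).mul (isWeightedHomogeneous_rename_inl (hc k))
    · refine ⟨Pi.single 1 1 + Pi.single 0 2, ?_⟩
      rw [tripleSystem, Sum.elim_inl]
      exact IsWeightedHomogeneous.sum _ _ _ fun k _ =>
        (hX (Sum.inr (Sum.inl k))).mul (isWeightedHomogeneous_rename_inl (hq k))
  · exact ⟨_, ((hX _).mul (hX _)).sub ((hX _).mul (hX _))⟩
  · refine ⟨Pi.single 2 1 + Pi.single 0 3, IsWeightedHomogeneous.add ?_ ?_⟩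
    · exact (hX _).mul (h0 2 ▸ (isWeightedHomogeneous_rename_inl (hq k)).mul (hX (Sum.inl j)))
    · exact (hX _).mul (isWeightedHomogeneous_rename_inl (hc k))
  · refine ⟨Pi.single 1 1 + (Pi.single 2 1 + Pi.single 0 2), ?_⟩
    rw [tripleSystem, Sum.elim_inr, Sum.elim_inr, Sum.elim_inr]
    refine IsWeightedHomogeneous.sum _ _ _ fun k _ =>
        (hX (Sum.inr (Sum.inl k))).mul (IsWeightedHomogeneous.add ?_ ?_)
    · exact (hX _).mul (h0 1 ▸ (isWeightedHomogeneous_rename_inl (hq k).pderiv).mul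
        (hX (Sum.inl j)))
    · exact (hX _).mul (isWeightedHomogeneous_rename_inl (hc k).pderiv)

lemma map_tripleSystem {A B : Type*} [CommRing A] [CommRing B] (φ : A →+* B)
    (q c : Fin 2 → MvPolynomial (Fin 5) A) (i) :
    map φ (tripleSystem q c i) = tripleSystem (fun k => map φ (q k)) (fun k => map φ (c k)) i := by
  rcases i with b | ⟨i, j⟩ | ⟨k, j⟩ | ⟨i, j⟩
  · cases b <;> simp [tripleSystem, map_rename]
  · simp [tripleSystem]
  · simp [tripleSystem, map_rename]
  · simp [tripleSystem, map_rename, pderiv_map]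

/-- The expressions a₀ q + a₁ c mix degrees 2 and 3 in y, so elimination does not apply to (y, γ, a)
directly. With x = (a₀, a₁ y), and after multiplication by a coordinate of y, the equations become
multihomogeneous in (y, γ, x). Conversely a is recovered from x by dividing by a nonzero coordinate
y_j. -/
lemma noCriticalTriple_iff (q c : Fin 2 → MvPolynomial (Fin 5) ℂ) :
    NoCriticalTriple q c ↔ ∀ z : TripleVars → ℂ, (∀ i, eval z (tripleSystem q c i) = 0) →
      ∃ k, ∀ s, tripleBlock s = k → z s = 0 := by
  constructor
  · intro h z hz
    by_contra! hcon
    have hy : z ∘ Sum.inl ≠ 0 := by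
      intro h0
      obtain ⟨s, hs, hs0⟩ := hcon 0
      rcases s with s | s | s
      · exact hs0 (congrFun h0 s)
      all_goals simp [tripleBlock] at hs
    have hγ : (fun k => z (Sum.inr (Sum.inl k))) ≠ 0 := by
      intro h0
      obtain ⟨s, hs, hs0⟩ := hcon 1
      rcases s with s | s | s
      · simp [tripleBlock] at hs
      · exact hs0 (congrFun h0 s)
      · simp [tripleBlock] at hs
    obtain ⟨j, hj⟩ := Function.ne_iff.1 hy
    have hj' : z (Sum.inl j) ≠ 0 := hj
    set l := z (Sum.inr (Sum.inr j.succ)) / z (Sum.inl j) with hl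
    have hx : ∀ i : Fin 5, z (Sum.inr (Sum.inr i.succ)) = l * z (Sum.inl i) := by
      intro i
      have := hz (Sum.inr (Sum.inl (i, j)))
      simp only [tripleSystem, Sum.elim_inr, Sum.elim_inl, map_sub, map_mul, eval_X] at this
      rw [hl]; field_simp
      linear_combination this
    refine h _ _ ![z (Sum.inr (Sum.inr 0)), l] hy hγ ?_ ⟨?_, ?_, ?_, ?_⟩
    · intro h0
      obtain ⟨s, hs, hs0⟩ := hcon 2
      have h1 : z (Sum.inr (Sum.inr 0)) = 0 := congrFun h0 0
      have h2 : l = 0 := congrFun h0 1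
      rcases s with s | s | s
      · simp [tripleBlock] at hs
      · simp [tripleBlock] at hs
      · refine Fin.cases (fun hs0 => hs0 h1) (fun i hs0 => hs0 ?_) s hs0
        rw [hx, h2, zero_mul]
    · simpa [tripleSystem, eval_rename] using hz (Sum.inl true)
    · simpa [tripleSystem, eval_rename] using hz (Sum.inl false)
    · intro k
      have := hz (Sum.inr (Sum.inr (Sum.inl (k, j))))
      simp only [tripleSystem, Sum.elim_inr, Sum.elim_inl, map_add, map_mul, eval_X, eval_rename,
        hx] at this
      refine (mul_eq_zero.1 (?_ : z (Sum.inl j) * _ = 0)).resolve_left hj'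
      simp only [Matrix.cons_val_zero, Matrix.cons_val_one]
      linear_combination this
    · intro i
      have := hz (Sum.inr (Sum.inr (Sum.inr (i, j))))
      simp only [tripleSystem, Sum.elim_inr, map_sum, map_add, map_mul, eval_X, eval_rename,
        hx] at this
      refine (mul_eq_zero.1 (?_ : z (Sum.inl j) * _ = 0)).resolve_left hj'
      rw [← this, Finset.mul_sum]
      simp only [Matrix.cons_val_zero, Matrix.cons_val_one]
      exact Finset.sum_congr rfl fun k _ => by ring
  · rintro h y γ a hy hγ ha ⟨h1, h2, h3, h4⟩
    obtain ⟨k, hk⟩ := h (Sum.elim y (Sum.elim γ (Fin.cons (a 0) fun i => a 1 * y i))) (by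
      have hcomp : (Sum.elim y (Sum.elim γ (Fin.cons (a 0) fun i => a 1 * y i) : Fin 2 ⊕ Fin 6 → ℂ)) ∘
        Sum.inl = y := rfl
      rintro (b | ⟨i, j⟩ | ⟨k, j⟩ | ⟨i, j⟩)
      · cases b
        · simpa [tripleSystem, eval_rename, hcomp] using h2
        · simpa [tripleSystem, eval_rename, hcomp] using h1
      · simp [tripleSystem]; ring
      · simp only [tripleSystem, Sum.elim_inr, Sum.elim_inl, map_add, map_mul, eval_X, eval_rename,
          hcomp, Fin.cons_zero, Fin.cons_succ]
        linear_combination y j * h3 k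
      · simp only [tripleSystem, Sum.elim_inr, Sum.elim_inl, map_sum, map_add, map_mul, eval_X,
          eval_rename, hcomp, Fin.cons_zero, Fin.cons_succ]
        rw [← mul_zero (y j), ← h4 i, Finset.mul_sum]
        exact Finset.sum_congr rfl fun k _ => by ring)
    fin_cases k
    · exact hy (funext fun i => hk (Sum.inl i) rfl)
    · exact hγ (funext fun i => hk (Sum.inr (Sum.inl i)) rfl)
    · have h5 := hk (Sum.inr (Sum.inr 0)) rfl
      have h6 : ∀ i, a 1 * y i = 0 := fun i => hk (Sum.inr (Sum.inr i.succ)) rfl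
      obtain ⟨j, hj⟩ := Function.ne_iff.1 hy
      refine ha (funext fun k => ?_)
      fin_cases k
      · exact h5
      · exact (mul_eq_zero.1 (h6 j)).resolve_right hj

/-- The absence of critical triples is a Zariski open condition. -/
theorem exists_eval_ne_zero_noCriticalTriple {P : Type*}
    {q c : Fin 2 → MvPolynomial (Fin 5) (MvPolynomial P ℂ)} (hq : ∀ k, (q k).IsHomogeneous 2)
    (hc : ∀ k, (c k).IsHomogeneous 3) (p₀ : P → ℂ)
    (h0 : NoCriticalTriple (fun k => map (eval p₀) (q k)) fun k => map (eval p₀) (c k)) :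
    ∃ D : MvPolynomial P ℂ, eval p₀ D ≠ 0 ∧ ∀ p : P → ℂ, eval p D ≠ 0 →
      NoCriticalTriple (fun k => map (eval p) (q k)) fun k => map (eval p) (c k) := by
  choose e he using exists_isWeightedHomogeneous_tripleSystem hq hc
  simp only [noCriticalTriple_iff, ← map_tripleSystem] at h0 ⊢
  exact exists_eval_ne_zero_of_forall_zero tripleBlock (tripleSystem q c) e he p₀ h0

end GenericNoCritical

section

/-! ### Singularities of determinantal quintics -/

section Determinantal

/-- The system `q 0 = q 1 = c 0 = c 1 = 0`. -/
def baseSystem {R : Type*} [CommRing R] (q c : Fin 2 → MvPolynomial (Fin 5) R) :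
    Fin 4 → MvPolynomial (Fin 5) R :=
  ![q 0, q 1, c 0, c 1]

/-- The degrees of `baseSystem`. -/
abbrev baseDegrees : Fin 4 → ℕ := ![2, 2, 3, 3]

lemma isHomogeneous_baseSystem {R : Type*} [CommRing R] {q c : Fin 2 → MvPolynomial (Fin 5) R}
    (hq : ∀ k, (q k).IsHomogeneous 2) (hc : ∀ k, (c k).IsHomogeneous 3) (i : Fin 4) :
    (baseSystem q c i).IsHomogeneous (baseDegrees i) := by
  fin_cases i
  exacts [hq 0, hq 1, hc 0, hc 1]

lemma map_baseSystem {R S : Type*} [CommRing R] [CommRing S] (φ : R →+* S)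
    (q c : Fin 2 → MvPolynomial (Fin 5) R) (i : Fin 4) :
    map φ (baseSystem q c i) = baseSystem (fun k => map φ (q k)) (fun k => map φ (c k)) i := by
  fin_cases i <;> rfl

variable {q c : Fin 2 → MvPolynomial (Fin 5) ℂ} {y : Fin 5 → ℂ}

lemma eval_baseSystem_eq_zero_iff :
    (∀ i, eval y (baseSystem q c i) = 0) ↔
      (∀ k, eval y (q k) = 0) ∧ ∀ k, eval y (c k) = 0 := by
  simp [baseSystem, Fin.forall_fin_succ, and_assoc]

/-- The determinant `q 0 * c 1 - q 1 * c 0`. -/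
def detQuintic (q c : Fin 2 → MvPolynomial (Fin 5) ℂ) : MvPolynomial (Fin 5) ℂ :=
  q 0 * c 1 - q 1 * c 0

lemma isHomogeneous_detQuintic (hq : ∀ k, (q k).IsHomogeneous 2)
    (hc : ∀ k, (c k).IsHomogeneous 3) : (detQuintic q c).IsHomogeneous 5 :=
  ((hq 0).mul (hc 1)).sub ((hq 1).mul (hc 0))

lemma eval_pderiv_detQuintic (i : Fin 5) :
    eval y (pderiv i (detQuintic q c)) =
      eval y (q 0) * eval y (pderiv i (c 1)) + eval y (c 1) * eval y (pderiv i (q 0)) -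
        eval y (q 1) * eval y (pderiv i (c 0)) - eval y (c 0) * eval y (pderiv i (q 1)) := by
  simp only [detQuintic, map_sub, Derivation.leibniz, map_add, smul_eq_mul, map_mul]
  ring

/-- Common zeros of the system are singular points of the quintic. -/
lemma eval_pderiv_detQuintic_eq_zero (h : ∀ i, eval y (baseSystem q c i) = 0) (i : Fin 5) :
    eval y (pderiv i (detQuintic q c)) = 0 := by
  obtain ⟨h1, h2⟩ := eval_baseSystem_eq_zero_iff.1 h
  simp [eval_pderiv_detQuintic, h1, h2]

lemma eval_detQuintic_eq_zero (h : ∀ i, eval y (baseSystem q c i) = 0) :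
    eval y (detQuintic q c) = 0 := by
  obtain ⟨h1, h2⟩ := eval_baseSystem_eq_zero_iff.1 h
  simp [detQuintic, h1]

/-- Singular points of the quintic that are not zeros of the system give critical triples. -/
lemma exists_isCriticalTriple (h0 : eval y (detQuintic q c) = 0)
    (h1 : ∀ i, eval y (pderiv i (detQuintic q c)) = 0)
    (h2 : ¬ ∀ i, eval y (baseSystem q c i) = 0) :
    ∃ γ a, γ ≠ 0 ∧ a ≠ 0 ∧ IsCriticalTriple q c y γ a := by
  have hdet : eval y (q 0) * eval y (c 1) - eval y (q 1) * eval y (c 0) = 0 := by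
    simpa [detQuintic] using h0
  simp only [eval_pderiv_detQuintic] at h1
  have hne : ∀ {u v : ℂ}, u ≠ 0 ∨ v ≠ 0 → ![u, v] ≠ 0 := by
    rintro u v (h | h) h'
    · exact h (congrFun h' 0)
    · exact h (congrFun h' 1)
  have key : ∃ k l : Fin 2, eval y (![q, c] l k) ≠ 0 := by
    by_contra! hcon
    exact h2 (eval_baseSystem_eq_zero_iff.2 ⟨fun k => hcon k 0, fun k => hcon k 1⟩)
  obtain ⟨k, l, hkl⟩ := key
  have hrow : eval y (![q, c] l 1) ≠ 0 ∨ -eval y (![q, c] l 0) ≠ 0 := by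
    fin_cases k
    · exact Or.inr (neg_ne_zero.2 hkl)
    · exact Or.inl hkl
  have hcol : eval y (c k) ≠ 0 ∨ -eval y (q k) ≠ 0 := by
    fin_cases l
    · exact Or.inr (neg_ne_zero.2 hkl)
    · exact Or.inl hkl
  -- For a nonzero entry in row l and column k, γ is the vector orthogonal to row l and a the one
  -- orthogonal to column k. Both kill the whole matrix since its determinant is zero.
  refine ⟨_, _, hne hrow, hne hcol, ?_, ?_, fun j => ?_, fun i => ?_⟩
  · fin_cases l
    · simp [Fin.sum_univ_two]; ring
    · simp [Fin.sum_univ_two]; linear_combination hdet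
  · fin_cases l
    · simp [Fin.sum_univ_two]; linear_combination -hdet
    · simp [Fin.sum_univ_two]; ring
  · fin_cases k <;> fin_cases j <;>
      simp only [Matrix.cons_val_zero, Matrix.cons_val_one, Fin.zero_eta, Fin.mk_one, Fin.isValue]
    · ring
    · linear_combination -hdet
    · linear_combination hdet
    · ring
  -- With E the chosen entry, the contraction of dM with γ ⊗ a is E · d(det) - det · dE.
  · have hi := h1 i
    fin_cases k <;> fin_cases l <;>
      simp only [Fin.sum_univ_two, Matrix.cons_val_zero, Matrix.cons_val_one, Fin.zero_eta,
        Fin.mk_one, Fin.isValue]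
    · linear_combination eval y (q 0) * hi - eval y (pderiv i (q 0)) * hdet
    · linear_combination eval y (c 0) * hi - eval y (pderiv i (c 0)) * hdet
    · linear_combination eval y (q 1) * hi - eval y (pderiv i (q 1)) * hdet
    · linear_combination eval y (c 1) * hi - eval y (pderiv i (c 1)) * hdet

lemma eval_baseSystem_eq_zero_of_noCriticalTriple (h : NoCriticalTriple q c) (hy : y ≠ 0)
    (h0 : eval y (detQuintic q c) = 0) (h1 : ∀ i, eval y (pderiv i (detQuintic q c)) = 0) :
    ∀ i, eval y (baseSystem q c i) = 0 := by
  by_contra h2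
  obtain ⟨γ, a, hγ, ha, ht⟩ := exists_isCriticalTriple h0 h1 h2
  exact h y γ a hy hγ ha ht

/-- If the singular points of the quintic are transverse common zeros of the system, then there
are no critical triples. -/
lemma noCriticalTriple_of_transverse
    (hs : ∀ y ≠ 0, eval y (detQuintic q c) = 0 → (∀ i, eval y (pderiv i (detQuintic q c)) = 0) →
      ∀ i, eval y (baseSystem q c i) = 0)
    (ht : ∀ y ≠ 0, (∀ i, eval y (baseSystem q c i) = 0) →
      LinearIndependent ℂ (fun k i => eval y (pderiv i (baseSystem q c k)))) :
    NoCriticalTriple q c := by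
  rintro y γ a hy hγ ha ⟨h1, h2, h3, h4⟩
  obtain ⟨k, hk⟩ := Function.ne_iff.1 hγ
  obtain ⟨l, hl⟩ := Function.ne_iff.1 ha
  simp only [Pi.zero_apply, Fin.sum_univ_two] at hk hl h1 h2 h4
  have ha0 := h3 0
  have ha1 := h3 1
  -- With kernel vectors γ and a, the adjugate of the matrix is a multiple of γ ⊗ a. The critical
  -- relation thus makes the differential of the determinant vanish, so y is a singular point of the
  -- quintic.
  have hbase : ∀ i, eval y (baseSystem q c i) = 0 := by
    refine hs y hy ?_ fun i => ?_
    · simp only [detQuintic, map_sub, map_mul]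
      refine (mul_eq_zero.1 (?_ : γ k * _ = 0)).resolve_left hk
      fin_cases k
      · simp only [Fin.zero_eta, Fin.isValue]
        linear_combination eval y (c 1) * h1 - eval y (q 1) * h2
      · simp only [Fin.mk_one, Fin.isValue]
        linear_combination eval y (q 0) * h2 - eval y (c 0) * h1
    · rw [eval_pderiv_detQuintic]
      refine (mul_eq_zero.1 (?_ : (γ k * a l) * _ = 0)).resolve_left (mul_ne_zero hk hl)
      have h4i := h4 i
      fin_cases k <;> fin_cases l <;> simp only [Fin.zero_eta, Fin.mk_one, Fin.isValue]
      · linear_combination eval y (c 1) * h4i - γ 0 * eval y (pderiv i (c 0)) * ha1 - a 0 * eval y (pderiv i (q 1)) * h2 +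
          eval y (pderiv i (c 1)) * (a 0 * h1 - γ 1 * ha1)
      · linear_combination -eval y (q 1) * h4i + eval y (pderiv i (q 0)) * γ 0 * ha1 +
          eval y (pderiv i (q 1)) * (-a 1 * h2 + γ 1 * ha1) + eval y (pderiv i (c 1)) * a 1 * h1
      · linear_combination -eval y (c 0) * h4i + eval y (pderiv i (q 0)) * a 0 * h2 +
          eval y (pderiv i (c 0)) * (-a 0 * h1 + γ 0 * ha0) + eval y (pderiv i (c 1)) * γ 1 * ha0
      · linear_combination eval y (q 0) * h4i + eval y (pderiv i (q 0)) * (γ 1 * ha1 - a 0 * h1) -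
          eval y (pderiv i (c 0)) * a 1 * h1 - eval y (pderiv i (q 1)) * γ 1 * ha0
  -- At a base point the critical relation is a linear relation among the four gradients, with
  -- coefficients the entries of γ ⊗ a.
  have hli := Fintype.linearIndependent_iff.1 (ht y hy hbase)
    ![γ 0 * a 0, γ 1 * a 0, γ 0 * a 1, γ 1 * a 1] (by
      funext i
      simp only [Fin.sum_univ_four, baseSystem, Pi.add_apply, Pi.smul_apply, smul_eq_mul,
        Matrix.cons_val, Pi.zero_apply]
      linear_combination h4 i)
  refine mul_ne_zero hk hl ?_
  fin_cases k <;> fin_cases l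
  exacts [hli 0, hli 2, hli 1, hli 3]

/-- The Hessian of the quintic at a common zero of the system has rank four exactly if the
gradients of the system are independent. -/
lemma rank_hessian_eq_four_iff (h : ∀ i, eval y (baseSystem q c i) = 0) :
    (Matrix.of fun i j : Fin 5 =>
      eval y (pderiv i (pderiv j (detQuintic q c)))).rank = 4 ↔
      LinearIndependent ℂ (fun k i => eval y (pderiv i (baseSystem q c k))) := by
  obtain ⟨h1, h2⟩ := eval_baseSystem_eq_zero_iff.1 h
  set N : Matrix (Fin 4) (Fin 5) ℂ := Matrix.of fun k i => eval y (pderiv i (baseSystem q c k))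
    with hN
  -- The Gram matrix of the determinant as a quadratic form in its four entries. At a base point
  -- only products of first derivatives survive, so the Hessian is NᵀJN.
  let J : Matrix (Fin 4) (Fin 4) ℂ := !![0, 0, 0, 1; 0, 0, -1, 0; 0, -1, 0, 0; 1, 0, 0, 0]
  have hJ : J * J = 1 := by
    ext i j
    fin_cases i <;> fin_cases j <;> simp [J, Matrix.mul_apply, Fin.sum_univ_four]
  have hH : (Matrix.of fun i j : Fin 5 => eval y (pderiv i (pderiv j (detQuintic q c)))) =
      N.transpose * (J * N) := by
    ext i j
    simp only [Matrix.of_apply, detQuintic, map_sub, Derivation.leibniz, map_add, smul_eq_mul,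
      map_mul, h1, h2, Matrix.mul_apply, Fin.sum_univ_four, Matrix.transpose_apply, hN, baseSystem,
      J]
    simp
    ring
  rw [hH]
  constructor
  · intro hr
    have h3 : 4 ≤ N.rank := by
      refine hr.symm.le.trans ?_
      exact (Matrix.rank_mul_le_right _ _).trans (Matrix.rank_mul_le_right _ _)
    rw [Matrix.rank_eq_finrank_span_row] at h3
    have : LinearIndependent ℂ N.row := by
      rw [linearIndependent_iff_card_le_finrank_span]
      simpa [Set.finrank] using h3
    exact this
  · intro hli
    have hNr : N.rank = 4 := by
      have : LinearIndependent ℂ N.row := hli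
      simpa using this.rank_matrix
    have hJN : (J * N).rank = 4 := by
      rw [Matrix.rank_mul_eq_right_of_isUnit_det _ _
        ((Matrix.isUnit_iff_isUnit_det _).1 (IsUnit.of_mul_eq_one _ hJ)), hNr]
    -- Nᵀ is injective, so the Hessian has the same kernel, hence the same rank, as JN.
    have hinj : LinearMap.ker N.transpose.mulVecLin = ⊥ := by
      rw [LinearMap.ker_eq_bot]
      have : LinearIndependent ℂ N.transpose.col := hli
      exact Matrix.mulVec_injective_iff.2 this
    have e1 := LinearMap.finrank_range_add_finrank_ker (N.transpose * (J * N)).mulVecLin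
    have e2 := LinearMap.finrank_range_add_finrank_ker (J * N).mulVecLin
    rw [Matrix.mulVecLin_mul, LinearMap.ker_comp_of_ker_eq_bot _ hinj,
      ← Matrix.mulVecLin_mul] at e1
    have e3 : Module.finrank ℂ (LinearMap.range (J * N).mulVecLin) = 4 := hJN
    change Module.finrank ℂ (LinearMap.range (N.transpose * (J * N)).mulVecLin) = 4
    omega

end Determinantal

end

section

/-! ### Cubics with a double point -/

section Cubics

lemma degree_cons {n : ℕ} (i : ℕ) (b : Fin n →₀ ℕ) :
    ∑ j, (Finsupp.cons i b : Fin (n + 1) →₀ ℕ) j = i + ∑ j, b j := by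
  rw [Fin.sum_univ_succ, Finsupp.cons_zero]
  simp

lemma isHomogeneous_iff_sum {σ R : Type*} [Fintype σ] [CommSemiring R] {p : MvPolynomial σ R}
    {m : ℕ} : p.IsHomogeneous m ↔ ∀ b, coeff b p ≠ 0 → ∑ i, b i = m := by
  refine forall_congr' fun b => forall_congr' fun _ => ?_
  rw [Finsupp.weight_apply, Finsupp.sum_fintype _ _ (by simp)]
  simp

lemma isHomogeneous_coeff_finSuccEquiv {n m i : ℕ} {F : MvPolynomial (Fin (n + 1)) ℂ}
    (hF : F.IsHomogeneous (i + m)) : ((finSuccEquiv ℂ n F).coeff i).IsHomogeneous m := by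
  rw [isHomogeneous_iff_sum] at hF ⊢
  intro b hb
  rw [finSuccEquiv_coeff_coeff] at hb
  have := hF _ hb
  rw [degree_cons] at this
  omega

lemma isHomogeneous_of_mem {F : MvPolynomial (Fin 6) ℂ} (hF : F ∈ doublePointCubics) :
    F.IsHomogeneous 3 := hF.1

lemma isHomogeneous_quadricPart {F : MvPolynomial (Fin 6) ℂ} (hF : F ∈ doublePointCubics) :
    (quadricPart F).IsHomogeneous 2 :=
  isHomogeneous_coeff_finSuccEquiv (m := 2) (i := 1) (isHomogeneous_of_mem hF)

lemma isHomogeneous_cubicPart {F : MvPolynomial (Fin 6) ℂ} (hF : F ∈ doublePointCubics) :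
    (cubicPart F).IsHomogeneous 3 :=
  isHomogeneous_coeff_finSuccEquiv (m := 3) (i := 0) (isHomogeneous_of_mem hF)

/-- The cubic `x₀ q(x₁,…,x₅) + c(x₁,…,x₅)`. -/
def cubicOf (q c : MvPolynomial (Fin 5) ℂ) : MvPolynomial (Fin 6) ℂ :=
  X 0 * rename Fin.succ q + rename Fin.succ c

lemma finSuccEquiv_rename_succ {n : ℕ} (p : MvPolynomial (Fin n) ℂ) :
    finSuccEquiv ℂ n (rename Fin.succ p) = Polynomial.C p := by
  induction p using MvPolynomial.induction_on with
  | C a => simp [finSuccEquiv_apply]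
  | add p q hp hq => simp [hp, hq]
  | mul_X p i hp => rw [map_mul, map_mul, hp, rename_X, finSuccEquiv_X_succ, map_mul]

lemma quadricPart_cubicOf (q c : MvPolynomial (Fin 5) ℂ) : quadricPart (cubicOf q c) = q := by
  rw [quadricPart, cubicOf, map_add, map_mul, finSuccEquiv_X_zero, finSuccEquiv_rename_succ,
    finSuccEquiv_rename_succ, Polynomial.coeff_add, ← zero_add 1, Polynomial.coeff_X_mul,
    Polynomial.coeff_C_zero, Polynomial.coeff_C_succ, add_zero]

lemma cubicPart_cubicOf (q c : MvPolynomial (Fin 5) ℂ) : cubicPart (cubicOf q c) = c := by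
  rw [cubicPart, cubicOf, map_add, map_mul, finSuccEquiv_X_zero, finSuccEquiv_rename_succ,
    finSuccEquiv_rename_succ, Polynomial.coeff_add, Polynomial.coeff_X_mul_zero,
    Polynomial.coeff_C_zero, zero_add]

lemma rename_succ_mem_pow {n m : ℕ} {p : MvPolynomial (Fin n) ℂ} (hp : p.IsHomogeneous m) :
    rename Fin.succ p ∈
      (Ideal.span (Set.range fun i : Fin n => (X i.succ : MvPolynomial (Fin (n + 1)) ℂ))) ^ m := by
  rw [p.as_sum, map_sum]
  refine Ideal.sum_mem _ fun b hb => ?_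
  rw [rename_monomial, ← isHomogeneous_iff_sum.1 hp b (mem_support_iff.1 hb), monomial_eq,
    Finsupp.prod_mapDomain_index (by simp) (by intros; rw [pow_add]),
    Finsupp.prod_fintype _ _ (by simp), ← Finset.prod_pow_eq_pow_sum]
  exact Ideal.mul_mem_left _ _ (Ideal.prod_mem_prod fun i _ =>
    Ideal.pow_mem_pow (Ideal.subset_span (Set.mem_range_self i)) _)

lemma cubicOf_mem {q c : MvPolynomial (Fin 5) ℂ} (hq : q.IsHomogeneous 2) (hc : c.IsHomogeneous 3) :
    cubicOf q c ∈ doublePointCubics := by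
  refine ⟨?_, ?_⟩
  · have h1 : (X 0 * rename Fin.succ q : MvPolynomial (Fin 6) ℂ).IsHomogeneous (1 + 2) :=
      (isHomogeneous_X ℂ 0).mul hq.rename_isHomogeneous
    exact h1.add hc.rename_isHomogeneous
  · exact Ideal.add_mem _ (Ideal.mul_mem_left _ _ (rename_succ_mem_pow hq))
      (Ideal.pow_le_pow_right (by norm_num) (rename_succ_mem_pow hc))

/-- The polynomial of degree `m` in `x₁, …, x₅` whose coefficients are the coordinates, on the
space of pairs of polynomials, of the coefficients at `x₀ ^ i`. -/
def genericPart (i m : ℕ) (k : Fin 2) :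
    MvPolynomial (Fin 5) (MvPolynomial (Fin 2 × (Fin 6 →₀ ℕ)) ℂ) :=
  ∑ b ∈ Finset.univ.finsuppAntidiag m, monomial b (X (k, b.cons i))

lemma isHomogeneous_genericPart (i m : ℕ) (k : Fin 2) : (genericPart i m k).IsHomogeneous m := by
  refine IsHomogeneous.sum _ _ _ fun b hb => isHomogeneous_monomial _ ?_
  rw [Finset.mem_finsuppAntidiag] at hb
  rw [← hb.1, Finsupp.degree_eq_sum]

/-- The coefficients of a pair of polynomials. -/
def pairCoeff (F F' : MvPolynomial (Fin 6) ℂ) (s : Fin 2 × (Fin 6 →₀ ℕ)) : ℂ :=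
  coeff s.2 (![F, F'] s.1)

/-- Specialising the universal coefficients to an actual pair. Homogeneity guarantees that no
coefficient lies outside the finite range of the universal sum. -/
lemma map_genericPart {i m : ℕ} {F F' : MvPolynomial (Fin 6) ℂ} (hF : F.IsHomogeneous (i + m))
    (hF' : F'.IsHomogeneous (i + m)) (k : Fin 2) :
    map (eval (pairCoeff F F')) (genericPart i m k) =
      (finSuccEquiv ℂ 5 (![F, F'] k)).coeff i := by
  have hk : (![F, F'] k).IsHomogeneous (i + m) := by fin_cases k <;> assumption
  ext b
  rw [finSuccEquiv_coeff_coeff, genericPart, map_sum, coeff_sum]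
  simp only [map_monomial, coeff_monomial, eval_X, pairCoeff]
  rw [Finset.sum_ite_eq']
  split_ifs with hb
  · rfl
  · symm
    by_contra hne
    refine hb (Finset.mem_finsuppAntidiag.2 ⟨?_, Finset.subset_univ _⟩)
    have := isHomogeneous_iff_sum.1 hk _ hne
    rw [degree_cons] at this
    exact Nat.add_left_cancel this

/-- Restricted to the line through p₁ and p₂, both polynomials are nonzero polynomials in one
variable, so their product is nonzero. Working on a line keeps the point found inside the linear
space of admissible pencils. -/
lemma exists_eval_lineMap_ne_zero {P : Type*} {D₁ D₂ : MvPolynomial P ℂ} {p₁ p₂ : P → ℂ}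
    (h₁ : eval p₁ D₁ ≠ 0) (h₂ : eval p₂ D₂ ≠ 0) :
    ∃ s : ℂ, eval (fun i => (1 - s) * p₁ i + s * p₂ i) (D₁ * D₂) ≠ 0 := by
  let φ : MvPolynomial P ℂ →ₐ[ℂ] Polynomial ℂ := aeval fun i =>
    (1 - Polynomial.X) * Polynomial.C (p₁ i) + Polynomial.X * Polynomial.C (p₂ i)
  have hφ : ∀ s D, (φ D).eval s = eval (fun i => (1 - s) * p₁ i + s * p₂ i) D := by
    intro s D
    have : (Polynomial.evalRingHom s).comp φ.toRingHom =
        eval (fun i => (1 - s) * p₁ i + s * p₂ i) := by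
      apply MvPolynomial.ringHom_ext <;> intros <;> simp [φ]
      ring
    exact congrArg (fun ψ : MvPolynomial P ℂ →+* ℂ => ψ D) this
  by_contra! hcon
  have h0 : φ (D₁ * D₂) = 0 := Polynomial.funext fun s => by rw [hφ, hcon, Polynomial.eval_zero]
  rw [map_mul] at h0
  rcases mul_eq_zero.1 h0 with h | h
  · have := hφ 0 D₁
    rw [h, Polynomial.eval_zero] at this
    exact h₁ (by simpa using this.symm)
  · have := hφ 1 D₂
    rw [h, Polynomial.eval_zero] at this
    exact h₂ (by simpa using this.symm)

end Cubics

/-! ### The generic pencil and the 36 nodes -/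

section Generic

/-- The quadrics of a pencil. -/
def pencilQuadrics (F₀ F₁ : MvPolynomial (Fin 6) ℂ) : Fin 2 → MvPolynomial (Fin 5) ℂ :=
  fun k => quadricPart (![F₀, F₁] k)

/-- The cubics of a pencil. -/
def pencilCubics (F₀ F₁ : MvPolynomial (Fin 6) ℂ) : Fin 2 → MvPolynomial (Fin 5) ℂ :=
  fun k => cubicPart (![F₀, F₁] k)

variable {F₀ F₁ : MvPolynomial (Fin 6) ℂ}

lemma detQuintic_pencil : detQuintic (pencilQuadrics F₀ F₁) (pencilCubics F₀ F₁) = quintic F₀ F₁ :=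
  rfl

lemma isHomogeneous_pencilQuadrics (h₀ : F₀ ∈ doublePointCubics) (h₁ : F₁ ∈ doublePointCubics)
    (k : Fin 2) : (pencilQuadrics F₀ F₁ k).IsHomogeneous 2 := by
  fin_cases k
  exacts [isHomogeneous_quadricPart h₀, isHomogeneous_quadricPart h₁]

lemma isHomogeneous_pencilCubics (h₀ : F₀ ∈ doublePointCubics) (h₁ : F₁ ∈ doublePointCubics)
    (k : Fin 2) : (pencilCubics F₀ F₁ k).IsHomogeneous 3 := by
  fin_cases k
  exacts [isHomogeneous_cubicPart h₀, isHomogeneous_cubicPart h₁]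

/-- The common zeros of the quadrics and cubics of a pencil. -/
abbrev baseZeros (F₀ F₁ : MvPolynomial (Fin 6) ℂ) : Set (ℙ ℂ (Fin 5 → ℂ)) :=
  projZeros (n := 4) (baseSystem (pencilQuadrics F₀ F₁) (pencilCubics F₀ F₁))

lemma baseZeros_subset_singularPoints :
    (fun p : PSpace 4 => p 0) ⁻¹' baseZeros F₀ F₁ ⊆ singularPoints (n := 4) (quintic F₀ F₁) := by
  rw [← detQuintic_pencil]
  exact fun _ hp => ⟨eval_detQuintic_eq_zero hp, eval_pderiv_detQuintic_eq_zero hp⟩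

lemma ncard_preimage_eval_zero (A : Set (ℙ ℂ (Fin 5 → ℂ))) :
    ((fun p : PSpace 4 => p 0) ⁻¹' A).ncard = A.ncard := by
  refine Set.ncard_preimage_of_injective_subset_range (fun p p' h => ?_)
    fun x _ => ⟨fun _ => x, rfl⟩
  funext i
  rw [Subsingleton.elim i 0]
  exact h

lemma isODP_of_mem_baseZeros {p : PSpace 4} (hp : p 0 ∈ baseZeros F₀ F₁) :
    IsODP (n := 4) (quintic F₀ F₁) p ↔ LinearIndependent ℂ (fun k i => eval (p 0).rep
      (pderiv i (baseSystem (pencilQuadrics F₀ F₁) (pencilCubics F₀ F₁) k))) := by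
  rw [← rank_hessian_eq_four_iff hp]
  exact ⟨fun h => h.2, fun h => ⟨baseZeros_subset_singularPoints hp, h⟩⟩

/-- The open set is the intersection of two. On the first there are no critical triples, so all
singular points are base points; it contains the diagonal pencil. On the second the base points are
transverse, so they are nodes and Bézout counts 2·2·3·3 of them; it contains the Fermat pencil. -/
theorem forGenericPencil_hasExactlyODPs : ForGenericPencil (fun F₀ F₁ =>
      HasExactlyODPs (n := 4) (quintic F₀ F₁) 36) := by
  obtain ⟨q, c, hq, hc, hqc⟩ := exists_noCriticalTriple
  set l : Fin 5 → ℂ := Pi.single 0 1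
  have hl : ∀ y ≠ 0, (∀ k, eval y (fermatSystem baseDegrees k) = 0) → ∑ i, l i * y i ≠ 0 := by
    intro y hy h0
    have := fermatSystem_zero_ne_zero (by decide) hy h0
    simpa [l, Pi.single_apply] using this
  set f := fermatSystem baseDegrees
  have hf := isHomogeneous_fermatSystem baseDegrees
  let gq : Fin 2 → MvPolynomial (Fin 5) (MvPolynomial (Fin 2 × (Fin 6 →₀ ℕ)) ℂ) := genericPart 1 2
  let gc : Fin 2 → MvPolynomial (Fin 5) (MvPolynomial (Fin 2 × (Fin 6 →₀ ℕ)) ℂ) := genericPart 0 3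
  have hgq : ∀ F ∈ doublePointCubics, ∀ F' ∈ doublePointCubics,
      (fun k => map (eval (pairCoeff F F')) (gq k)) = pencilQuadrics F F' := fun F hF F' hF' =>
    funext fun k => map_genericPart (isHomogeneous_of_mem hF) (isHomogeneous_of_mem hF') k
  have hgc : ∀ F ∈ doublePointCubics, ∀ F' ∈ doublePointCubics,
      (fun k => map (eval (pairCoeff F F')) (gc k)) = pencilCubics F F' := fun F hF F' hF' =>
    funext fun k => map_genericPart (isHomogeneous_of_mem (by exact hF))
      (isHomogeneous_of_mem (by exact hF')) k
  have hgb : ∀ F ∈ doublePointCubics, ∀ F' ∈ doublePointCubics,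
      (fun k => map (eval (pairCoeff F F')) (baseSystem gq gc k)) =
        baseSystem (pencilQuadrics F F') (pencilCubics F F') := by
    intro F hF F' hF'
    funext k
    rw [map_baseSystem, hgq F hF F' hF', hgc F hF F' hF']
  have hA := cubicOf_mem (hq 0) (hc 0)
  have hA' := cubicOf_mem (hq 1) (hc 1)
  have hB := cubicOf_mem (hf 0) (hf 2)
  have hB' := cubicOf_mem (hf 1) (hf 3)
  set A := cubicOf (q 0) (c 0)
  set A' := cubicOf (q 1) (c 1)
  set B := cubicOf (f 0) (f 2)
  set B' := cubicOf (f 1) (f 3)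
  have hAq : pencilQuadrics A A' = q := by
    funext k; fin_cases k <;> exact quadricPart_cubicOf _ _
  have hAc : pencilCubics A A' = c := by
    funext k; fin_cases k <;> exact cubicPart_cubicOf _ _
  have hBf : baseSystem (pencilQuadrics B B') (pencilCubics B B') = f := by
    funext k
    fin_cases k
    exacts [quadricPart_cubicOf _ _, quadricPart_cubicOf _ _, cubicPart_cubicOf _ _,
      cubicPart_cubicOf _ _]
  obtain ⟨D₁, hD₁, hD₁'⟩ := exists_eval_ne_zero_noCriticalTriple (q := gq) (c := gc)
    (isHomogeneous_genericPart _ _) (isHomogeneous_genericPart _ _) (pairCoeff A A') (by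
      rw [hgq A hA A' hA', hgc A hA A' hA', hAq, hAc]
      exact hqc)
  obtain ⟨D₂, hD₂, hD₂'⟩ := exists_eval_ne_zero_transverse (n := 4) (f := baseSystem gq gc)
    (d := baseDegrees)
    (isHomogeneous_baseSystem (isHomogeneous_genericPart _ _) (isHomogeneous_genericPart _ _)) l
    (pairCoeff B B') (by
      intro y hy h0
      have h1 : ∀ k, map (eval (pairCoeff B B')) (baseSystem gq gc k) = f k := fun k =>
        congrFun ((hgb B hB B' hB').trans hBf) k
      simp only [h1] at h0 ⊢
      exact eval_jacDet_ne_zero hf h0 (hl y hy h0)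
        (linearIndependent_fermatSystem (by decide) hy h0))
  refine ⟨D₁ * D₂, ?_, fun F hF F' hF' hD => ?_⟩
  · obtain ⟨s, hs⟩ := exists_eval_lineMap_ne_zero hD₁ hD₂
    refine ⟨(1 - s) • A + s • B, Submodule.add_mem _ (Submodule.smul_mem _ _ hA)
      (Submodule.smul_mem _ _ hB), (1 - s) • A' + s • B', Submodule.add_mem _
      (Submodule.smul_mem _ _ hA') (Submodule.smul_mem _ _ hB'), ?_⟩
    have hpc : pairCoeff ((1 - s) • A + s • B) ((1 - s) • A' + s • B') =
        fun i => (1 - s) * pairCoeff A A' i + s * pairCoeff B B' i := by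
      funext ⟨k, b⟩
      fin_cases k <;> simp [pairCoeff]
    change eval (pairCoeff _ _) _ ≠ 0
    rw [hpc]
    exact hs
  · change eval (pairCoeff F F') _ ≠ 0 at hD
    rw [map_mul] at hD
    have hcrit := hD₁' _ (left_ne_zero_of_mul hD)
    rw [hgq F hF F' hF', hgc F hF F' hF'] at hcrit
    have htr := hD₂' _ (right_ne_zero_of_mul hD)
    have hgb' : ∀ k, map (eval (pairCoeff F F')) (baseSystem gq gc k) =
        baseSystem (pencilQuadrics F F') (pencilCubics F F') k := fun k =>
      congrFun (hgb F hF F' hF') k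
    simp only [hgb'] at htr
    have hfin := projZeros_finite_and_ncard (n := 4) (d := baseDegrees) (by decide)
      (isHomogeneous_baseSystem (isHomogeneous_pencilQuadrics hF hF')
        (isHomogeneous_pencilCubics hF hF')) hl htr
    have hsing : singularPoints (n := 4) (quintic F F') =
        (fun p : PSpace 4 => p 0) ⁻¹' baseZeros F F' := by
      refine Set.Subset.antisymm (fun p hp => ?_) baseZeros_subset_singularPoints
      exact eval_baseSystem_eq_zero_of_noCriticalTriple hcrit (p 0).rep_nonzero hp.1 hp.2
    have hinj : Function.Injective fun p : PSpace 4 => p 0 := fun p p' h => by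
      funext i
      rw [Subsingleton.elim i 0]
      exact h
    rw [HasExactlyODPs, hsing]
    refine ⟨hfin.1.preimage hinj.injOn, ?_, fun p hp => ?_⟩
    · rw [ncard_preimage_eval_zero, hfin.2]
      rfl
    · exact (isODP_of_mem_baseZeros hp).2
        (linearIndependent_of_eval_jacDet_ne_zero (htr _ (p 0).rep_nonzero hp))

/-- If the quintic has exactly `36` singular points, all nodes, then these are the common zeros of
the quadrics and cubics, which are transverse. -/
theorem singularPoints_eq_of_hasExactlyODPs (h₀ : F₀ ∈ doublePointCubics)
    (h₁ : F₁ ∈ doublePointCubics) (h : HasExactlyODPs (n := 4) (quintic F₀ F₁) 36) :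
    singularPoints (n := 4) (quintic F₀ F₁) = (fun p : PSpace 4 => p 0) ⁻¹' baseZeros F₀ F₁ ∧
      ∀ y ≠ 0, (∀ i, eval y (baseSystem (pencilQuadrics F₀ F₁) (pencilCubics F₀ F₁) i) = 0) →
        LinearIndependent ℂ (fun k i => eval y
          (pderiv i (baseSystem (pencilQuadrics F₀ F₁) (pencilCubics F₀ F₁) k))) := by
  obtain ⟨hfin, hcard, hodp⟩ := h
  have hhom := isHomogeneous_baseSystem (isHomogeneous_pencilQuadrics h₀ h₁)
    (isHomogeneous_pencilCubics h₀ h₁)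
  set f := baseSystem (pencilQuadrics F₀ F₁) (pencilCubics F₀ F₁)
  -- Base points are singular, hence nodes by hypothesis, hence transverse. Passing from the chosen
  -- representative to y rescales each gradient by a unit.
  have htr : ∀ y ≠ 0, (∀ i, eval y (f i) = 0) →
      LinearIndependent ℂ (fun k i => eval y (pderiv i (f k))) := by
    intro y hy h0
    let p : PSpace 4 := fun _ => Projectivization.mk ℂ y hy
    have hp : p 0 ∈ baseZeros F₀ F₁ := fun k => (eval_mk_rep_eq_zero_iff (hhom k) hy).2 (h0 k)
    have hli := (isODP_of_mem_baseZeros hp).1 (hodp p (baseZeros_subset_singularPoints hp))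
    obtain ⟨a, ha⟩ := Projectivization.exists_smul_eq_mk_rep ℂ y hy
    have hrep : (p 0).rep = (a : ℂ) • y := ha.symm
    have hsc : (fun k i => eval (p 0).rep (pderiv i (f k))) =
        fun k => (a ^ (baseDegrees k - 1) : ℂˣ) • fun i => eval y (pderiv i (f k)) := by
      funext k i
      rw [hrep, eval_smul_of_isHomogeneous (hhom k).pderiv]
      simp [Units.smul_def]
    change LinearIndependent ℂ (fun k i => eval (p 0).rep (pderiv i (f k))) at hli
    rw [hsc] at hli
    have := hli.units_smul fun k => (a ^ (baseDegrees k - 1))⁻¹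
    convert this using 1
    funext k
    simp [smul_smul]
  have hzfin : (baseZeros F₀ F₁).Finite := by
    refine (hfin.image fun p : PSpace 4 => p 0).subset fun x hx => ?_
    exact ⟨fun _ => x, baseZeros_subset_singularPoints (F₀ := F₀) (F₁ := F₁) (a := fun _ => x) hx,
      rfl⟩
  have hzcard := projZeros_ncard_of_transverse (n := 4) (d := baseDegrees) (by decide) hhom hzfin htr
  -- By Bézout the base points already account for all 36 singular points.
  refine ⟨(Set.eq_of_subset_of_ncard_le baseZeros_subset_singularPoints ?_ hfin).symm, htr⟩
  rw [hcard, ncard_preimage_eval_zero, hzcard]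
  decide

end Generic

end

/-! ### Points and polynomials on products of projective spaces -/

section Points

variable {n : ℕ}

lemma toProj_rep (p : ℙ ℂ (Fin (n + 1) → ℂ)) : toProj p.rep = p := by
  rw [toProj_of_ne_zero p.rep_nonzero, p.mk_rep]

lemma exists_rep_toProj {v : Fin (n + 1) → ℂ} (hv : v ≠ 0) :
    ∃ a : ℂ, a ≠ 0 ∧ (toProj v).rep = a • v := by
  obtain ⟨a, ha⟩ := Projectivization.exists_smul_eq_mk_rep ℂ v hv
  exact ⟨a, a.ne_zero, by rw [toProj_of_ne_zero hv, ← ha]; rfl⟩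

lemma toProj_smul {a : ℂ} (ha : a ≠ 0) (v : Fin (n + 1) → ℂ) : toProj (a • v) = toProj v := by
  by_cases hv : v = 0
  · rw [hv, smul_zero]
  · rw [toProj_of_ne_zero hv, toProj_of_ne_zero (smul_ne_zero ha hv),
      Projectivization.mk_eq_mk_iff']
    exact ⟨a, rfl⟩

lemma toProj_eq_of_smul_eq_smul {a b : ℂ} (ha : a ≠ 0) (hb : b ≠ 0) {v w : Fin (n + 1) → ℂ}
    (h : a • v = b • w) : toProj v = toProj w := by
  rw [← toProj_smul ha, h, toProj_smul hb]

/-- Two vectors of the plane with vanishing determinant define the same point. -/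
lemma toProj_eq_of_mul_eq {v w : Fin 2 → ℂ} (hv : v ≠ 0) (hw : w ≠ 0)
    (h : v 0 * w 1 = v 1 * w 0) : toProj v = toProj w := by
  by_cases h0 : v 0 = 0
  · have h1 : v 1 ≠ 0 := fun h1 => hv (by ext i; fin_cases i <;> assumption)
    have h2 : w 0 = 0 := by
      rw [h0, zero_mul] at h
      exact (mul_eq_zero.1 h.symm).resolve_left h1
    have h3 : w 1 ≠ 0 := fun h3 => hw (by ext i; fin_cases i <;> assumption)
    refine toProj_eq_of_smul_eq_smul h3 h1 ?_
    ext i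
    fin_cases i
    · simp [h0, h2]
    · exact mul_comm _ _
  · have h2 : w 0 ≠ 0 := by
      intro h2
      rw [h2, mul_zero] at h
      have h3 := (mul_eq_zero.1 h).resolve_left h0
      exact hw (by ext i; fin_cases i <;> assumption)
    refine toProj_eq_of_smul_eq_smul h2 h0 ?_
    ext i
    fin_cases i
    · exact mul_comm _ _
    · exact (mul_comm _ _).trans h.symm

end Points

/-! ### Multihomogeneous polynomials and their values -/

section Multihomogeneous

variable {ι : Type} [DecidableEq ι] {d : ι → ℕ}

lemma isMultihomogeneous_X (s : Σ i : ι, Fin (d i + 1)) :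
    IsMultihomogeneous (X s : CoordRing d) (Pi.single s.1 1) :=
  isWeightedHomogeneous_X ℂ _ s

lemma IsMultihomogeneous.mul {G G' : CoordRing d} {m m' : ι → ℕ} (h : IsMultihomogeneous G m)
    (h' : IsMultihomogeneous G' m') : IsMultihomogeneous (G * G') (m + m') :=
  IsWeightedHomogeneous.mul h h'

lemma IsMultihomogeneous.add {G G' : CoordRing d} {m : ι → ℕ} (h : IsMultihomogeneous G m)
    (h' : IsMultihomogeneous G' m) : IsMultihomogeneous (G + G') m :=
  IsWeightedHomogeneous.add h h'

lemma IsMultihomogeneous.sub {G G' : CoordRing d} {m : ι → ℕ} (h : IsMultihomogeneous G m)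
    (h' : IsMultihomogeneous G' m) : IsMultihomogeneous (G - G') m :=
  IsWeightedHomogeneous.sub h h'

lemma IsMultihomogeneous.neg {G : CoordRing d} {m : ι → ℕ} (h : IsMultihomogeneous G m) :
    IsMultihomogeneous (-G) m :=
  IsWeightedHomogeneous.neg h

lemma isMultihomogeneous_C (r : ℂ) : IsMultihomogeneous (C r : CoordRing d) 0 :=
  isWeightedHomogeneous_C _ r

/-- A homogeneous polynomial in a single block of coordinates is multihomogeneous. -/
lemma isMultihomogeneous_rename {τ : Type*} [Fintype τ] {emb : τ → Σ i : ι, Fin (d i + 1)} {i : ι}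
    (hemb : ∀ k, (emb k).1 = i) {p : MvPolynomial τ ℂ} {m : ℕ} (hp : p.IsHomogeneous m) :
    IsMultihomogeneous (rename emb p : CoordRing d) (Pi.single i m) := by
  intro b hb
  obtain ⟨u, rfl, hu⟩ := coeff_rename_ne_zero _ _ _ hb
  rw [Finsupp.weight_apply, Finsupp.sum_mapDomain_index (by simp) (by intros; rw [add_smul]),
    Finsupp.sum_fintype _ _ (by simp), ← isHomogeneous_iff_sum.1 hp u hu]
  simp only [hemb]
  rw [← Finset.sum_smul]
  funext k
  simp [Pi.single_apply]

end Multihomogeneous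

section Value

variable {ι : Type} {d : ι → ℕ}

lemma value_rename {τ : Type*} (emb : τ → Σ i : ι, Fin (d i + 1)) (p : MvPolynomial τ ℂ)
    (a : MP d) : value (rename emb p : CoordRing d) a = eval (fun k => coords a (emb k)) p := by
  rw [value, eval_rename]; rfl

lemma value_X (s : Σ i : ι, Fin (d i + 1)) (a : MP d) : value (X s) a = coords a s := eval_X _

lemma value_mul (G G' : CoordRing d) (a : MP d) : value (G * G') a = value G a * value G' a :=
  map_mul _ _ _

lemma value_add (G G' : CoordRing d) (a : MP d) : value (G + G') a = value G a + value G' a :=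
  map_add _ _ _

lemma value_sub (G G' : CoordRing d) (a : MP d) : value (G - G') a = value G a - value G' a :=
  map_sub _ _ _

lemma value_neg (G : CoordRing d) (a : MP d) : value (-G) a = -value G a :=
  map_neg _ _

lemma value_C (r : ℂ) (a : MP d) : value (C r : CoordRing d) a = r := eval_C _

end Value

/-! ### Regular maps to a projective space -/

section Regular

variable {ι : Type} [DecidableEq ι] {d : ι → ℕ} {n : ℕ}

/-- A map to projective space is regular on `A`. -/
def RegularFactorOn (f : MP d → ℙ ℂ (Fin (n + 1) → ℂ)) (A : Set (MP d)) : Prop :=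
  ∀ a ∈ A, ∃ (m : ι → ℕ) (G : Fin (n + 1) → CoordRing d),
    (∀ k, IsMultihomogeneous (G k) m) ∧
    (fun k => value (G k) a) ≠ 0 ∧
    ∀ x ∈ A, ∀ hx : (fun k => value (G k) x) ≠ 0,
      f x = Projectivization.mk ℂ (fun k => value (G k) x) hx

lemma regularOn_of_factors {κ : Type} {e : κ → ℕ} {f : MP d → MP e} {A : Set (MP d)}
    (h : ∀ j, RegularFactorOn (fun x => f x j) A) : RegularOn f A :=
  fun a ha j => h j a ha

/-- A map given by either of two systems of polynomials that agree where both are nonzero. -/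
lemma regularFactorOn_ite {f : MP d → ℙ ℂ (Fin (n + 1) → ℂ)} {A : Set (MP d)}
    {G G' : Fin (n + 1) → CoordRing d} {m m' : ι → ℕ} (hG : ∀ k, IsMultihomogeneous (G k) m)
    (hG' : ∀ k, IsMultihomogeneous (G' k) m')
    (hA : ∀ x ∈ A, (fun k => value (G k) x) ≠ 0 ∨ (fun k => value (G' k) x) ≠ 0)
    (hf : ∀ x ∈ A, (fun k => value (G k) x) ≠ 0 → f x = toProj fun k => value (G k) x)
    (hf' : ∀ x ∈ A, (fun k => value (G' k) x) ≠ 0 → f x = toProj fun k => value (G' k) x) :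
    RegularFactorOn f A := by
  intro a ha
  rcases hA a ha with h | h
  · exact ⟨m, G, hG, h, fun x hx hne => by rw [hf x hx hne, toProj_of_ne_zero hne]⟩
  · exact ⟨m', G', hG', h, fun x hx hne => by rw [hf' x hx hne, toProj_of_ne_zero hne]⟩

lemma regularFactorOn_of_eq {f : MP d → ℙ ℂ (Fin (n + 1) → ℂ)} {A : Set (MP d)}
    {G : Fin (n + 1) → CoordRing d} {m : ι → ℕ} (hG : ∀ k, IsMultihomogeneous (G k) m)
    (hA : ∀ x ∈ A, (fun k => value (G k) x) ≠ 0)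
    (hf : ∀ x ∈ A, f x = toProj fun k => value (G k) x) :
    RegularFactorOn f A :=
  regularFactorOn_ite hG hG (fun x hx => Or.inl (hA x hx)) (fun x hx _ => hf x hx)
    fun x hx _ => hf x hx

lemma regularFactorOn_proj {d : ι → ℕ} (i : ι) (A : Set (MP d)) :
    RegularFactorOn (fun x : MP d => x i) A := by
  have hv : ∀ x : MP d, (fun k => value (X ⟨i, k⟩ : CoordRing d) x) = (x i).rep := by
    intro x
    funext k
    rw [value_X, coords]
  refine regularFactorOn_of_eq (G := fun k => X ⟨i, k⟩) (m := Pi.single i 1)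
    (fun k => isMultihomogeneous_X _) (fun x _ => ?_) fun x _ => ?_
  · rw [hv]
    exact (x i).rep_nonzero
  · rw [hv, toProj_rep]

lemma regularFactorOn_const (p : ℙ ℂ (Fin (n + 1) → ℂ)) (A : Set (MP d)) :
    RegularFactorOn (fun _ : MP d => p) A := by
  have hv : ∀ x : MP d, (fun k => value (C (p.rep k) : CoordRing d) x) = p.rep := by
    intro x
    funext k
    rw [value_C]
  refine regularFactorOn_of_eq (G := fun k => C (p.rep k)) (m := 0)
    (fun k => isMultihomogeneous_C _) (fun x _ => ?_) fun x _ => ?_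
  · rw [hv]
    exact p.rep_nonzero
  · rw [hv, toProj_rep]

end Regular

/-! ### The threefolds `X` and `Y` -/

section Threefolds

variable {F₀ F₁ : MvPolynomial (Fin 6) ℂ}

/-- The first component of a point of `ℙ^5 × ℙ^4`. -/
def xPt (a : MP ![5, 4]) : ℙ ℂ (Fin 6 → ℂ) := a 0

/-- The second component of a point of `ℙ^5 × ℙ^4`. -/
def yPt (a : MP ![5, 4]) : ℙ ℂ (Fin 5 → ℂ) := a 1

/-- The first component of a point of `ℙ^4 × ℙ^1`. -/
def zPt (b : MP ![4, 1]) : ℙ ℂ (Fin 5 → ℂ) := b 0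

/-- The second component of a point of `ℙ^4 × ℙ^1`. -/
def uPt (b : MP ![4, 1]) : ℙ ℂ (Fin 2 → ℂ) := b 1

/-- The point of `ℙ^5 × ℙ^4` with the given components. -/
def pairX (x : ℙ ℂ (Fin 6 → ℂ)) (y : ℙ ℂ (Fin 5 → ℂ)) : MP ![5, 4]
  | ⟨0, _⟩ => x
  | ⟨1, _⟩ => y

/-- The point of `ℙ^4 × ℙ^1` with the given components. -/
def pairY (y : ℙ ℂ (Fin 5 → ℂ)) (u : ℙ ℂ (Fin 2 → ℂ)) : MP ![4, 1]
  | ⟨0, _⟩ => y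
  | ⟨1, _⟩ => u

lemma xPt_pairX (x : ℙ ℂ (Fin 6 → ℂ)) (y : ℙ ℂ (Fin 5 → ℂ)) : xPt (pairX x y) = x := rfl

lemma yPt_pairX (x : ℙ ℂ (Fin 6 → ℂ)) (y : ℙ ℂ (Fin 5 → ℂ)) : yPt (pairX x y) = y := rfl

lemma zPt_pairY (y : ℙ ℂ (Fin 5 → ℂ)) (u : ℙ ℂ (Fin 2 → ℂ)) : zPt (pairY y u) = y := rfl

lemma uPt_pairY (y : ℙ ℂ (Fin 5 → ℂ)) (u : ℙ ℂ (Fin 2 → ℂ)) : uPt (pairY y u) = u := rfl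

lemma pairX_eta (a : MP ![5, 4]) : pairX (xPt a) (yPt a) = a := by
  funext i; fin_cases i <;> rfl

lemma pairY_eta (b : MP ![4, 1]) : pairY (zPt b) (uPt b) = b := by
  funext i; fin_cases i <;> rfl

lemma quadricPart_add (F G : MvPolynomial (Fin 6) ℂ) :
    quadricPart (F + G) = quadricPart F + quadricPart G := by simp [quadricPart]

lemma cubicPart_add (F G : MvPolynomial (Fin 6) ℂ) :
    cubicPart (F + G) = cubicPart F + cubicPart G := by simp [cubicPart]

lemma quadricPart_smul (r : ℂ) (F : MvPolynomial (Fin 6) ℂ) :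
    quadricPart (r • F) = r • quadricPart F := by simp [quadricPart]

lemma cubicPart_smul (r : ℂ) (F : MvPolynomial (Fin 6) ℂ) :
    cubicPart (r • F) = r • cubicPart F := by simp [cubicPart]

/-- The scalar l in `divisorOf` is determined by the point, as y ≠ 0. Hence one l serves both
generators, and by linearity all members of the pencil. -/
lemma mem_baseLocus_iff {a : MP ![5, 4]} : a ∈ baseLocus F₀ F₁ ↔
    ∃ l : ℂ, (∀ i : Fin 5, (xPt a).rep i.succ = l * (yPt a).rep i) ∧
      ∀ k, (xPt a).rep 0 * eval (yPt a).rep (pencilQuadrics F₀ F₁ k) +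
        l * eval (yPt a).rep (pencilCubics F₀ F₁ k) = 0 := by
  constructor
  · intro h
    obtain ⟨l, hl, h0⟩ := h F₀ (Submodule.subset_span (by simp))
    obtain ⟨l', hl', h1⟩ := h F₁ (Submodule.subset_span (by simp))
    obtain ⟨j, hj⟩ := Function.ne_iff.1 (yPt a).rep_nonzero
    have hll : l' = l := mul_right_cancel₀ hj ((hl' j).symm.trans (hl j))
    rw [hll] at h1
    refine ⟨l, hl, fun k => ?_⟩
    fin_cases k
    exacts [h0, h1]
  · rintro ⟨l, hl, h⟩ F hF
    obtain ⟨r, s, rfl⟩ := Submodule.mem_span_pair.1 hF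
    refine ⟨l, hl, ?_⟩
    change (xPt a).rep 0 * eval (yPt a).rep _ + l * eval (yPt a).rep _ = 0
    have h0 := h 0
    have h1 := h 1
    simp only [pencilQuadrics, pencilCubics, Matrix.cons_val_zero, Matrix.cons_val_one] at h0 h1
    simp only [quadricPart_add, quadricPart_smul, cubicPart_add, cubicPart_smul, map_add, smul_eval]
    linear_combination r * h0 + s * h1

lemma mem_dualThreefold_iff {b : MP ![4, 1]} : b ∈ dualThreefold F₀ F₁ ↔
    (uPt b).rep 0 * eval (zPt b).rep (pencilQuadrics F₀ F₁ 0) +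
        (uPt b).rep 1 * eval (zPt b).rep (pencilQuadrics F₀ F₁ 1) = 0 ∧
      (uPt b).rep 0 * eval (zPt b).rep (pencilCubics F₀ F₁ 0) +
        (uPt b).rep 1 * eval (zPt b).rep (pencilCubics F₀ F₁ 1) = 0 := Iff.rfl

/-- The vector `(α, β y)`. -/
def liftVec (α β : ℂ) (y : Fin 5 → ℂ) : Fin 6 → ℂ := Fin.cons α fun i => β * y i

lemma liftVec_ne_zero {α β : ℂ} {y : Fin 5 → ℂ} (hy : y ≠ 0) (h : α ≠ 0 ∨ β ≠ 0) :
    liftVec α β y ≠ 0 := by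
  intro h0
  rcases h with h | h
  · exact h (congrFun h0 0)
  · obtain ⟨j, hj⟩ := Function.ne_iff.1 hy
    exact mul_ne_zero h hj (congrFun h0 j.succ)

lemma pairX_mem_baseLocus {α β : ℂ} {y : ℙ ℂ (Fin 5 → ℂ)} (h : α ≠ 0 ∨ β ≠ 0)
    (hk : ∀ k, α * eval y.rep (pencilQuadrics F₀ F₁ k) +
      β * eval y.rep (pencilCubics F₀ F₁ k) = 0) :
    pairX (toProj (liftVec α β y.rep)) y ∈ baseLocus F₀ F₁ := by
  obtain ⟨r, hr, hrep⟩ := exists_rep_toProj (liftVec_ne_zero y.rep_nonzero h)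
  rw [mem_baseLocus_iff]
  refine ⟨r * β, fun i => ?_, fun k => ?_⟩
  · rw [xPt_pairX, yPt_pairX, hrep]
    simp [liftVec, mul_assoc]
  · rw [xPt_pairX, yPt_pairX, hrep]
    simp only [Pi.smul_apply, smul_eq_mul, liftVec, Fin.cons_zero]
    linear_combination r * hk k

lemma exists_lift_of_mem_baseLocus {a : MP ![5, 4]} (ha : a ∈ baseLocus F₀ F₁) :
    ∃ α β : ℂ, (α ≠ 0 ∨ β ≠ 0) ∧ (xPt a).rep = liftVec α β (yPt a).rep ∧
      ∀ k, α * eval (yPt a).rep (pencilQuadrics F₀ F₁ k) +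
        β * eval (yPt a).rep (pencilCubics F₀ F₁ k) = 0 := by
  obtain ⟨l, hl, h⟩ := mem_baseLocus_iff.1 ha
  have hrep : (xPt a).rep = liftVec ((xPt a).rep 0) l (yPt a).rep := by
    funext i
    refine Fin.cases rfl (fun j => hl j) i
  refine ⟨_, l, ?_, hrep, h⟩
  by_contra! hcon
  apply (xPt a).rep_nonzero
  rw [hrep, hcon.1, hcon.2]
  funext i
  refine Fin.cases rfl (fun j => zero_mul _) i

lemma pairY_mem_dualThreefold {u : Fin 2 → ℂ} {y : ℙ ℂ (Fin 5 → ℂ)} (hu : u ≠ 0)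
    (hq : u 0 * eval y.rep (pencilQuadrics F₀ F₁ 0) +
        u 1 * eval y.rep (pencilQuadrics F₀ F₁ 1) = 0)
    (hc : u 0 * eval y.rep (pencilCubics F₀ F₁ 0) +
        u 1 * eval y.rep (pencilCubics F₀ F₁ 1) = 0) :
    pairY y (toProj u) ∈ dualThreefold F₀ F₁ := by
  obtain ⟨r, hr, hrep⟩ := exists_rep_toProj hu
  rw [mem_dualThreefold_iff]
  rw [zPt_pairY, uPt_pairY, hrep]
  simp only [Pi.smul_apply, smul_eq_mul]
  exact ⟨by linear_combination r * hq, by linear_combination r * hc⟩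

/-- The row `(q 1, - q 0)` of the kernel of the matrix of the pencil. -/
def kernelRow (q : Fin 2 → MvPolynomial (Fin 5) ℂ) (y : Fin 5 → ℂ) : Fin 2 → ℂ :=
  ![eval y (q 1), -eval y (q 0)]

lemma kernelRow_ne_zero {q : Fin 2 → MvPolynomial (Fin 5) ℂ} {y : Fin 5 → ℂ}
    (h : ∃ k, eval y (q k) ≠ 0) : kernelRow q y ≠ 0 := by
  intro h0
  obtain ⟨k, hk⟩ := h
  fin_cases k
  · exact hk (neg_eq_zero.1 (congrFun h0 1))
  · exact hk (congrFun h0 0)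

lemma eval_quintic (y : Fin 5 → ℂ) : eval y (quintic F₀ F₁) =
    eval y (pencilQuadrics F₀ F₁ 0) * eval y (pencilCubics F₀ F₁ 1) -
      eval y (pencilQuadrics F₀ F₁ 1) * eval y (pencilCubics F₀ F₁ 0) := by
  rw [← detQuintic_pencil, detQuintic, map_sub, map_mul, map_mul]

/-- A point of the fibre over y is a nonzero (α, β) annihilating both columns of the matrix of the
pencil, which exists exactly where the determinant vanishes. -/
theorem image_rhoMap_baseLocus : rhoMap '' baseLocus F₀ F₁ =
    hypersurface (n := 4) (quintic F₀ F₁) := by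
  ext p
  constructor
  · rintro ⟨a, ha, rfl⟩
    obtain ⟨α, β, hne, -, h⟩ := exists_lift_of_mem_baseLocus ha
    change eval (yPt a).rep (quintic F₀ F₁) = 0
    rw [eval_quintic]
    have h0 := h 0
    have h1 := h 1
    rcases hne with hne | hne
    · refine (mul_eq_zero.1 (?_ : α * _ = 0)).resolve_left hne
      linear_combination eval (yPt a).rep (pencilCubics F₀ F₁ 1) * h0 -
        eval (yPt a).rep (pencilCubics F₀ F₁ 0) * h1
    · refine (mul_eq_zero.1 (?_ : β * _ = 0)).resolve_left hne
      linear_combination eval (yPt a).rep (pencilQuadrics F₀ F₁ 0) * h1 -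
        eval (yPt a).rep (pencilQuadrics F₀ F₁ 1) * h0
  · intro hp
    have hp0 : eval (p 0).rep (quintic F₀ F₁) = 0 := hp
    rw [eval_quintic] at hp0
    have key : ∃ α β : ℂ, (α ≠ 0 ∨ β ≠ 0) ∧
        ∀ k, α * eval (p 0).rep (pencilQuadrics F₀ F₁ k) +
          β * eval (p 0).rep (pencilCubics F₀ F₁ k) = 0 := by
      by_cases h : ∃ k, eval (p 0).rep (pencilCubics F₀ F₁ k) ≠ 0 ∨
          eval (p 0).rep (pencilQuadrics F₀ F₁ k) ≠ 0
      · obtain ⟨k, hk⟩ := h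
        -- The vector (c_k, -q_k) orthogonal to a nonzero column k.
        refine ⟨_, -eval (p 0).rep (pencilQuadrics F₀ F₁ k), hk.imp_right neg_ne_zero.2,
          fun j => ?_⟩
        fin_cases k <;> fin_cases j <;> simp only [Fin.zero_eta, Fin.mk_one, Fin.isValue]
        · ring
        · linear_combination -hp0
        · linear_combination hp0
        · ring
      · push Not at h
        exact ⟨1, 0, Or.inl one_ne_zero, fun k => by rw [(h k).2]; ring⟩
    obtain ⟨α, β, hne, h⟩ := key
    refine ⟨_, pairX_mem_baseLocus hne h, ?_⟩
    funext i
    rw [Subsingleton.elim i 0]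
    rfl

/-- The transposed argument: the fibre consists of the vectors annihilating both rows. -/
theorem image_projMap_dualThreefold : projMap '' dualThreefold F₀ F₁ =
    hypersurface (n := 4) (quintic F₀ F₁) := by
  ext p
  constructor
  · rintro ⟨b, hb, rfl⟩
    obtain ⟨h0, h1⟩ := mem_dualThreefold_iff.1 hb
    change eval (zPt b).rep (quintic F₀ F₁) = 0
    rw [eval_quintic]
    obtain ⟨k, hk⟩ := Function.ne_iff.1 (uPt b).rep_nonzero
    refine (mul_eq_zero.1 (?_ : (uPt b).rep k * _ = 0)).resolve_left hk
    fin_cases k <;> simp only [Fin.zero_eta, Fin.mk_one, Fin.isValue]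
    · linear_combination eval (zPt b).rep (pencilCubics F₀ F₁ 1) * h0 -
        eval (zPt b).rep (pencilQuadrics F₀ F₁ 1) * h1
    · linear_combination eval (zPt b).rep (pencilQuadrics F₀ F₁ 0) * h1 -
        eval (zPt b).rep (pencilCubics F₀ F₁ 0) * h0
  · intro hp
    have hp0 : eval (p 0).rep (quintic F₀ F₁) = 0 := hp
    rw [eval_quintic] at hp0
    have key : ∃ u : Fin 2 → ℂ, u ≠ 0 ∧ u 0 * eval (p 0).rep (pencilQuadrics F₀ F₁ 0) +
        u 1 * eval (p 0).rep (pencilQuadrics F₀ F₁ 1) = 0 ∧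
        u 0 * eval (p 0).rep (pencilCubics F₀ F₁ 0) +
          u 1 * eval (p 0).rep (pencilCubics F₀ F₁ 1) = 0 := by
      by_cases h : ∃ k, eval (p 0).rep (pencilQuadrics F₀ F₁ k) ≠ 0
      · refine ⟨_, kernelRow_ne_zero h, ?_, ?_⟩ <;> simp [kernelRow]
        · ring
        · linear_combination -hp0
      by_cases h' : ∃ k, eval (p 0).rep (pencilCubics F₀ F₁ k) ≠ 0
      · refine ⟨_, kernelRow_ne_zero h', ?_, ?_⟩ <;> simp [kernelRow]
        · linear_combination hp0
        · ring
      · push Not at h h'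
        exact ⟨![1, 0], fun h0 => one_ne_zero (congrFun h0 0), by simp [h], by simp [h']⟩
    obtain ⟨u, hu, h0, h1⟩ := key
    refine ⟨_, pairY_mem_dualThreefold hu h0 h1, ?_⟩
    funext i
    rw [Subsingleton.elim i 0]
    rfl

end Threefolds

/-! ### The quintic of a smooth base locus -/

/-- The chain rule, used to differentiate the equations of X along the parametrization `coneParam`.
-/
lemma pderiv_bind₁ {σ τ : Type*} [Fintype σ] (Θ : σ → MvPolynomial τ ℂ) (g : MvPolynomial σ ℂ)
    (i : τ) : pderiv i (bind₁ Θ g) = ∑ s, bind₁ Θ (pderiv s g) * pderiv i (Θ s) := by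
  classical
  induction g using MvPolynomial.induction_on with
  | C a => simp
  | add p q hp hq => simp only [map_add, hp, hq, add_mul, Finset.sum_add_distrib]
  | mul_X p s hp =>
    simp only [map_mul, bind₁_X_right, Derivation.leibniz, smul_eq_mul, hp, map_add, add_mul,
      Finset.sum_add_distrib, pderiv_X, Finset.mul_sum]
    congr 1
    · rw [Finset.sum_eq_single s]
      · simp
      · intro t _ hts
        simp [hts.symm]
      · simp
    · exact Finset.sum_congr rfl fun t _ => by ring

lemma eval_bind₁ {σ τ : Type*} (Θ : σ → MvPolynomial τ ℂ) (g : MvPolynomial σ ℂ) (z : τ → ℂ) :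
    eval z (bind₁ Θ g) = eval (fun s => eval z (Θ s)) g := by
  rw [← coe_aeval_eq_eval, ← coe_aeval_eq_eval, RingHom.coe_coe, aeval_bind₁]
  rfl

section

variable {ι : Type} [DecidableEq ι] {d : ι → ℕ}

/-- The vanishing of a multihomogeneous polynomial can be tested at any coordinates. -/
lemma value_eq_zero_iff [Fintype ι] {G : CoordRing d} {m : ι → ℕ} (hG : IsMultihomogeneous G m)
    {a : MP d} {z : (Σ i : ι, Fin (d i + 1)) → ℂ} {r : ι → ℂ} (hr : ∀ i, r i ≠ 0)
    (h : ∀ i k, (a i).rep k = r i * z ⟨i, k⟩) : value G a = 0 ↔ eval z G = 0 := by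
  have hz : coords a = fun s => r s.1 * z s := funext fun s => h s.1 s.2
  rw [value, hz, eval_blockScale (π := Sigma.fst) hG r z, mul_eq_zero, or_iff_right]
  exact Finset.prod_ne_zero_iff.2 fun i _ => pow_ne_zero _ (hr i)

end

/-- The parametrization `(l, y) ↦ ((l A(y), l B(y) y), y)`. -/
def coneParam (A B : MvPolynomial (Fin 5) ℂ) :
    (Σ i : Fin 2, Fin (![5, 4] i + 1)) → MvPolynomial (Fin 6) ℂ
  | ⟨⟨0, _⟩, i⟩ => X 0 * (Fin.cons (rename Fin.succ A) fun i : Fin 5 =>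
      rename Fin.succ B * X i.succ : Fin 6 → MvPolynomial (Fin 6) ℂ) i
  | ⟨⟨1, _⟩, i⟩ => X (Fin.succ (i : Fin 5))

lemma eval_coneParam_zero (A B : MvPolynomial (Fin 5) ℂ) (l : ℂ) (y : Fin 5 → ℂ) (i : Fin 6) :
    eval (Fin.cons l y) (coneParam A B ⟨0, i⟩) =
      l * liftVec (eval y A) (eval y B) y i := by
  have h : ∀ p : MvPolynomial (Fin 5) ℂ,
      eval (Fin.cons l y : Fin 6 → ℂ) (rename Fin.succ p) = eval y p := fun p => by
    rw [eval_rename]; rfl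
  change eval _ (X 0 * _) = _
  rw [map_mul, eval_X, Fin.cons_zero]
  congr 1
  refine Fin.cases ?_ (fun j => ?_) i
  · simp only [Fin.cons_zero, liftVec, h]
  · simp only [Fin.cons_succ, liftVec, h, map_mul, eval_X]

lemma eval_coneParam_one (A B : MvPolynomial (Fin 5) ℂ) (l : ℂ) (y : Fin 5 → ℂ) (i : Fin 5) :
    eval (Fin.cons l y) (coneParam A B ⟨1, i⟩) = y i := by
  change eval _ (X i.succ) = _
  rw [eval_X, Fin.cons_succ]

/-- The y-coordinates supply five independent directions, and the l-derivative is the nonzero vector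
(A, By) in the x-coordinates. After dividing by the two scalings, the parametrized set is a fourfold
in ℙ⁵ × ℙ⁴. -/
lemma rank_jacobian_coneParam (A B : MvPolynomial (Fin 5) ℂ) {l : ℂ} {y : Fin 5 → ℂ} (hy : y ≠ 0)
    (h : eval y A ≠ 0 ∨ eval y B ≠ 0) :
    (Matrix.of fun s i => eval (Fin.cons l y) (pderiv i (coneParam A B s))).rank = 6 := by
  have hd : ∀ p : MvPolynomial (Fin 5) ℂ,
      pderiv 0 (rename Fin.succ p : MvPolynomial (Fin 6) ℂ) = 0 := fun p =>
    pderiv_eq_zero_of_notMem_vars fun hmem => by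
      obtain ⟨j, -, hj⟩ := Finset.mem_image.1 (vars_rename _ _ hmem)
      exact Fin.succ_ne_zero j hj
  have hcone : ∀ j : Fin 6, eval (Fin.cons l y : Fin 6 → ℂ) (pderiv 0 (coneParam A B ⟨0, j⟩)) =
      liftVec (eval y A) (eval y B) y j := fun j => by
    have h1 := eval_coneParam_zero A B 1 y j
    rw [one_mul] at h1
    rw [← h1]
    change eval _ (pderiv 0 (X 0 * _)) = eval _ (X 0 * _)
    refine Fin.cases ?_ (fun i => ?_) j
    · simp [eval_rename, Derivation.leibniz, hd, Function.comp_def]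
    · simp [eval_rename, Derivation.leibniz, hd, Function.comp_def, pderiv_X]
  rw [← Matrix.rank_transpose, LinearIndependent.rank_matrix, Fintype.card_fin]
  rw [Fintype.linearIndependent_iff]
  intro v hv
  have hs : ∀ k : Fin 5, v k.succ = 0 := by
    intro k
    have := congrFun hv ⟨1, k⟩
    rw [Finset.sum_apply, Finset.sum_eq_single k.succ] at this
    · simpa [coneParam, pderiv_X] using this
    · intro j _ hj
      simp [coneParam, pderiv_X, hj.symm]
    · simp
  have h0 : v 0 = 0 := by
    obtain ⟨j, hj⟩ := Function.ne_iff.1 (liftVec_ne_zero hy h)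
    have := congrFun hv ⟨0, j⟩
    rw [Finset.sum_apply, Finset.sum_eq_single 0] at this
    · refine (mul_eq_zero.1 (Eq.trans ?_ this)).resolve_right hj
      rw [← hcone j]
      rfl
    · intro i _ hi
      obtain ⟨i, rfl⟩ := Fin.exists_succ_eq.2 hi
      simp [hs]
    · simp
  exact fun i => Fin.cases h0 hs i

/-- A base locus that is smooth of dimension three contains no section over an open set. -/
lemma not_isSmoothOfDim_of_kernel {F₀ F₁ : MvPolynomial (Fin 6) ℂ}
    (h₀ : F₀ ∈ doublePointCubics) (h₁ : F₁ ∈ doublePointCubics) {A B : MvPolynomial (Fin 5) ℂ}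
    (hA : A.IsHomogeneous 3) (hB : B.IsHomogeneous 2) (hAB : A ≠ 0 ∨ B ≠ 0)
    (h : ∀ k, A * pencilQuadrics F₀ F₁ k + B * pencilCubics F₀ F₁ k = 0) :
    ¬ IsSmoothOfDim (baseLocus F₀ F₁) 3 := by
  intro hX
  have hk : ∀ (y : Fin 5 → ℂ) k, eval y A * eval y (pencilQuadrics F₀ F₁ k) +
      eval y B * eval y (pencilCubics F₀ F₁ k) = 0 := fun y k => by
    rw [← map_mul, ← map_mul, ← map_add, h k, map_zero]
  -- a polynomial, nonvanishing where the section is defined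
  obtain ⟨E, hE, hEAB⟩ : ∃ E : MvPolynomial (Fin 5) ℂ, E ≠ 0 ∧
      ∀ y, eval y E ≠ 0 → y ≠ 0 ∧ (eval y A ≠ 0 ∨ eval y B ≠ 0) := by
    have hX0 : (X 0 : MvPolynomial (Fin 5) ℂ) ≠ 0 := X_ne_zero 0
    have hy0 : ∀ y : Fin 5 → ℂ, y 0 ≠ 0 → y ≠ 0 := fun y hy hy' => hy (congrFun hy' 0)
    rcases hAB with hne | hne
    · refine ⟨A * X 0, mul_ne_zero hne hX0, fun y hy => ?_⟩
      rw [map_mul, eval_X] at hy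
      exact ⟨hy0 y (right_ne_zero_of_mul hy), Or.inl (left_ne_zero_of_mul hy)⟩
    · refine ⟨B * X 0, mul_ne_zero hne hX0, fun y hy => ?_⟩
      rw [map_mul, eval_X] at hy
      exact ⟨hy0 y (right_ne_zero_of_mul hy), Or.inr (left_ne_zero_of_mul hy)⟩
  have hpt : ∀ y : Fin 5 → ℂ, eval y E ≠ 0 →
      pairX (toProj (liftVec (eval y A) (eval y B) y)) (toProj y) ∈ baseLocus F₀ F₁ := by
    intro y hy
    obtain ⟨hy0, hne⟩ := hEAB y hy
    obtain ⟨r, hr, hrep⟩ := exists_rep_toProj (liftVec_ne_zero hy0 hne)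
    obtain ⟨t, ht, htrep⟩ := exists_rep_toProj hy0
    rw [mem_baseLocus_iff, xPt_pairX, yPt_pairX, hrep, htrep]
    refine ⟨r * eval y B / t, fun i => ?_, fun k => ?_⟩
    · simp only [liftVec, Pi.smul_apply, Fin.cons_succ, smul_eq_mul]
      field_simp
    · rw [eval_smul_of_isHomogeneous (isHomogeneous_pencilQuadrics h₀ h₁ k),
        eval_smul_of_isHomogeneous (isHomogeneous_pencilCubics h₀ h₁ k)]
      simp only [liftVec, Pi.smul_apply, Fin.cons_zero, smul_eq_mul]
      field_simp
      linear_combination r * t ^ 2 * hk y k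
  obtain ⟨y₀, hy₀⟩ : ∃ y, eval y E ≠ 0 := by
    by_contra! hcon
    exact hE (funext fun y => by rw [hcon y, map_zero])
  obtain ⟨r, H, g, hr, ⟨mH, hH⟩, hHa, ⟨hg, hcut⟩, hli⟩ := hX _ (hpt y₀ hy₀)
  set a := pairX (toProj (liftVec (eval y₀ A) (eval y₀ B) y₀)) (toProj y₀) with ha
  obtain ⟨hy0, hne⟩ := hEAB y₀ hy₀
  obtain ⟨u, hu, hurep⟩ := exists_rep_toProj (liftVec_ne_zero hy0 hne)
  obtain ⟨t, ht, htrep⟩ := exists_rep_toProj hy0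
  -- A has degree 3 and B y has degree 3 in y, so the factor t³ cancels and the parametrization hits
  -- the chosen coordinates of the point exactly.
  have hcoords : ∀ s, eval (Fin.cons (u / t ^ 3) (t • y₀)) (coneParam A B s) = coords a s := by
    rintro ⟨i, k⟩
    fin_cases i
    · refine (eval_coneParam_zero A B _ _ k).trans (Eq.trans ?_ (congrFun hurep k).symm)
      rw [eval_smul_of_isHomogeneous hA, eval_smul_of_isHomogeneous hB]
      change Fin 6 at k
      refine Fin.cases ?_ (fun j => ?_) k
      · simp only [liftVec, Pi.smul_apply, Fin.cons_zero, smul_eq_mul]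
        field_simp
      · simp only [liftVec, Pi.smul_apply, Fin.cons_succ, smul_eq_mul]
        field_simp
    · exact (eval_coneParam_one A B _ _ k).trans (congrFun htrep k).symm
  have hHΘ : bind₁ (coneParam A B) H ≠ 0 := by
    intro h0
    apply hHa
    rw [value, ← _root_.funext hcoords, ← eval_bind₁, h0, map_zero]
  -- The local equations of X vanish on the parametrized points wherever a certain nonzero
  -- polynomial does not vanish, so their pullbacks vanish identically.
  have hgΘ : ∀ k, bind₁ (coneParam A B) (g k) = 0 := by
    intro k
    have hD : X 0 * rename Fin.succ E * bind₁ (coneParam A B) H ≠ 0 :=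
      mul_ne_zero (mul_ne_zero (X_ne_zero _)
        (fun h0 => hE (rename_injective _ (Fin.succ_injective 5) (h0.trans (map_zero _).symm)))) hHΘ
    suffices h0 : X 0 * rename Fin.succ E * bind₁ (coneParam A B) H *
        bind₁ (coneParam A B) (g k) = 0 from (mul_eq_zero.1 h0).resolve_left hD
    refine MvPolynomial.funext fun z => ?_
    obtain ⟨l, y, rfl⟩ : ∃ (l : ℂ) (y : Fin 5 → ℂ), z = Fin.cons l y :=
      ⟨z 0, Fin.tail z, (Fin.cons_self_tail z).symm⟩
    rw [map_mul, map_mul, map_mul, map_zero, eval_X, Fin.cons_zero, eval_rename]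
    change l * eval y E * _ * _ = 0
    by_cases hl : l = 0
    · rw [hl]; ring
    by_cases hy : eval y E = 0
    · rw [hy]; ring
    obtain ⟨hy0, hne⟩ := hEAB y hy
    obtain ⟨u, hu, hurep⟩ := exists_rep_toProj (liftVec_ne_zero hy0 hne)
    obtain ⟨t, ht, htrep⟩ := exists_rep_toProj hy0
    have hr : ∀ i : Fin 2, (![u / l, t] : Fin 2 → ℂ) i ≠ 0 := by
      simp [Fin.forall_fin_two, hu, hl, ht]
    have hrep : ∀ (i : Fin 2) (k : Fin (![5, 4] i + 1)),
        (pairX (toProj (liftVec (eval y A) (eval y B) y)) (toProj y) i).rep k =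
          (![u / l, t] : Fin 2 → ℂ) i * eval (Fin.cons l y) (coneParam A B ⟨i, k⟩) := by
      intro i k
      fin_cases i
      · refine (congrFun hurep k).trans (Eq.trans ?_
          (congrArg (u / l * ·) (eval_coneParam_zero A B l y k)).symm)
        change u * _ = u / l * (l * _)
        field_simp
      · exact (congrFun htrep k).trans (congrArg (t * ·) (eval_coneParam_one A B l y k)).symm
    rw [eval_bind₁, eval_bind₁]
    by_cases hH0 : eval (fun s => eval (Fin.cons l y) (coneParam A B s)) H = 0
    · rw [hH0]; ring
    rw [← value_eq_zero_iff hH hr hrep] at hH0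
    obtain ⟨m, hm⟩ := hg k
    rw [(value_eq_zero_iff hm hr hrep).1 ((hcut _ hH0).1 (hpt y hy) k), mul_zero]
  have hMN : (Matrix.of fun k s => grad (g k) a s) * (Matrix.of fun s i =>
      eval (Fin.cons (u / t ^ 3) (t • y₀)) (pderiv i (coneParam A B s))) = 0 := by
    ext k i
    have := congrArg (eval (Fin.cons (u / t ^ 3) (t • y₀))) (pderiv_bind₁ (coneParam A B) (g k) i)
    rw [hgΘ k, map_zero, map_zero, map_sum] at this
    rw [Matrix.mul_apply, Matrix.zero_apply, this]
    refine Finset.sum_congr rfl fun s _ => ?_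
    rw [map_mul, eval_bind₁, _root_.funext hcoords]
    rfl
  -- Smoothness of dimension 3 in ℙ⁵ × ℙ⁴ means six independent gradients; they annihilate six
  -- independent tangent vectors in a space with only 6 + 5 = 11 coordinates.
  have hle := Matrix.rank_add_rank_le_card_of_mul_eq_zero hMN
  have hne' : eval (t • y₀) A ≠ 0 ∨ eval (t • y₀) B ≠ 0 := by
    rw [eval_smul_of_isHomogeneous hA, eval_smul_of_isHomogeneous hB]
    exact hne.imp (mul_ne_zero (pow_ne_zero _ ht)) (mul_ne_zero (pow_ne_zero _ ht))
  rw [rank_jacobian_coneParam A B (smul_ne_zero ht hy0) hne',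
    LinearIndependent.rank_matrix (M := Matrix.of fun k s => grad (g k) a s) hli,
    Fintype.card_fin, Fintype.card_sigma, Fin.sum_univ_two] at hle
  rw [Fin.sum_univ_two] at hr
  rw [Fintype.card_fin, Fintype.card_fin] at hle
  simp only [Matrix.cons_val_zero, Matrix.cons_val_one] at hle hr
  omega

/-- If the determinant vanishes identically, a nonzero column gives the polynomial kernel vector
(c_k, -q_k). If the matrix is zero, any polynomials of the right degrees serve. Either way
`not_isSmoothOfDim_of_kernel` applies. -/
theorem quintic_ne_zero_of_isSmoothOfDim {F₀ F₁ : MvPolynomial (Fin 6) ℂ}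
    (h₀ : F₀ ∈ doublePointCubics) (h₁ : F₁ ∈ doublePointCubics)
    (hX : IsSmoothOfDim (baseLocus F₀ F₁) 3) : quintic F₀ F₁ ≠ 0 := by
  intro h0
  have hdet : pencilQuadrics F₀ F₁ 0 * pencilCubics F₀ F₁ 1 -
      pencilQuadrics F₀ F₁ 1 * pencilCubics F₀ F₁ 0 = 0 := h0
  by_cases h : ∃ k, pencilCubics F₀ F₁ k ≠ 0 ∨ pencilQuadrics F₀ F₁ k ≠ 0
  · obtain ⟨k, hk⟩ := h
    refine not_isSmoothOfDim_of_kernel h₀ h₁ (isHomogeneous_pencilCubics h₀ h₁ k)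
      (isHomogeneous_pencilQuadrics h₀ h₁ k).neg (hk.imp_right neg_ne_zero.2) (fun j => ?_) hX
    fin_cases k <;> fin_cases j <;> simp only [Fin.zero_eta, Fin.mk_one, Fin.isValue]
    · ring
    · linear_combination -hdet
    · linear_combination hdet
    · ring
  · push Not at h
    refine not_isSmoothOfDim_of_kernel h₀ h₁ (A := 0) (B := X 0 ^ 2) (isHomogeneous_zero _ _ _)
      (isHomogeneous_X_pow 0 2) (Or.inr (pow_ne_zero _ (X_ne_zero 0))) (fun k => ?_) hX
    rw [(h k).1]
    ring

/-! ### Gradients of multihomogeneous polynomials -/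

section Grad

variable {ι : Type} {d : ι → ℕ}

lemma grad_add (G G' : CoordRing d) (a : MP d) : grad (G + G') a = grad G a + grad G' a := by
  funext s
  simp [grad]

lemma grad_sub (G G' : CoordRing d) (a : MP d) : grad (G - G') a = grad G a - grad G' a := by
  funext s
  simp [grad]

lemma grad_neg (G : CoordRing d) (a : MP d) : grad (-G) a = -grad G a := by
  funext s
  simp [grad]

lemma grad_mul (G G' : CoordRing d) (a : MP d) :
    grad (G * G') a = value G a • grad G' a + value G' a • grad G a := by
  funext s
  simp [grad, value, Derivation.leibniz]

lemma grad_X_self (s : Σ i : ι, Fin (d i + 1)) (a : MP d) : grad (X s) a s = 1 := by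
  simp [grad]

lemma grad_X_of_ne {s t : Σ i : ι, Fin (d i + 1)} (h : s ≠ t) (a : MP d) :
    grad (X s) a t = 0 := by
  rw [grad, pderiv_X_of_ne h, map_zero]

lemma grad_rename_apply {τ : Type*} {emb : τ → Σ i : ι, Fin (d i + 1)}
    (hemb : Function.Injective emb) (p : MvPolynomial τ ℂ) (a : MP d) (k : τ) :
    grad (rename emb p) a (emb k) = eval (fun k => coords a (emb k)) (pderiv k p) := by
  rw [grad, pderiv_rename hemb, eval_rename]
  rfl

lemma grad_rename_of_notMem {τ : Type*} {emb : τ → Σ i : ι, Fin (d i + 1)}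
    (p : MvPolynomial τ ℂ) (a : MP d) {s : Σ i : ι, Fin (d i + 1)} (hs : s ∉ Set.range emb) :
    grad (rename emb p) a s = 0 := by
  classical
  rw [grad, pderiv_eq_zero_of_notMem_vars, map_zero]
  intro hmem
  obtain ⟨j, -, hj⟩ := Finset.mem_image.1 (vars_rename _ _ hmem)
  exact hs ⟨j, hj⟩

variable [DecidableEq ι] {κ κ' μ : Type}

lemma CutsOutOn.comp_equiv {H : CoordRing d} {g : κ → CoordRing d} {A : Set (MP d)}
    (h : CutsOutOn H g A) (e : κ' ≃ κ) : CutsOutOn H (g ∘ e) A :=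
  ⟨fun k => h.1 (e k), fun x hx => (h.2 x hx).trans e.forall_congr_right.symm⟩

lemma CutsOutOn.elim_comp_equiv {H : CoordRing d} {g : κ → CoordRing d} {G : μ → CoordRing d}
    {A : Set (MP d)} (h : CutsOutOn H (Sum.elim g G) A) (e : κ' ≃ κ) :
    CutsOutOn H (Sum.elim (g ∘ e) G) A := by
  have := h.comp_equiv (e.sumCongr (Equiv.refl μ))
  rwa [show ⇑(e.sumCongr (Equiv.refl μ)) = Sum.map e (Equiv.refl μ) from rfl, Sum.elim_comp_map, Equiv.coe_refl, Function.comp_id] at this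

end Grad

/-! ### Equations of the two threefolds -/

section Equations

variable {F₀ F₁ : MvPolynomial (Fin 6) ℂ}

/-- The coordinates of the first factor of `ℙ^5 × ℙ^4`. -/
def xVar (i : Fin 6) : Σ i : Fin 2, Fin (![5, 4] i + 1) := ⟨0, i⟩

/-- The coordinates of the second factor of `ℙ^5 × ℙ^4`. -/
def yVar (i : Fin 5) : Σ i : Fin 2, Fin (![5, 4] i + 1) := ⟨1, i⟩

/-- The coordinates of the first factor of `ℙ^4 × ℙ^1`. -/
def zVar (i : Fin 5) : Σ i : Fin 2, Fin (![4, 1] i + 1) := ⟨0, i⟩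

/-- The coordinates of the second factor of `ℙ^4 × ℙ^1`. -/
def uVar (i : Fin 2) : Σ i : Fin 2, Fin (![4, 1] i + 1) := ⟨1, i⟩

lemma xVar_injective : Function.Injective xVar := fun _ _ h => eq_of_heq (Sigma.mk.inj h).2

lemma yVar_injective : Function.Injective yVar := fun _ _ h => eq_of_heq (Sigma.mk.inj h).2

lemma zVar_injective : Function.Injective zVar := fun _ _ h => eq_of_heq (Sigma.mk.inj h).2

lemma uVar_injective : Function.Injective uVar := fun _ _ h => eq_of_heq (Sigma.mk.inj h).2

lemma xVar_ne_yVar (i : Fin 6) (j : Fin 5) : xVar i ≠ yVar j := fun h =>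
  absurd (congrArg Sigma.fst h) (by decide : (0 : Fin 2) ≠ 1)

lemma zVar_ne_uVar (i : Fin 5) (j : Fin 2) : zVar i ≠ uVar j := fun h =>
  absurd (congrArg Sigma.fst h) (by decide : (0 : Fin 2) ≠ 1)

lemma value_xVar (i : Fin 6) (a : MP ![5, 4]) : value (X (xVar i)) a = (xPt a).rep i := value_X _ _

lemma value_yVar (i : Fin 5) (a : MP ![5, 4]) : value (X (yVar i)) a = (yPt a).rep i := value_X _ _

lemma value_zVar (i : Fin 5) (b : MP ![4, 1]) : value (X (zVar i)) b = (zPt b).rep i := value_X _ _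

lemma value_uVar (i : Fin 2) (b : MP ![4, 1]) : value (X (uVar i)) b = (uPt b).rep i := value_X _ _

lemma value_rename_yVar (p : MvPolynomial (Fin 5) ℂ) (a : MP ![5, 4]) :
    value (rename yVar p) a = eval (yPt a).rep p := value_rename _ _ _

lemma value_rename_zVar (p : MvPolynomial (Fin 5) ℂ) (b : MP ![4, 1]) :
    value (rename zVar p) b = eval (zPt b).rep p := value_rename _ _ _

lemma grad_xVar (i j : Fin 6) (a : MP ![5, 4]) :
    grad (X (xVar i)) a (xVar j) = if i = j then 1 else 0 := by
  split_ifs with h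
  · rw [h, grad_X_self]
  · exact grad_X_of_ne (xVar_injective.ne h) a

lemma grad_xVar_yVar (i : Fin 6) (j : Fin 5) (a : MP ![5, 4]) :
    grad (X (xVar i)) a (yVar j) = 0 := grad_X_of_ne (xVar_ne_yVar i j) a

lemma grad_yVar_xVar (i : Fin 5) (j : Fin 6) (a : MP ![5, 4]) :
    grad (X (yVar i)) a (xVar j) = 0 := grad_X_of_ne (xVar_ne_yVar j i).symm a

lemma grad_yVar (i j : Fin 5) (a : MP ![5, 4]) :
    grad (X (yVar i)) a (yVar j) = if i = j then 1 else 0 := by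
  split_ifs with h
  · rw [h, grad_X_self]
  · exact grad_X_of_ne (yVar_injective.ne h) a

lemma grad_rename_yVar (p : MvPolynomial (Fin 5) ℂ) (a : MP ![5, 4]) (j : Fin 5) :
    grad (rename yVar p) a (yVar j) = eval (yPt a).rep (pderiv j p) :=
  grad_rename_apply yVar_injective _ _ _

lemma grad_rename_yVar_xVar (p : MvPolynomial (Fin 5) ℂ) (a : MP ![5, 4]) (j : Fin 6) :
    grad (rename yVar p) a (xVar j) = 0 :=
  grad_rename_of_notMem _ _ fun ⟨i, hi⟩ => xVar_ne_yVar j i hi.symm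

lemma grad_uVar (i j : Fin 2) (b : MP ![4, 1]) :
    grad (X (uVar i)) b (uVar j) = if i = j then 1 else 0 := by
  split_ifs with h
  · rw [h, grad_X_self]
  · exact grad_X_of_ne (uVar_injective.ne h) b

lemma grad_uVar_zVar (i : Fin 2) (j : Fin 5) (b : MP ![4, 1]) :
    grad (X (uVar i)) b (zVar j) = 0 := grad_X_of_ne (zVar_ne_uVar j i).symm b

lemma grad_rename_zVar (p : MvPolynomial (Fin 5) ℂ) (b : MP ![4, 1]) (j : Fin 5) :
    grad (rename zVar p) b (zVar j) = eval (zPt b).rep (pderiv j p) :=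
  grad_rename_apply zVar_injective _ _ _

lemma grad_rename_zVar_uVar (p : MvPolynomial (Fin 5) ℂ) (b : MP ![4, 1]) (j : Fin 2) :
    grad (rename zVar p) b (uVar j) = 0 :=
  grad_rename_of_notMem _ _ fun ⟨i, hi⟩ => zVar_ne_uVar i j hi

/-- The equation expressing that `(x₁, …, x₅)` is proportional to `y`. -/
def incidenceEq (j i : Fin 5) : CoordRing ![5, 4] :=
  X (xVar i.succ) * X (yVar j) - X (xVar j.succ) * X (yVar i)

/-- The equation `x₀ q(y) + l c(y) = 0`, multiplied by `y_j`. -/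
def strictEq (q c : Fin 2 → MvPolynomial (Fin 5) ℂ) (j : Fin 5) (k : Fin 2) : CoordRing ![5, 4] :=
  X (xVar 0) * (X (yVar j) * rename yVar (q k)) + X (xVar j.succ) * rename yVar (c k)

/-- The equations of the base locus where `y_j ≠ 0`. -/
def baseEqs (q c : Fin 2 → MvPolynomial (Fin 5) ℂ) (j : Fin 5) : Fin 4 ⊕ Fin 2 → CoordRing ![5, 4] :=
  Sum.elim (fun i => incidenceEq j (j.succAbove i)) (strictEq q c j)

/-- The two equations of `Y`. -/
def dualEqs (q c : Fin 2 → MvPolynomial (Fin 5) ℂ) : Fin 2 → CoordRing ![4, 1] :=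
  fun l => X (uVar 0) * rename zVar (![q, c] l 0) + X (uVar 1) * rename zVar (![q, c] l 1)

lemma isMultihomogeneous_incidenceEq (j i : Fin 5) :
    IsMultihomogeneous (incidenceEq j i) (Pi.single 0 1 + Pi.single 1 1) :=
  ((isMultihomogeneous_X _).mul (isMultihomogeneous_X _)).sub
    ((isMultihomogeneous_X _).mul (isMultihomogeneous_X _))

variable {q c : Fin 2 → MvPolynomial (Fin 5) ℂ}

lemma isMultihomogeneous_rename_yVar {p : MvPolynomial (Fin 5) ℂ} {m : ℕ} (hp : p.IsHomogeneous m) :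
    IsMultihomogeneous (rename yVar p : CoordRing ![5, 4]) (Pi.single 1 m) :=
  isMultihomogeneous_rename (d := ![5, 4]) (emb := yVar) (i := 1) (fun _ => rfl) hp

lemma isMultihomogeneous_rename_zVar {p : MvPolynomial (Fin 5) ℂ} {m : ℕ} (hp : p.IsHomogeneous m) :
    IsMultihomogeneous (rename zVar p : CoordRing ![4, 1]) (Pi.single 0 m) :=
  isMultihomogeneous_rename (d := ![4, 1]) (emb := zVar) (i := 0) (fun _ => rfl) hp

/-- The form `y_j q_k` has the degree of the `c_k`. -/
lemma isMultihomogeneous_yVar_mul {p : MvPolynomial (Fin 5) ℂ} (hp : p.IsHomogeneous 2) (j : Fin 5) :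
    IsMultihomogeneous (X (yVar j) * rename yVar p : CoordRing ![5, 4]) (Pi.single 1 3) := by
  have := (isMultihomogeneous_X (yVar j)).mul (isMultihomogeneous_rename_yVar hp)
  rwa [show (Pi.single (yVar j).1 1 + Pi.single 1 2 : Fin 2 → ℕ) = Pi.single 1 3 by
    funext i; fin_cases i <;> rfl] at this

lemma isMultihomogeneous_zVar_mul {p : MvPolynomial (Fin 5) ℂ} (hp : p.IsHomogeneous 2) (j : Fin 5) :
    IsMultihomogeneous (X (zVar j) * rename zVar p : CoordRing ![4, 1]) (Pi.single 0 3) := by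
  have := (isMultihomogeneous_X (zVar j)).mul (isMultihomogeneous_rename_zVar hp)
  rwa [show (Pi.single (zVar j).1 1 + Pi.single 0 2 : Fin 2 → ℕ) = Pi.single 0 3 by
    funext i; fin_cases i <;> rfl] at this

lemma isMultihomogeneous_strictEq (hq : ∀ k, (q k).IsHomogeneous 2)
    (hc : ∀ k, (c k).IsHomogeneous 3) (j : Fin 5) (k : Fin 2) :
    IsMultihomogeneous (strictEq q c j k) (Pi.single 0 1 + Pi.single 1 3) :=
  ((isMultihomogeneous_X _).mul (isMultihomogeneous_yVar_mul (hq k) j)).add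
    ((isMultihomogeneous_X _).mul (isMultihomogeneous_rename_yVar (hc k)))

lemma isMultihomogeneous_dualEqs (hq : ∀ k, (q k).IsHomogeneous 2)
    (hc : ∀ k, (c k).IsHomogeneous 3) (l : Fin 2) :
    IsMultihomogeneous (dualEqs q c l) (Pi.single 1 1 + Pi.single 0 (![2, 3] l)) := by
  have h : ∀ k, (![q, c] l k).IsHomogeneous (![2, 3] l) := by
    fin_cases l
    exacts [hq, hc]
  exact ((isMultihomogeneous_X _).mul (isMultihomogeneous_rename_zVar (h 0))).add
    ((isMultihomogeneous_X _).mul (isMultihomogeneous_rename_zVar (h 1)))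

lemma value_incidenceEq (j i : Fin 5) (a : MP ![5, 4]) : value (incidenceEq j i) a =
    (xPt a).rep i.succ * (yPt a).rep j - (xPt a).rep j.succ * (yPt a).rep i := by
  simp only [incidenceEq, value_sub, value_mul, value_xVar, value_yVar]

lemma value_strictEq (j : Fin 5) (k : Fin 2) (a : MP ![5, 4]) : value (strictEq q c j k) a =
    (xPt a).rep 0 * ((yPt a).rep j * eval (yPt a).rep (q k)) +
      (xPt a).rep j.succ * eval (yPt a).rep (c k) := by
  simp only [strictEq, value_add, value_mul, value_xVar, value_yVar, value_rename_yVar]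

lemma value_dualEqs (l : Fin 2) (b : MP ![4, 1]) : value (dualEqs q c l) b =
    (uPt b).rep 0 * eval (zPt b).rep (![q, c] l 0) +
      (uPt b).rep 1 * eval (zPt b).rep (![q, c] l 1) := by
  simp only [dualEqs, value_add, value_mul, value_uVar, value_rename_zVar]

/-- Where y_j ≠ 0, the scalar l is x_{j+1}/y_j and can be eliminated. -/
lemma mem_baseLocus_iff_of_ne {a : MP ![5, 4]} {j : Fin 5} (hj : (yPt a).rep j ≠ 0) :
    a ∈ baseLocus F₀ F₁ ↔ (∀ i, value (incidenceEq j i) a = 0) ∧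
      ∀ k, value (strictEq (pencilQuadrics F₀ F₁) (pencilCubics F₀ F₁) j k) a = 0 := by
  rw [mem_baseLocus_iff]
  simp only [value_incidenceEq, value_strictEq]
  constructor
  · rintro ⟨l, hl, h⟩
    refine ⟨fun i => ?_, fun k => ?_⟩
    · rw [hl, hl]; ring
    · rw [hl]; linear_combination (yPt a).rep j * h k
  · rintro ⟨h1, h2⟩
    refine ⟨(xPt a).rep j.succ / (yPt a).rep j, fun i => ?_, fun k => ?_⟩
    · field_simp
      linear_combination h1 i
    · field_simp
      linear_combination h2 k

lemma exists_yPt_ne_zero (a : MP ![5, 4]) : ∃ j, (yPt a).rep j ≠ 0 :=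
  Function.ne_iff.1 (yPt a).rep_nonzero

theorem isZariskiClosed_baseLocus (h₀ : F₀ ∈ doublePointCubics) (h₁ : F₁ ∈ doublePointCubics) :
    IsZariskiClosed (baseLocus F₀ F₁) := by
  refine ⟨(Set.range fun s : Fin 5 × Fin 5 => incidenceEq s.1 s.2) ∪
    Set.range fun s : Fin 5 × Fin 2 =>
      strictEq (pencilQuadrics F₀ F₁) (pencilCubics F₀ F₁) s.1 s.2, ?_, ?_⟩
  · rintro _ (⟨s, rfl⟩ | ⟨s, rfl⟩)
    · exact ⟨_, isMultihomogeneous_incidenceEq _ _⟩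
    · exact ⟨_, isMultihomogeneous_strictEq (isHomogeneous_pencilQuadrics h₀ h₁)
        (isHomogeneous_pencilCubics h₀ h₁) _ _⟩
  · ext a
    constructor
    · rintro ha _ (⟨s, rfl⟩ | ⟨s, rfl⟩)
      all_goals
        obtain ⟨l, hl, h⟩ := mem_baseLocus_iff.1 ha
        dsimp only
      · rw [value_incidenceEq, hl, hl]; ring
      · rw [value_strictEq, hl]
        linear_combination (yPt a).rep s.1 * h s.2
    · intro ha
      obtain ⟨j, hj⟩ := exists_yPt_ne_zero a
      exact (mem_baseLocus_iff_of_ne hj).2 ⟨fun i => ha _ (Or.inl ⟨(j, i), rfl⟩),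
        fun k => ha _ (Or.inr ⟨(j, k), rfl⟩)⟩

lemma mem_dualThreefold_iff_value {b : MP ![4, 1]} : b ∈ dualThreefold F₀ F₁ ↔
    ∀ l, value (dualEqs (pencilQuadrics F₀ F₁) (pencilCubics F₀ F₁) l) b = 0 := by
  simp only [mem_dualThreefold_iff, value_dualEqs, Fin.forall_fin_two]
  rfl

theorem isZariskiClosed_dualThreefold (h₀ : F₀ ∈ doublePointCubics) (h₁ : F₁ ∈ doublePointCubics) :
    IsZariskiClosed (dualThreefold F₀ F₁) := by
  refine ⟨Set.range (dualEqs (pencilQuadrics F₀ F₁) (pencilCubics F₀ F₁)), ?_, ?_⟩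
  · rintro _ ⟨l, rfl⟩
    exact ⟨_, isMultihomogeneous_dualEqs (isHomogeneous_pencilQuadrics h₀ h₁)
        (isHomogeneous_pencilCubics h₀ h₁) l⟩
  · ext b
    rw [mem_dualThreefold_iff_value, Set.mem_ofPred_eq, Set.forall_mem_range]

lemma cutsOutOn_baseEqs (h₀ : F₀ ∈ doublePointCubics) (h₁ : F₁ ∈ doublePointCubics)
    {H : CoordRing ![5, 4]} {j : Fin 5} (hH : ∀ x, value H x ≠ 0 → (yPt x).rep j ≠ 0) :
    CutsOutOn H (baseEqs (pencilQuadrics F₀ F₁) (pencilCubics F₀ F₁) j) (baseLocus F₀ F₁) := by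
  refine ⟨?_, fun x hx => ?_⟩
  · rintro (i | k)
    · exact ⟨_, isMultihomogeneous_incidenceEq _ _⟩
    · exact ⟨_, isMultihomogeneous_strictEq (isHomogeneous_pencilQuadrics h₀ h₁)
        (isHomogeneous_pencilCubics h₀ h₁) _ _⟩
  · rw [mem_baseLocus_iff_of_ne (hH x hx), Sum.forall]
    refine and_congr ⟨fun h i => h _, fun h i => ?_⟩ Iff.rfl
    rcases eq_or_ne i j with rfl | hij
    · rw [value_incidenceEq, sub_self]
    · obtain ⟨i, rfl⟩ := Fin.exists_succAbove_eq hij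
      exact h i

lemma cutsOutOn_dualEqs (h₀ : F₀ ∈ doublePointCubics) (h₁ : F₁ ∈ doublePointCubics)
    (H : CoordRing ![4, 1]) :
    CutsOutOn H (dualEqs (pencilQuadrics F₀ F₁) (pencilCubics F₀ F₁)) (dualThreefold F₀ F₁) :=
  ⟨fun l => ⟨_, isMultihomogeneous_dualEqs (isHomogeneous_pencilQuadrics h₀ h₁)
    (isHomogeneous_pencilCubics h₀ h₁) l⟩, fun _ _ => mem_dualThreefold_iff_value⟩

/-- A linear relation between the differentials of the equations of `X`, up to a differential
pulled back from `ℙ^4`. -/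
lemma relation_baseEqs {a : MP ![5, 4]} {j : Fin 5} (hj : (yPt a).rep j ≠ 0)
    {β : Fin 4 ⊕ Fin 2 → ℂ} {ψ : (Σ i : Fin 2, Fin (![5, 4] i + 1)) → ℂ}
    (hψ : ∀ i, ψ (xVar i) = 0) (h : ∑ k, β k • grad (baseEqs q c j k) a + ψ = 0) :
    (∀ i, β (Sum.inl i) = 0) ∧ ∑ k, β (Sum.inr k) * eval (yPt a).rep (q k) = 0 ∧
      ∑ k, β (Sum.inr k) * eval (yPt a).rep (c k) = 0 ∧
      ∀ i, ∑ k, β (Sum.inr k) * ((xPt a).rep 0 * (yPt a).rep j * eval (yPt a).rep (pderiv i (q k)) +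
        (xPt a).rep j.succ * eval (yPt a).rep (pderiv i (c k))) + ψ (yVar i) = 0 := by
  have hs : ∀ s, ∑ i, β (Sum.inl i) * grad (incidenceEq j (j.succAbove i)) a s +
      ∑ k, β (Sum.inr k) * grad (strictEq q c j k) a s + ψ s = 0 := fun s => by
    have := congrFun h s
    rw [Pi.add_apply, Finset.sum_apply, Fintype.sum_sum_type] at this
    exact this
  have hI0 : ∀ i, grad (incidenceEq j i) a (xVar 0) = 0 := fun i => by
    simp [incidenceEq, grad_sub, grad_mul, grad_xVar, grad_yVar_xVar]
  have hI1 : ∀ i m, grad (incidenceEq j i) a (xVar (Fin.succ m)) =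
      (yPt a).rep j * (if i = m then 1 else 0) - (yPt a).rep i * (if j = m then 1 else 0) :=
    fun i m => by
      simp [incidenceEq, grad_sub, grad_mul, grad_xVar, grad_yVar_xVar, value_yVar, value_xVar]
  have hS0 : ∀ k, grad (strictEq q c j k) a (xVar 0) =
      (yPt a).rep j * eval (yPt a).rep (q k) := fun k => by
    simp [strictEq, grad_add, grad_mul, grad_xVar, grad_yVar_xVar, grad_rename_yVar_xVar,
      value_mul, value_yVar, value_rename_yVar]
  have hS1 : ∀ k m, grad (strictEq q c j k) a (xVar (Fin.succ m)) =
      eval (yPt a).rep (c k) * if j = m then 1 else 0 := fun k m => by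
    simp [strictEq, grad_add, grad_mul, grad_xVar, grad_yVar_xVar, grad_rename_yVar_xVar,
      value_rename_yVar, (Fin.succ_ne_zero m).symm]
  have hS2 : ∀ k m, grad (strictEq q c j k) a (yVar m) = (xPt a).rep 0 *
      ((yPt a).rep j * eval (yPt a).rep (pderiv m (q k)) +
        eval (yPt a).rep (q k) * if j = m then 1 else 0) +
      (xPt a).rep j.succ * eval (yPt a).rep (pderiv m (c k)) := fun k m => by
    simp [strictEq, grad_add, grad_mul, grad_xVar_yVar, grad_yVar, grad_rename_yVar,
      value_xVar, value_yVar, value_rename_yVar]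
    split_ifs <;> ring
  -- The components of the relation are read off one by one. Those at the variables x_{i+1} with i ≠
  -- j isolate the incidence equations, the one at x₀ gives the quadrics, the one at x_{j+1} the
  -- cubics, and the y-components give the gradients.
  have hβ : ∀ i, β (Sum.inl i) = 0 := by
    intro i
    have := hs (xVar (Fin.succ (j.succAbove i)))
    simp only [hI1, hS1, hψ, (Fin.succAbove_ne j i).symm, Fin.succAbove_right_inj, if_false,
      mul_zero, sub_zero, Finset.sum_const_zero, add_zero, mul_ite, mul_one,
      Finset.sum_ite_eq', Finset.mem_univ, if_true] at this
    exact (mul_eq_zero.1 this).resolve_right hj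
  have hq : ∑ k, β (Sum.inr k) * eval (yPt a).rep (q k) = 0 := by
    have := hs (xVar 0)
    simp only [hβ, zero_mul, Finset.sum_const_zero, zero_add, hS0, hψ, add_zero] at this
    refine (mul_eq_zero.1 (Eq.trans ?_ this)).resolve_left hj
    rw [Finset.mul_sum]
    exact Finset.sum_congr rfl fun k _ => by ring
  refine ⟨hβ, hq, ?_, fun i => ?_⟩
  · have := hs (xVar (Fin.succ j))
    simpa only [hβ, zero_mul, Finset.sum_const_zero, zero_add, hS1, hψ, add_zero, if_true,
      mul_one] using this
  · have := hs (yVar i)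
    simp only [hβ, zero_mul, Finset.sum_const_zero, zero_add, hS2] at this
    rw [Fin.sum_univ_two] at hq this ⊢
    linear_combination this - (xPt a).rep 0 * (if j = i then 1 else 0) * hq

lemma relation_dualEqs {b : MP ![4, 1]} {α : Fin 2 → ℂ}
    {ψ : (Σ i : Fin 2, Fin (![4, 1] i + 1)) → ℂ}
    (hψ : ∀ i, ψ (uVar i) = 0) (h : ∑ k, α k • grad (dualEqs q c k) b + ψ = 0) :
    (∀ k, α 0 * eval (zPt b).rep (q k) + α 1 * eval (zPt b).rep (c k) = 0) ∧
      ∀ i, ∑ k, (uPt b).rep k * (α 0 * eval (zPt b).rep (pderiv i (q k)) +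
        α 1 * eval (zPt b).rep (pderiv i (c k))) + ψ (zVar i) = 0 := by
  have hs : ∀ s, α 0 * grad (dualEqs q c 0) b s + α 1 * grad (dualEqs q c 1) b s + ψ s = 0 :=
    fun s => by
      have := congrFun h s
      rwa [Fin.sum_univ_two] at this
  have h0 : ∀ l k, grad (dualEqs q c l) b (uVar k) = eval (zPt b).rep (![q, c] l k) :=
    fun l k => by
      fin_cases k <;>
      simp [dualEqs, grad_add, grad_mul, grad_uVar, grad_rename_zVar_uVar, value_rename_zVar]
  have h1 : ∀ l i, grad (dualEqs q c l) b (zVar i) =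
      (uPt b).rep 0 * eval (zPt b).rep (pderiv i (![q, c] l 0)) +
      (uPt b).rep 1 * eval (zPt b).rep (pderiv i (![q, c] l 1)) := fun l i => by
    simp [dualEqs, grad_add, grad_mul, grad_uVar_zVar, grad_rename_zVar, value_uVar]
  refine ⟨fun k => ?_, fun i => ?_⟩
  · have := hs (uVar k)
    rw [h0, h0, hψ, add_zero] at this
    exact this
  · have := hs (zVar i)
    rw [h1, h1] at this
    rw [Fin.sum_univ_two]
    simp only [Matrix.cons_val_zero, Matrix.cons_val_one] at this
    linear_combination this

/-- A relation among the six differentials would be a critical triple. Here a = (x₀ y_j, x_{j+1})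
comes from the point of X, and γ consists of the coefficients of the two strict equations. -/
theorem isSmoothOfDim_baseLocus (h₀ : F₀ ∈ doublePointCubics) (h₁ : F₁ ∈ doublePointCubics)
    (h : NoCriticalTriple (pencilQuadrics F₀ F₁) (pencilCubics F₀ F₁)) :
    IsSmoothOfDim (baseLocus F₀ F₁) 3 := by
  intro a ha
  obtain ⟨j, hj⟩ := exists_yPt_ne_zero a
  refine ⟨4 + 2, X (yVar j), baseEqs (pencilQuadrics F₀ F₁) (pencilCubics F₀ F₁) j ∘
    finSumFinEquiv.symm, by rw [Fin.sum_univ_two]; rfl, ⟨_, isMultihomogeneous_X _⟩,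
    by rwa [value_yVar], (cutsOutOn_baseEqs h₀ h₁ fun x hx => by rwa [value_yVar] at hx).comp_equiv _,
    ?_⟩
  refine (linearIndependent_equiv (R := ℂ) finSumFinEquiv.symm (f := fun k =>
    grad (baseEqs (pencilQuadrics F₀ F₁) (pencilCubics F₀ F₁) j k) a)).2 ?_
  rw [Fintype.linearIndependent_iff]
  intro β hβ
  obtain ⟨hβ0, hq, hc, hg⟩ := relation_baseEqs (ψ := 0) hj (fun _ => rfl) ((add_zero _).trans hβ)
  by_contra! hne
  obtain ⟨k, hk⟩ := hne
  obtain ⟨k, rfl⟩ : ∃ k', k = Sum.inr k' := by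
    rcases k with i | k
    · exact absurd (hβ0 i) hk
    · exact ⟨k, rfl⟩
  have ha' := (mem_baseLocus_iff_of_ne hj).1 ha
  have hx : ![(xPt a).rep 0 * (yPt a).rep j, (xPt a).rep j.succ] ≠ 0 := by
    intro h0
    have hx0 : (xPt a).rep 0 = 0 := (mul_eq_zero.1 (congrFun h0 0)).resolve_right hj
    have hxj : (xPt a).rep j.succ = 0 := congrFun h0 1
    refine (xPt a).rep_nonzero (_root_.funext fun i => Fin.cases hx0 (fun i => ?_) i)
    have := ha'.1 i
    rw [value_incidenceEq, hxj, zero_mul, sub_zero] at this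
    exact (mul_eq_zero.1 this).resolve_right hj
  refine h (yPt a).rep (fun k => β (Sum.inr k)) _ (yPt a).rep_nonzero
    (fun h0 => hk (congrFun h0 k)) hx ⟨hq, hc, fun k => ?_, fun i => ?_⟩
  · have := ha'.2 k
    rw [value_strictEq] at this
    simp only [Matrix.cons_val_zero, Matrix.cons_val_one]
    linear_combination this
  · have := hg i
    rwa [Pi.zero_apply, add_zero] at this

/-- As for X with the roles exchanged: γ is the point of ℙ¹ and a the relation between the two
differentials. -/
theorem isSmoothOfDim_dualThreefold (h₀ : F₀ ∈ doublePointCubics) (h₁ : F₁ ∈ doublePointCubics)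
    (h : NoCriticalTriple (pencilQuadrics F₀ F₁) (pencilCubics F₀ F₁)) :
    IsSmoothOfDim (dualThreefold F₀ F₁) 3 := by
  intro b hb
  refine ⟨2, C 1, dualEqs (pencilQuadrics F₀ F₁) (pencilCubics F₀ F₁),
    by rw [Fin.sum_univ_two]; rfl, ⟨_, isMultihomogeneous_C _⟩,
    by rw [value_C]; exact one_ne_zero, cutsOutOn_dualEqs h₀ h₁ _, ?_⟩
  rw [Fintype.linearIndependent_iff]
  intro α hα
  obtain ⟨hf, hg⟩ := relation_dualEqs (ψ := 0) (fun _ => rfl) ((add_zero _).trans hα)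
  by_contra! hne
  obtain ⟨k, hk⟩ := hne
  obtain ⟨h1, h2⟩ := mem_dualThreefold_iff.1 hb
  refine h (zPt b).rep (uPt b).rep α (zPt b).rep_nonzero (uPt b).rep_nonzero
    (fun h0 => hk (congrFun h0 k)) ⟨?_, ?_, hf, fun i => ?_⟩
  · rwa [Fin.sum_univ_two]
  · rwa [Fin.sum_univ_two]
  · have := hg i
    rwa [Pi.zero_apply, add_zero] at this

end Equations

/-! ### Regular maps into products -/

section RegularMaps

variable {ι κ μ : Type} [DecidableEq ι] {d : ι → ℕ} {e : κ → ℕ} {e' : μ → ℕ} {A : Set (MP d)}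

lemma regularOn_fstMap [DecidableEq κ] (B : Set (MPProd d e)) : RegularOn fstMap B :=
  regularOn_of_factors fun i => regularFactorOn_proj (Sum.inl i) B

lemma regularOn_sndMap [DecidableEq κ] (B : Set (MPProd d e)) : RegularOn sndMap B :=
  regularOn_of_factors fun i => regularFactorOn_proj (Sum.inr i) B

lemma regularOn_id : RegularOn (fun x : MP d => x) A :=
  regularOn_of_factors fun i => regularFactorOn_proj i A

lemma regularOn_pairX {f : MP d → ℙ ℂ (Fin 6 → ℂ)} {g : MP d → ℙ ℂ (Fin 5 → ℂ)}
    (hf : RegularFactorOn (n := 5) f A) (hg : RegularFactorOn (n := 4) g A) :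
    RegularOn (fun x => pairX (f x) (g x)) A := by
  refine regularOn_of_factors fun j => ?_
  fin_cases j
  exacts [hf, hg]

lemma regularOn_pairY {f : MP d → ℙ ℂ (Fin 5 → ℂ)} {g : MP d → ℙ ℂ (Fin 2 → ℂ)}
    (hf : RegularFactorOn (n := 4) f A) (hg : RegularFactorOn (n := 1) g A) :
    RegularOn (fun x => pairY (f x) (g x)) A := by
  refine regularOn_of_factors fun j => ?_
  fin_cases j
  exacts [hf, hg]

lemma regularOn_single {n : ℕ} {f : MP d → ℙ ℂ (Fin (n + 1) → ℂ)} (hf : RegularFactorOn f A) :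
    RegularOn (fun x => (fun _ => f x : PSpace n)) A :=
  regularOn_of_factors fun _ => hf

/-- The point of the product with the given components. -/
def prodPair (a : MP e) (b : MP e') : MPProd e e'
  | Sum.inl i => a i
  | Sum.inr i => b i

lemma fstMap_prodPair (a : MP e) (b : MP e') : fstMap (prodPair a b) = a := rfl

lemma prodPair_eta (w : MPProd e e') : prodPair (fstMap w) (sndMap w) = w := by
  funext i
  rcases i with i | i <;> rfl

lemma regularOn_prodPair {f : MP d → MP e} {g : MP d → MP e'} (hf : RegularOn f A)
    (hg : RegularOn g A) : RegularOn (fun x => prodPair (f x) (g x)) A := by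
  intro a ha j
  rcases j with j | j
  exacts [hf a ha j, hg a ha j]

end RegularMaps

lemma exists_smul_eq_smul_of_mul_eq {v w : Fin 2 → ℂ} (hv : v ≠ 0) (hw : w ≠ 0)
    (h : v 0 * w 1 = v 1 * w 0) : ∃ r : ℂ, r ≠ 0 ∧ w = r • v := by
  have h1 := toProj_eq_of_mul_eq hv hw h
  rw [toProj_of_ne_zero hv, toProj_of_ne_zero hw, Eq.comm, Projectivization.mk_eq_mk_iff] at h1
  obtain ⟨r, hr⟩ := h1
  exact ⟨r, r.ne_zero, hr.symm⟩

lemma smul_liftVec (r α β : ℂ) (y : Fin 5 → ℂ) :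
    r • liftVec α β y = liftVec (r * α) (r * β) y := by
  funext i
  refine Fin.cases rfl (fun j => ?_) i
  simp [liftVec, mul_assoc]

lemma toProj_liftVec_eq {α β α' β' : ℂ} (y : Fin 5 → ℂ) (h : α ≠ 0 ∨ β ≠ 0)
    (h' : α' ≠ 0 ∨ β' ≠ 0) (hd : α * β' = β * α') :
    toProj (liftVec α β y) = toProj (liftVec α' β' y) := by
  have hne : ∀ {α β : ℂ}, α ≠ 0 ∨ β ≠ 0 → ![α, β] ≠ 0 := fun h h0 =>
    h.elim (fun h => h (congrFun h0 0)) fun h => h (congrFun h0 1)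
  obtain ⟨r, hr, he⟩ := exists_smul_eq_smul_of_mul_eq (hne h) (hne h') hd
  rw [show α' = r * α from congrFun he 0, show β' = r * β from congrFun he 1, ← smul_liftVec,
    toProj_smul hr]

/-! ### Inverses of X → Q and Y → Q away from the base points -/

section Kernels

variable {F₀ F₁ : MvPolynomial (Fin 6) ℂ} {p : ℙ ℂ (Fin 5 → ℂ)}

lemma mem_baseZeros_iff : p ∈ baseZeros F₀ F₁ ↔
    (∀ k, eval p.rep (pencilQuadrics F₀ F₁ k) = 0) ∧
      ∀ k, eval p.rep (pencilCubics F₀ F₁ k) = 0 :=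
  eval_baseSystem_eq_zero_iff

/-- The point of `ℙ^5` given by the column `k` of the matrix of the pencil. -/
def colPoint (F₀ F₁ : MvPolynomial (Fin 6) ℂ) (k : Fin 2) (p : ℙ ℂ (Fin 5 → ℂ)) :
    ℙ ℂ (Fin 6 → ℂ) :=
  toProj (liftVec (eval p.rep (pencilCubics F₀ F₁ k)) (-eval p.rep (pencilQuadrics F₀ F₁ k)) p.rep)

/-- The rows of the matrix of the pencil. -/
def pencilRow (F₀ F₁ : MvPolynomial (Fin 6) ℂ) : Fin 2 → Fin 2 → MvPolynomial (Fin 5) ℂ :=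
  ![pencilQuadrics F₀ F₁, pencilCubics F₀ F₁]

/-- The point of `ℙ^1` given by the row `l` of the matrix of the pencil. -/
def rowPoint (F₀ F₁ : MvPolynomial (Fin 6) ℂ) (l : Fin 2) (p : ℙ ℂ (Fin 5 → ℂ)) :
    ℙ ℂ (Fin 2 → ℂ) :=
  toProj (kernelRow (pencilRow F₀ F₁ l) p.rep)

/-- Column `k` of the matrix of the pencil is nonzero at `p`. -/
def ColNeZero (F₀ F₁ : MvPolynomial (Fin 6) ℂ) (k : Fin 2) (p : ℙ ℂ (Fin 5 → ℂ)) : Prop :=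
  eval p.rep (pencilCubics F₀ F₁ k) ≠ 0 ∨ -eval p.rep (pencilQuadrics F₀ F₁ k) ≠ 0

/-- Row `l` of the matrix of the pencil is nonzero at `p`. -/
def RowNeZero (F₀ F₁ : MvPolynomial (Fin 6) ℂ) (l : Fin 2) (p : ℙ ℂ (Fin 5 → ℂ)) : Prop :=
  ∃ k, eval p.rep (pencilRow F₀ F₁ l k) ≠ 0

open Classical in
/-- The fibre of `X` over a point outside the base locus. -/
def colKernel (F₀ F₁ : MvPolynomial (Fin 6) ℂ) (p : ℙ ℂ (Fin 5 → ℂ)) : ℙ ℂ (Fin 6 → ℂ) :=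
  if ColNeZero F₀ F₁ 0 p then colPoint F₀ F₁ 0 p else colPoint F₀ F₁ 1 p

open Classical in
/-- The fibre of `Y` over a point outside the base locus. -/
def rowKernel (F₀ F₁ : MvPolynomial (Fin 6) ℂ) (p : ℙ ℂ (Fin 5 → ℂ)) : ℙ ℂ (Fin 2 → ℂ) :=
  if RowNeZero F₀ F₁ 0 p then rowPoint F₀ F₁ 0 p else rowPoint F₀ F₁ 1 p

lemma exists_colNeZero (hp : p ∉ baseZeros F₀ F₁) :
    ColNeZero F₀ F₁ 0 p ∨ ColNeZero F₀ F₁ 1 p := by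
  by_contra! hcon
  simp only [ColNeZero, not_or, not_not, neg_eq_zero] at hcon
  exact hp (mem_baseZeros_iff.2 ⟨Fin.forall_fin_two.2 ⟨hcon.1.2, hcon.2.2⟩,
    Fin.forall_fin_two.2 ⟨hcon.1.1, hcon.2.1⟩⟩)

lemma exists_rowNeZero (hp : p ∉ baseZeros F₀ F₁) :
    RowNeZero F₀ F₁ 0 p ∨ RowNeZero F₀ F₁ 1 p := by
  by_contra! hcon
  simp only [RowNeZero, not_exists, not_not] at hcon
  exact hp (mem_baseZeros_iff.2 hcon)

lemma pairX_colPoint_mem {k : Fin 2} (hk : ColNeZero F₀ F₁ k p)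
    (hp : eval p.rep (quintic F₀ F₁) = 0) : pairX (colPoint F₀ F₁ k p) p ∈ baseLocus F₀ F₁ := by
  rw [eval_quintic] at hp
  refine pairX_mem_baseLocus hk fun j => ?_
  fin_cases k <;> fin_cases j <;> simp only [Fin.zero_eta, Fin.mk_one, Fin.isValue]
  · ring
  · linear_combination -hp
  · linear_combination hp
  · ring

lemma pairY_rowPoint_mem {l : Fin 2} (hl : RowNeZero F₀ F₁ l p)
    (hp : eval p.rep (quintic F₀ F₁) = 0) : pairY p (rowPoint F₀ F₁ l p) ∈ dualThreefold F₀ F₁ := by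
  rw [eval_quintic] at hp
  refine pairY_mem_dualThreefold (kernelRow_ne_zero hl) ?_ ?_ <;> fin_cases l <;>
    simp only [kernelRow, pencilRow, Fin.zero_eta, Fin.mk_one, Fin.isValue, Matrix.cons_val_zero,
      Matrix.cons_val_one]
  · ring
  · linear_combination hp
  · linear_combination -hp
  · ring

/-- One nonzero column already determines the annihilating vector (α : β) up to scale. -/
lemma xPt_eq_colPoint {a : MP ![5, 4]} (ha : a ∈ baseLocus F₀ F₁) {k : Fin 2}
    (hk : ColNeZero F₀ F₁ k (yPt a)) : xPt a = colPoint F₀ F₁ k (yPt a) := by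
  obtain ⟨α, β, hne, hrep, h⟩ := exists_lift_of_mem_baseLocus ha
  rw [← toProj_rep (n := 5) (xPt a), hrep, colPoint]
  exact toProj_liftVec_eq _ hne hk (by linear_combination -h k)

lemma uPt_eq_rowPoint {b : MP ![4, 1]} (hb : b ∈ dualThreefold F₀ F₁) {l : Fin 2}
    (hl : RowNeZero F₀ F₁ l (zPt b)) : uPt b = rowPoint F₀ F₁ l (zPt b) := by
  obtain ⟨h0, h1⟩ := mem_dualThreefold_iff.1 hb
  rw [← toProj_rep (n := 1) (uPt b), rowPoint]
  refine toProj_eq_of_mul_eq (uPt b).rep_nonzero (kernelRow_ne_zero hl) ?_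
  fin_cases l <;> simp only [kernelRow, pencilRow, Fin.zero_eta, Fin.mk_one, Fin.isValue,
    Matrix.cons_val_zero, Matrix.cons_val_one]
  · linear_combination -h0
  · linear_combination -h1

lemma colKernel_eq_or (hp : p ∉ baseZeros F₀ F₁) :
    ∃ k, ColNeZero F₀ F₁ k p ∧ colKernel F₀ F₁ p = colPoint F₀ F₁ k p := by
  by_cases h : ColNeZero F₀ F₁ 0 p
  · exact ⟨0, h, if_pos h⟩
  · exact ⟨1, (exists_colNeZero hp).resolve_left h, if_neg h⟩

lemma rowKernel_eq_or (hp : p ∉ baseZeros F₀ F₁) :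
    ∃ l, RowNeZero F₀ F₁ l p ∧ rowKernel F₀ F₁ p = rowPoint F₀ F₁ l p := by
  by_cases h : RowNeZero F₀ F₁ 0 p
  · exact ⟨0, h, if_pos h⟩
  · exact ⟨1, (exists_rowNeZero hp).resolve_left h, if_neg h⟩

lemma pairX_colKernel_mem (hp : p ∉ baseZeros F₀ F₁) (h0 : eval p.rep (quintic F₀ F₁) = 0) :
    pairX (colKernel F₀ F₁ p) p ∈ baseLocus F₀ F₁ := by
  obtain ⟨k, hk, he⟩ := colKernel_eq_or hp
  rw [he]
  exact pairX_colPoint_mem hk h0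

lemma pairY_rowKernel_mem (hp : p ∉ baseZeros F₀ F₁) (h0 : eval p.rep (quintic F₀ F₁) = 0) :
    pairY p (rowKernel F₀ F₁ p) ∈ dualThreefold F₀ F₁ := by
  obtain ⟨l, hl, he⟩ := rowKernel_eq_or hp
  rw [he]
  exact pairY_rowPoint_mem hl h0

lemma xPt_eq_colKernel {a : MP ![5, 4]} (ha : a ∈ baseLocus F₀ F₁)
    (h : yPt a ∉ baseZeros F₀ F₁) : xPt a = colKernel F₀ F₁ (yPt a) := by
  obtain ⟨k, hk, he⟩ := colKernel_eq_or h
  rw [he, xPt_eq_colPoint ha hk]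

lemma uPt_eq_rowKernel {b : MP ![4, 1]} (hb : b ∈ dualThreefold F₀ F₁)
    (h : zPt b ∉ baseZeros F₀ F₁) : uPt b = rowKernel F₀ F₁ (zPt b) := by
  obtain ⟨l, hl, he⟩ := rowKernel_eq_or h
  rw [he, uPt_eq_rowPoint hb hl]

/-- On Q the case distinction in `colKernel` is immaterial, since either nonzero column gives the
same point. This is what makes `colKernel` regular. -/
lemma colKernel_eq (hp : p ∉ baseZeros F₀ F₁) (h0 : eval p.rep (quintic F₀ F₁) = 0) {k : Fin 2}
    (hk : ColNeZero F₀ F₁ k p) : colKernel F₀ F₁ p = colPoint F₀ F₁ k p :=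
  xPt_eq_colPoint (a := pairX (colKernel F₀ F₁ p) p) (pairX_colKernel_mem hp h0) hk

lemma rowKernel_eq (hp : p ∉ baseZeros F₀ F₁) (h0 : eval p.rep (quintic F₀ F₁) = 0) {l : Fin 2}
    (hl : RowNeZero F₀ F₁ l p) : rowKernel F₀ F₁ p = rowPoint F₀ F₁ l p :=
  uPt_eq_rowPoint (b := pairY p (rowKernel F₀ F₁ p)) (pairY_rowKernel_mem hp h0) hl

section Regular

variable {ι : Type} [DecidableEq ι] {d : ι → ℕ} {A : Set (MP d)} {i : ι}
  {emb : Fin 5 → Σ i : ι, Fin (d i + 1)} {P : MP d → ℙ ℂ (Fin 5 → ℂ)}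

/-- The point of ℙ⁴ is allowed to be one factor of a larger product, because the inverse map is
needed both on Q and on Y. The two columns give the two systems of local formulas. -/
lemma regularFactorOn_colKernel (h₀ : F₀ ∈ doublePointCubics) (h₁ : F₁ ∈ doublePointCubics)
    (hemb : ∀ k, (emb k).1 = i) (hP : ∀ x k, coords x (emb k) = (P x).rep k)
    (hA : ∀ x ∈ A, P x ∉ baseZeros F₀ F₁ ∧ eval (P x).rep (quintic F₀ F₁) = 0) :
    RegularFactorOn (n := 5) (fun x => colKernel F₀ F₁ (P x)) A := by
  let G : Fin 2 → Fin 6 → CoordRing d := fun k => Fin.cons (rename emb (pencilCubics F₀ F₁ k))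
    fun i => rename emb (-pencilQuadrics F₀ F₁ k * X i)
  have hG : ∀ k s, IsMultihomogeneous (G k s) (Pi.single i 3) := fun k s => by
    refine Fin.cases ?_ (fun j => ?_) s
    · exact isMultihomogeneous_rename hemb (isHomogeneous_pencilCubics h₀ h₁ k)
    · exact isMultihomogeneous_rename hemb
        ((isHomogeneous_pencilQuadrics h₀ h₁ k).neg.mul (isHomogeneous_X _ _))
  have hv : ∀ k x, (fun s => value (G k s) x) = liftVec (eval (P x).rep (pencilCubics F₀ F₁ k))
      (-eval (P x).rep (pencilQuadrics F₀ F₁ k)) (P x).rep := fun k x => by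
    funext s
    have hr : ∀ p, value (rename emb p : CoordRing d) x = eval (P x).rep p := fun p => by
      rw [value_rename, _root_.funext (hP x)]
    refine Fin.cases ?_ (fun j => ?_) s
    · exact hr _
    · refine (hr _).trans ?_
      rw [map_mul, map_neg, eval_X]
      rfl
  have hne : ∀ k x, (fun s => value (G k s) x) ≠ 0 → ColNeZero F₀ F₁ k (P x) := by
    intro k x h
    rw [hv] at h
    by_contra hcon
    simp only [ColNeZero, not_or, not_not] at hcon
    rw [hcon.1, hcon.2] at h
    exact h (_root_.funext fun s => Fin.cases rfl (fun j => zero_mul _) s)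
  refine regularFactorOn_ite (G := G 0) (G' := G 1) (hG 0) (hG 1) (fun x hx => ?_)
    (fun x hx h => ?_) (fun x hx h => ?_)
  · rw [hv, hv]
    exact (exists_colNeZero (hA x hx).1).imp (liftVec_ne_zero (P x).rep_nonzero)
      (liftVec_ne_zero (P x).rep_nonzero)
  · rw [hv, colKernel_eq (hA x hx).1 (hA x hx).2 (hne 0 x h), colPoint]
  · rw [hv, colKernel_eq (hA x hx).1 (hA x hx).2 (hne 1 x h), colPoint]

lemma regularFactorOn_rowKernel (h₀ : F₀ ∈ doublePointCubics) (h₁ : F₁ ∈ doublePointCubics)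
    (hemb : ∀ k, (emb k).1 = i) (hP : ∀ x k, coords x (emb k) = (P x).rep k)
    (hA : ∀ x ∈ A, P x ∉ baseZeros F₀ F₁ ∧ eval (P x).rep (quintic F₀ F₁) = 0) :
    RegularFactorOn (n := 1) (fun x => rowKernel F₀ F₁ (P x)) A := by
  let G : Fin 2 → Fin 2 → CoordRing d := fun l =>
    ![rename emb (pencilRow F₀ F₁ l 1), -rename emb (pencilRow F₀ F₁ l 0)]
  have hrow : ∀ l k, (pencilRow F₀ F₁ l k).IsHomogeneous (![2, 3] l) := fun l => by
    fin_cases l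
    exacts [isHomogeneous_pencilQuadrics h₀ h₁, isHomogeneous_pencilCubics h₀ h₁]
  have hG : ∀ l s, IsMultihomogeneous (G l s) (Pi.single i (![2, 3] l)) := fun l s => by
    fin_cases s
    · exact isMultihomogeneous_rename hemb (hrow l 1)
    · exact (isMultihomogeneous_rename hemb (hrow l 0)).neg
  have hv : ∀ l x, (fun s => value (G l s) x) = kernelRow (pencilRow F₀ F₁ l) (P x).rep :=
    fun l x => by
      funext s
      have hr : ∀ p, value (rename emb p : CoordRing d) x = eval (P x).rep p := fun p => by
        rw [value_rename, _root_.funext (hP x)]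
      fin_cases s
      · exact hr _
      · exact (value_neg _ _).trans (congrArg Neg.neg (hr _))
  have hne : ∀ l x, (fun s => value (G l s) x) ≠ 0 → RowNeZero F₀ F₁ l (P x) := by
    intro l x h
    rw [hv] at h
    by_contra hcon
    simp only [RowNeZero, not_exists, not_not] at hcon
    exact h (by simp [kernelRow, hcon])
  refine regularFactorOn_ite (G := G 0) (G' := G 1) (hG 0) (hG 1) (fun x hx => ?_)
    (fun x hx h => ?_) (fun x hx h => ?_)
  · rw [hv, hv]
    exact (exists_rowNeZero (hA x hx).1).imp kernelRow_ne_zero kernelRow_ne_zero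
  · rw [hv, rowKernel_eq (hA x hx).1 (hA x hx).2 (hne 0 x h), rowPoint]
  · rw [hv, rowKernel_eq (hA x hx).1 (hA x hx).2 (hne 1 x h), rowPoint]

end Regular

lemma eval_quintic_yPt {a : MP ![5, 4]} (ha : a ∈ baseLocus F₀ F₁) :
    eval (yPt a).rep (quintic F₀ F₁) = 0 := by
  have : rhoMap a ∈ hypersurface (n := 4) (quintic F₀ F₁) :=
    image_rhoMap_baseLocus ▸ Set.mem_image_of_mem _ ha
  exact this

lemma eval_quintic_zPt {b : MP ![4, 1]} (hb : b ∈ dualThreefold F₀ F₁) :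
    eval (zPt b).rep (quintic F₀ F₁) = 0 := by
  have : projMap b ∈ hypersurface (n := 4) (quintic F₀ F₁) :=
    image_projMap_dualThreefold ▸ Set.mem_image_of_mem _ hb
  exact this

lemma regularOn_rhoMap (A : Set (MP ![5, 4])) : RegularOn rhoMap A :=
  regularOn_single (n := 4) (f := yPt) (regularFactorOn_proj (d := ![5, 4]) 1 A)

lemma regularOn_projMap (A : Set (MP ![4, 1])) : RegularOn projMap A :=
  regularOn_single (n := 4) (f := zPt) (regularFactorOn_proj (d := ![4, 1]) 0 A)

/-- The preimage in `ℙ^4`, viewed as a product with one factor, of the base points. -/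
abbrev basePoints (F₀ F₁ : MvPolynomial (Fin 6) ℂ) : Set (PSpace 4) :=
  (fun p : PSpace 4 => p 0) ⁻¹' baseZeros F₀ F₁

theorem isIsoOn_rhoMap (h₀ : F₀ ∈ doublePointCubics) (h₁ : F₁ ∈ doublePointCubics) :
    IsIsoOn rhoMap (baseLocus F₀ F₁ \ rhoMap ⁻¹' basePoints F₀ F₁)
      (hypersurface (n := 4) (quintic F₀ F₁) \ basePoints F₀ F₁) := by
  refine ⟨regularOn_rhoMap _, fun a ha => ⟨eval_quintic_yPt ha.1, ha.2⟩,
    fun p => pairX (colKernel F₀ F₁ (p 0)) (p 0), ?_, fun p hp => ?_, fun a ha => ?_, fun p hp => ?_⟩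
  · exact regularOn_pairX (regularFactorOn_colKernel (i := 0) (emb := fun k => ⟨0, k⟩) h₀ h₁
      (fun _ => rfl) (fun _ _ => rfl) fun p hp => ⟨hp.2, hp.1⟩)
      (regularFactorOn_proj (d := fun _ : Fin 1 => 4) 0 _)
  · exact ⟨pairX_colKernel_mem hp.2 hp.1, hp.2⟩
  · change pairX (colKernel F₀ F₁ (yPt a)) (yPt a) = a
    rw [← xPt_eq_colKernel ha.1 ha.2, pairX_eta]
  · funext i
    rw [Subsingleton.elim i 0]
    rfl

theorem isIsoOn_projMap (h₀ : F₀ ∈ doublePointCubics) (h₁ : F₁ ∈ doublePointCubics) :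
    IsIsoOn projMap (dualThreefold F₀ F₁ \ projMap ⁻¹' basePoints F₀ F₁)
      (hypersurface (n := 4) (quintic F₀ F₁) \ basePoints F₀ F₁) := by
  refine ⟨regularOn_projMap _, fun a ha => ⟨eval_quintic_zPt ha.1, ha.2⟩,
    fun p => pairY (p 0) (rowKernel F₀ F₁ (p 0)), ?_, fun p hp => ?_, fun b hb => ?_, fun p hp => ?_⟩
  · exact regularOn_pairY (regularFactorOn_proj (d := fun _ : Fin 1 => 4) 0 _)
      (regularFactorOn_rowKernel (i := 0) (emb := fun k => ⟨0, k⟩) h₀ h₁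
      (fun _ => rfl) (fun _ _ => rfl) fun p hp => ⟨hp.2, hp.1⟩)
  · exact ⟨pairY_rowKernel_mem hp.2 hp.1, hp.2⟩
  · change pairY (zPt b) (rowKernel F₀ F₁ (zPt b)) = b
    rw [← uPt_eq_rowKernel hb.1 hb.2, pairY_eta]
  · funext i
    rw [Subsingleton.elim i 0]
    rfl

end Kernels

/-! ### The fibres over the base points -/

section Fibres

variable {F₀ F₁ : MvPolynomial (Fin 6) ℂ}

lemma exists_rep_eq_liftVec {a : MP ![5, 4]} (ha : a ∈ baseLocus F₀ F₁) :
    ∃ α β : ℂ, (α ≠ 0 ∨ β ≠ 0) ∧ (xPt a).rep = liftVec α β (yPt a).rep :=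
  let ⟨α, β, h, h', _⟩ := exists_lift_of_mem_baseLocus ha
  ⟨α, β, h, h'⟩

lemma pairX_mem_of_mem_baseZeros {p : ℙ ℂ (Fin 5 → ℂ)} (hp : p ∈ baseZeros F₀ F₁) {α β : ℂ}
    (h : α ≠ 0 ∨ β ≠ 0) : pairX (toProj (liftVec α β p.rep)) p ∈ baseLocus F₀ F₁ :=
  pairX_mem_baseLocus h fun k => by
    rw [(mem_baseZeros_iff.1 hp).1 k, (mem_baseZeros_iff.1 hp).2 k, mul_zero, mul_zero, add_zero]

lemma rep_ne_zero_or (s : ℙ ℂ (Fin 2 → ℂ)) : s.rep 0 ≠ 0 ∨ s.rep 1 ≠ 0 := by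
  by_contra! hcon
  exact s.rep_nonzero (by ext i; fin_cases i; exacts [hcon.1, hcon.2])

/-- Over a base point there is no condition on (α : β), so the fibre is the line of points [α : βy].
The inverse reads off [y_j x₀ : x_{j+1}] for a coordinate y_j ≠ 0. -/
theorem isIsomorphic_fibre_rhoMap {p : PSpace 4} (hp : p ∈ basePoints F₀ F₁) :
    IsIsomorphic (Set.univ : Set (PSpace 1)) (baseLocus F₀ F₁ ∩ rhoMap ⁻¹' {p}) := by
  obtain ⟨j, hj⟩ := Function.ne_iff.1 (p 0).rep_nonzero
  have hfib : ∀ a ∈ baseLocus F₀ F₁ ∩ rhoMap ⁻¹' {p}, yPt a = p 0 := fun a ha => congrFun ha.2 0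
  have hne : ∀ a ∈ baseLocus F₀ F₁ ∩ rhoMap ⁻¹' {p},
      ![(p 0).rep j * (xPt a).rep 0, (xPt a).rep j.succ] ≠ 0 := by
    intro a ha h0
    obtain ⟨α, β, hne, hrep⟩ := exists_rep_eq_liftVec ha.1
    rw [hrep, hfib a ha] at h0
    have h1 : (p 0).rep j * α = 0 := congrFun h0 0
    have h2 : β * (p 0).rep j = 0 := congrFun h0 1
    exact hne.elim (fun h => h ((mul_eq_zero.1 h1).resolve_left hj))
      fun h => h ((mul_eq_zero.1 h2).resolve_right hj)
  refine ⟨fun s => pairX (toProj (liftVec ((s 0).rep 0) ((s 0).rep 1) (p 0).rep)) (p 0),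
    ?_, fun s _ => ⟨?_, ?_⟩,
    fun a _ => toProj ![(p 0).rep j * (xPt a).rep 0, (xPt a).rep j.succ], ?_,
    fun _ _ => Set.mem_univ _, fun s _ => ?_, fun a ha => ?_⟩
  · refine regularOn_pairX ?_ (regularFactorOn_const _ _)
    have hv : ∀ s : PSpace 1, (fun k => value ((Fin.cons (X ⟨0, 0⟩) fun i =>
        X ⟨0, 1⟩ * C ((p 0).rep i) : Fin 6 → CoordRing fun _ : Fin 1 => 1) k) s) =
          liftVec ((s 0).rep 0) ((s 0).rep 1) (p 0).rep := by
      intro s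
      funext k
      refine Fin.cases ?_ (fun i => ?_) k
      · exact value_X _ _
      · refine (value_mul _ _ _).trans ?_
        rw [value_X, value_C]
        rfl
    refine regularFactorOn_of_eq (m := Pi.single 0 1) (G := Fin.cons (X ⟨0, 0⟩) fun i =>
        X ⟨0, 1⟩ * C ((p 0).rep i)) (fun k => ?_) (fun s _ => ?_) fun s _ => ?_
    · refine Fin.cases ?_ (fun i => ?_) k
      · exact isMultihomogeneous_X _
      · have := (isMultihomogeneous_X (d := fun _ : Fin 1 => 1) ⟨0, 1⟩).mul
          (isMultihomogeneous_C ((p 0).rep i))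
        rwa [add_zero] at this
    · rw [hv]
      exact liftVec_ne_zero (p 0).rep_nonzero (rep_ne_zero_or _)
    · rw [hv]
  · exact pairX_mem_of_mem_baseZeros hp (rep_ne_zero_or _)
  · funext i
    rw [Subsingleton.elim i 0]
    rfl
  · refine regularOn_single (n := 1) ?_
    have hv : ∀ a : MP ![5, 4], (fun k => value ((![C ((p 0).rep j) * X (xVar 0), X (xVar j.succ)] :
        Fin 2 → CoordRing ![5, 4]) k) a) =
          ![(p 0).rep j * (xPt a).rep 0, (xPt a).rep j.succ] := by
      intro a
      funext k
      fin_cases k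
      · refine (value_mul _ _ _).trans ?_
        rw [value_xVar, value_C]
        rfl
      · exact value_xVar _ _
    refine regularFactorOn_of_eq (m := Pi.single 0 1) (G := ![C ((p 0).rep j) * X (xVar 0),
      X (xVar j.succ)]) (fun k => ?_) (fun a ha => ?_) fun a ha => ?_
    · fin_cases k
      · have := (isMultihomogeneous_C ((p 0).rep j)).mul (isMultihomogeneous_X (xVar 0))
        rwa [zero_add] at this
      · exact isMultihomogeneous_X _
    · rw [hv]
      exact hne a ha
    · rw [hv]
  · funext i
    rw [Subsingleton.elim i 0]
    dsimp only
    rw [xPt_pairX]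
    obtain ⟨r, hr, hrep⟩ := exists_rep_toProj
      (liftVec_ne_zero (p 0).rep_nonzero (rep_ne_zero_or (s 0)))
    rw [hrep]
    refine Eq.trans ?_ (toProj_rep (n := 1) (s 0))
    refine toProj_eq_of_smul_eq_smul (b := (p 0).rep j * r) one_ne_zero (mul_ne_zero hj hr) ?_
    ext k
    fin_cases k
    · simp [liftVec]; ring
    · simp [liftVec]; ring
  · dsimp only
    obtain ⟨α, β, hαβ, hrep⟩ := exists_rep_eq_liftVec ha.1
    obtain ⟨r, hr, hrep'⟩ := exists_rep_toProj (hne a ha)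
    rw [hrep', ← hfib a ha]
    refine Eq.trans ?_ (pairX_eta a)
    congr 1
    refine Eq.trans ?_ (toProj_rep (n := 5) (xPt a))
    have hj' : (yPt a).rep j ≠ 0 := by rwa [hfib a ha]
    rw [hrep]
    refine toProj_eq_of_smul_eq_smul (b := r * (yPt a).rep j) one_ne_zero (mul_ne_zero hr hj') ?_
    rw [smul_liftVec, smul_liftVec]
    simp only [liftVec, Pi.smul_apply, Matrix.cons_val_zero, Matrix.cons_val_one, Fin.cons_zero,
      Fin.cons_succ, smul_eq_mul]
    congr 1
    · ring
    · funext i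
      ring

theorem isIsomorphic_fibre_projMap {p : PSpace 4} (hp : p ∈ basePoints F₀ F₁) :
    IsIsomorphic (Set.univ : Set (PSpace 1)) (dualThreefold F₀ F₁ ∩ projMap ⁻¹' {p}) := by
  refine ⟨fun s => pairY (p 0) (s 0), regularOn_pairY (regularFactorOn_const _ _)
    (regularFactorOn_proj (d := fun _ : Fin 1 => 1) 0 _), fun s _ => ⟨?_, ?_⟩,
    fun b _ => uPt b, regularOn_single (n := 1) (regularFactorOn_proj (d := ![4, 1]) 1 _),
    fun _ _ => Set.mem_univ _, fun s _ => ?_, fun b hb => ?_⟩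
  · have h := mem_baseZeros_iff.1 hp
    rw [mem_dualThreefold_iff, zPt_pairY, h.1, h.1, h.2, h.2]
    simp
  · funext i
    rw [Subsingleton.elim i 0]
    rfl
  · funext i
    rw [Subsingleton.elim i 0]
    rfl
  · have : p 0 = zPt b := (congrFun hb.2 0).symm
    dsimp only
    rw [this, pairY_eta]

end Fibres

/-! ### The common blow-up -/

section CommonBlowUp

variable {F₀ F₁ : MvPolynomial (Fin 6) ℂ}

/-- The fibre product of `X` and `Y` over `ℙ^4`. -/
def fibreProduct (F₀ F₁ : MvPolynomial (Fin 6) ℂ) : Set (MPProd ![5, 4] ![4, 1]) :=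
  {w | fstMap w ∈ baseLocus F₀ F₁ ∧ sndMap w ∈ dualThreefold F₀ F₁ ∧
    yPt (fstMap w) = zPt (sndMap w)}

/-- The exceptional curves in `X`. -/
abbrev curvesX (F₀ F₁ : MvPolynomial (Fin 6) ℂ) : Set (MP ![5, 4]) :=
  baseLocus F₀ F₁ ∩ rhoMap ⁻¹' basePoints F₀ F₁

/-- The exceptional curves in `Y`. -/
abbrev curvesY (F₀ F₁ : MvPolynomial (Fin 6) ℂ) : Set (MP ![4, 1]) :=
  dualThreefold F₀ F₁ ∩ projMap ⁻¹' basePoints F₀ F₁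

/-- Away from the curves the point of Y is determined by its image in Q, so `rowKernel` provides the
inverse. -/
lemma isIsoOn_fstMap (h₀ : F₀ ∈ doublePointCubics) (h₁ : F₁ ∈ doublePointCubics) :
    IsIsoOn fstMap (fibreProduct F₀ F₁ \ fstMap ⁻¹' curvesX F₀ F₁)
      (baseLocus F₀ F₁ \ curvesX F₀ F₁) := by
  have hA : ∀ a ∈ baseLocus F₀ F₁ \ curvesX F₀ F₁,
      yPt a ∉ baseZeros F₀ F₁ ∧ eval (yPt a).rep (quintic F₀ F₁) = 0 := fun a ha =>
    ⟨fun h => ha.2 ⟨ha.1, h⟩, eval_quintic_yPt ha.1⟩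
  refine ⟨regularOn_fstMap _, fun w hw => ⟨hw.1.1, hw.2⟩,
    fun a => prodPair a (pairY (yPt a) (rowKernel F₀ F₁ (yPt a))), ?_, fun a ha => ⟨⟨ha.1, ?_, rfl⟩,
      ha.2⟩, fun w hw => ?_, fun a ha => rfl⟩
  · exact regularOn_prodPair regularOn_id (regularOn_pairY
      (regularFactorOn_proj (d := ![5, 4]) 1 _) (regularFactorOn_rowKernel (i := 1) (emb := yVar)
        h₀ h₁ (fun _ => rfl) (fun _ _ => rfl) hA))
  · exact pairY_rowKernel_mem (hA a ha).1 (hA a ha).2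
  · have hw' := hA (fstMap w) ⟨hw.1.1, hw.2⟩
    dsimp only
    rw [hw.1.2.2] at hw' ⊢
    rw [← uPt_eq_rowKernel hw.1.2.1 hw'.1, pairY_eta, prodPair_eta]

lemma isIsoOn_sndMap (h₀ : F₀ ∈ doublePointCubics) (h₁ : F₁ ∈ doublePointCubics) :
    IsIsoOn sndMap (fibreProduct F₀ F₁ \ sndMap ⁻¹' curvesY F₀ F₁)
      (dualThreefold F₀ F₁ \ curvesY F₀ F₁) := by
  have hA : ∀ b ∈ dualThreefold F₀ F₁ \ curvesY F₀ F₁,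
      zPt b ∉ baseZeros F₀ F₁ ∧ eval (zPt b).rep (quintic F₀ F₁) = 0 := fun b hb =>
    ⟨fun h => hb.2 ⟨hb.1, h⟩, eval_quintic_zPt hb.1⟩
  refine ⟨regularOn_sndMap _, fun w hw => ⟨hw.1.2.1, hw.2⟩,
    fun b => prodPair (pairX (colKernel F₀ F₁ (zPt b)) (zPt b)) b, ?_, fun b hb => ⟨⟨?_, hb.1, rfl⟩,
      hb.2⟩, fun w hw => ?_, fun b hb => rfl⟩
  · exact regularOn_prodPair (regularOn_pairX (regularFactorOn_colKernel (i := 0) (emb := zVar)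
        h₀ h₁ (fun _ => rfl) (fun _ _ => rfl) hA) (regularFactorOn_proj (d := ![4, 1]) 0 _))
        regularOn_id
  · exact pairX_colKernel_mem (hA b hb).1 (hA b hb).2
  · have hw' := hA (sndMap w) ⟨hw.1.2.1, hw.2⟩
    dsimp only
    rw [← hw.1.2.2] at hw' ⊢
    rw [← xPt_eq_colKernel hw.1.1 hw'.1, pairX_eta, prodPair_eta]

lemma linearIndependent_grad_elim_comp_equiv {ι κ κ' μ : Type} {d : ι → ℕ}
    {g : κ → CoordRing d} {G : μ → CoordRing d} {a : MP d} (e : κ' ≃ κ)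
    (h : LinearIndependent ℂ (fun k => grad (Sum.elim g G k) a)) :
    LinearIndependent ℂ (fun k => grad (Sum.elim (g ∘ e) G k) a) := by
  have h' := (linearIndependent_equiv (e.sumCongr (Equiv.refl μ))).2 h
  have he : (fun k => grad (Sum.elim g G k) a) ∘ (e.sumCongr (Equiv.refl μ)) =
      fun k => grad (Sum.elim (g ∘ e) G k) a := by
    funext k
    rcases k with k | k <;> rfl
  rwa [he] at h'

/-- The map from the fibre product to a local model of the blow-up of `X`. -/
lemma isIsoOn_blowUpModel_baseLocus {H : CoordRing ![5, 4]} {G : Fin 2 → CoordRing ![5, 4]}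
    {p : Fin 2 → MvPolynomial (Fin 5) ℂ}
    (hv0 : ∀ x, value (G 0) x = -eval (yPt x).rep (p 1))
    (hv1 : ∀ x, value (G 1) x = eval (yPt x).rep (p 0))
    (hker : ∀ x ∈ baseLocus F₀ F₁, value H x ≠ 0 → ∀ s t : ℂ,
      (s * eval (yPt x).rep (p 0) + t * eval (yPt x).rep (p 1) = 0 ↔ ∀ l,
        s * eval (yPt x).rep (pencilRow F₀ F₁ l 0) +
          t * eval (yPt x).rep (pencilRow F₀ F₁ l 1) = 0)) :
    IsIsoOn (fun w => prodPair (fstMap w) (fun _ => uPt (sndMap w) : PSpace 1))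
      {w ∈ fibreProduct F₀ F₁ | value H (fstMap w) ≠ 0} (blowUpModel (baseLocus F₀ F₁) H G) := by
  refine ⟨regularOn_prodPair (regularOn_fstMap _)
    (regularOn_single (n := 1) (f := fun w : MPProd ![5, 4] ![4, 1] => uPt (sndMap w))
      (regularFactorOn_proj (d := Sum.elim ![5, 4] ![4, 1]) (Sum.inr 1) _)),
    fun w hw => ⟨hw.1.1, hw.2, ?_⟩,
    fun v => prodPair (fstMap v) (pairY (yPt (fstMap v)) (sndMap v 0)), ?_, fun v hv => ?_,
    fun w hw => ?_, fun v hv => ?_⟩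
  · have h := (hker _ hw.1.1 hw.2 ((uPt (sndMap w)).rep 0) ((uPt (sndMap w)).rep 1)).2 (by
      rw [hw.1.2.2, Fin.forall_fin_two]
      exact mem_dualThreefold_iff.1 hw.1.2.1)
    change (uPt (sndMap w)).rep 0 * value (G 1) (fstMap w) =
      (uPt (sndMap w)).rep 1 * value (G 0) (fstMap w)
    rw [hv0, hv1]
    linear_combination h
  · exact regularOn_prodPair (regularOn_fstMap _) (regularOn_pairY
      (f := fun v : MPProd ![5, 4] (fun _ : Fin 1 => 1) => yPt (fstMap v))
      (g := fun v : MPProd ![5, 4] (fun _ : Fin 1 => 1) => sndMap v 0)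
      (regularFactorOn_proj (d := Sum.elim ![5, 4] fun _ : Fin 1 => 1) (Sum.inl 1) _)
      (regularFactorOn_proj (d := Sum.elim ![5, 4] fun _ : Fin 1 => 1) (Sum.inr 0) _))
  · obtain ⟨hv1', hv2, hv3⟩ := hv
    rw [hv0, hv1] at hv3
    refine ⟨⟨hv1', ?_, rfl⟩, hv2⟩
    have h := (hker _ hv1' hv2 ((sndMap v 0).rep 0) ((sndMap v 0).rep 1)).1
      (by linear_combination hv3)
    exact mem_dualThreefold_iff.2 ⟨h 0, h 1⟩
  · change prodPair (fstMap w) (pairY (yPt (fstMap w)) (uPt (sndMap w))) = w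
    rw [hw.1.2.2, pairY_eta, prodPair_eta]
  · refine Eq.trans ?_ (prodPair_eta v)
    refine congrArg (prodPair (fstMap v)) (_root_.funext fun i => ?_)
    rw [Subsingleton.elim i 0]
    rfl

/-- A local model of the blow-up of `X` in which the equations of the curves are the
forms `p 0`, `p 1` on `ℙ^4`. -/
lemma exists_blowUpModel_baseLocus (h₀ : F₀ ∈ doublePointCubics) (h₁ : F₁ ∈ doublePointCubics)
    {a : MP ![5, 4]} {j : Fin 5} {H : CoordRing ![5, 4]} {p : Fin 2 → MvPolynomial (Fin 5) ℂ} {m : ℕ}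
    (hH : ∃ m, IsMultihomogeneous H m) (hHa : value H a ≠ 0)
    (hHj : ∀ x, value H x ≠ 0 → (yPt x).rep j ≠ 0) (hp : ∀ k, (p k).IsHomogeneous m)
    (hker : ∀ x ∈ baseLocus F₀ F₁, value H x ≠ 0 → ∀ s t : ℂ,
      (s * eval (yPt x).rep (p 0) + t * eval (yPt x).rep (p 1) = 0 ↔ ∀ l,
        s * eval (yPt x).rep (pencilRow F₀ F₁ l 0) +
          t * eval (yPt x).rep (pencilRow F₀ F₁ l 1) = 0))
    (hli : LinearIndependent ℂ fun k => grad (Sum.elim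
      (baseEqs (pencilQuadrics F₀ F₁) (pencilCubics F₀ F₁) j)
        ![-rename yVar (p 1), rename yVar (p 0)] k) a) :
    ∃ (r : ℕ) (H : CoordRing ![5, 4]) (g : Fin r → CoordRing ![5, 4])
      (G : Fin 2 → CoordRing ![5, 4])
      (φ : MPProd ![5, 4] ![4, 1] → MPProd ![5, 4] (fun _ : Fin 1 => 1)),
      (∃ m, IsMultihomogeneous H m) ∧ value H a ≠ 0 ∧
      (∃ m, ∀ k, IsMultihomogeneous (G k) m) ∧
      CutsOutOn H g (baseLocus F₀ F₁) ∧ CutsOutOn H (Sum.elim g G) (curvesX F₀ F₁) ∧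
      LinearIndependent ℂ (fun k => grad (Sum.elim g G k) a) ∧
      IsIsoOn φ {w ∈ fibreProduct F₀ F₁ | value H (fstMap w) ≠ 0}
        (blowUpModel (baseLocus F₀ F₁) H G) ∧
      ∀ w ∈ fibreProduct F₀ F₁, value H (fstMap w) ≠ 0 → fstMap (φ w) = fstMap w := by
  have hG : ∀ k, IsMultihomogeneous
      ((![-rename yVar (p 1), rename yVar (p 0)] : Fin 2 → CoordRing ![5, 4]) k)
        (Pi.single 1 m) := fun k => by
    fin_cases k
    · exact (isMultihomogeneous_rename_yVar (hp 1)).neg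
    · exact isMultihomogeneous_rename_yVar (hp 0)
  have hv0 : ∀ x : MP ![5, 4], value
      ((![-rename yVar (p 1), rename yVar (p 0)] : Fin 2 → CoordRing ![5, 4]) 0) x =
        -eval (yPt x).rep (p 1) := fun x => by
    rw [Matrix.cons_val_zero, value_neg, value_rename_yVar]
  have hv1 : ∀ x : MP ![5, 4], value
      ((![-rename yVar (p 1), rename yVar (p 0)] : Fin 2 → CoordRing ![5, 4]) 1) x =
        eval (yPt x).rep (p 0) := fun x => by
    rw [Matrix.cons_val_one, Matrix.cons_val_fin_one, value_rename_yVar]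
  have hcut := cutsOutOn_baseEqs h₀ h₁ hHj
  have hcut' : CutsOutOn H (Sum.elim (baseEqs (pencilQuadrics F₀ F₁) (pencilCubics F₀ F₁) j)
      ![-rename yVar (p 1), rename yVar (p 0)]) (curvesX F₀ F₁) := by
    refine ⟨?_, fun x hx => ?_⟩
    · rintro (k | k)
      exacts [hcut.1 k, ⟨_, hG k⟩]
    · rw [Sum.forall]
      refine Iff.trans ?_ (and_congr_left' (hcut.2 x hx))
      refine and_congr_right fun hxX => ?_
      rw [Fin.forall_fin_two]
      change yPt x ∈ baseZeros F₀ F₁ ↔ value (![-rename yVar (p 1), rename yVar (p 0)] 0) x = 0 ∧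
        value (![-rename yVar (p 1), rename yVar (p 0)] 1) x = 0
      rw [hv0, hv1, neg_eq_zero, mem_baseZeros_iff]
      -- With (s, t) = (1, 0) and (0, 1), the hypothesis on kernels says that vanishing of the row p
      -- forces vanishing of the whole matrix.
      have hk0 := hker x hxX hx 1 0
      have hk1 := hker x hxX hx 0 1
      simp only [Fin.forall_fin_two, one_mul, zero_mul, add_zero, zero_add, pencilRow,
        Matrix.cons_val_zero, Matrix.cons_val_one] at hk0 hk1 ⊢
      rw [hk0, hk1]
      exact ⟨fun h => ⟨⟨h.1.2, h.2.2⟩, h.1.1, h.2.1⟩, fun h => ⟨⟨h.2.1, h.1.1⟩, h.2.2, h.1.2⟩⟩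
  refine ⟨4 + 2, H, baseEqs (pencilQuadrics F₀ F₁) (pencilCubics F₀ F₁) j ∘ finSumFinEquiv.symm, _,
    fun w => prodPair (fstMap w) fun _ => uPt (sndMap w), hH, hHa, ⟨_, hG⟩, hcut.comp_equiv _,
    hcut'.elim_comp_equiv _, linearIndependent_grad_elim_comp_equiv _ hli,
    isIsoOn_blowUpModel_baseLocus hv0 hv1 hker, fun _ _ _ => rfl⟩

/-- The independence of the differentials of the four forms, coordinate by coordinate. -/
lemma eq_zero_of_transverse {q c : Fin 2 → MvPolynomial (Fin 5) ℂ} {y : Fin 5 → ℂ}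
    (ht : LinearIndependent ℂ (fun k i => eval y (pderiv i (baseSystem q c k)))) {A B : Fin 2 → ℂ}
    (h : ∀ i, A 0 * eval y (pderiv i (q 0)) + A 1 * eval y (pderiv i (q 1)) +
      B 0 * eval y (pderiv i (c 0)) + B 1 * eval y (pderiv i (c 1)) = 0) :
    (A 0 = 0 ∧ A 1 = 0) ∧ B 0 = 0 ∧ B 1 = 0 := by
  have := Fintype.linearIndependent_iff.1 ht ![A 0, A 1, B 0, B 1] (by
    funext i
    rw [Finset.sum_apply, Fin.sum_univ_four]
    exact h i)
  exact ⟨⟨this 0, this 1⟩, this 2, this 3⟩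

/-- The relations between the differentials of the equations in a local model for `X`. -/
lemma relation_blowUpEqs {q c p : Fin 2 → MvPolynomial (Fin 5) ℂ} {a : MP ![5, 4]} {j : Fin 5}
    (hj : (yPt a).rep j ≠ 0) {β : (Fin 4 ⊕ Fin 2) ⊕ Fin 2 → ℂ}
    (h : ∑ k, β k • grad (Sum.elim (baseEqs q c j) ![-rename yVar (p 1), rename yVar (p 0)] k) a =
      0) :
    (∀ i, β (Sum.inl (Sum.inl i)) = 0) ∧
      ∀ i, ∑ k, β (Sum.inl (Sum.inr k)) *
        ((xPt a).rep 0 * (yPt a).rep j * eval (yPt a).rep (pderiv i (q k)) +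
          (xPt a).rep j.succ * eval (yPt a).rep (pderiv i (c k))) +
        (β (Sum.inr 1) * eval (yPt a).rep (pderiv i (p 0)) -
          β (Sum.inr 0) * eval (yPt a).rep (pderiv i (p 1))) = 0 := by
  set ψ := β (Sum.inr 1) • grad (rename yVar (p 0)) a - β (Sum.inr 0) • grad (rename yVar (p 1)) a
    with hψ
  have hψ0 : ∀ i, ψ (xVar i) = 0 := fun i => by
    simp [hψ, grad_rename_yVar_xVar]
  have hψ1 : ∀ i, ψ (yVar i) = β (Sum.inr 1) * eval (yPt a).rep (pderiv i (p 0)) -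
      β (Sum.inr 0) * eval (yPt a).rep (pderiv i (p 1)) := fun i => by
    simp [hψ, grad_rename_yVar]
  have hsum : ∑ k, β (Sum.inl k) • grad (baseEqs q c j k) a + ψ = 0 := by
    rw [← h]
    refine Eq.trans ?_ (Fintype.sum_sum_type _).symm
    refine congrArg (fun v => _ + v) ?_
    rw [Fin.sum_univ_two]
    change _ = β (Sum.inr 0) • grad (-rename yVar (p 1)) a + β (Sum.inr 1) • grad (rename yVar (p 0)) a
    rw [grad_neg, smul_neg, hψ, sub_eq_neg_add]
  obtain ⟨h1, -, -, h4⟩ := relation_baseEqs (β := fun k => β (Sum.inl k)) hj hψ0 hsum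
  exact ⟨h1, fun i => by rw [← hψ1]; exact h4 i⟩

/-- On X the relation x₀ y_j q_k + x_{j+1} c_k = 0 makes the two rows proportional. Where x₀ ≠ 0 the
quadrics are multiples of the cubics, which then cut out the curves; where x_{j+1} ≠ 0 the quadrics
cut them out. The remaining row equation for (u : t) is the equation of the blow-up, and
transversality at the base points gives the independence of the differentials. -/
theorem isBlowUp_fstMap (h₀ : F₀ ∈ doublePointCubics) (h₁ : F₁ ∈ doublePointCubics)
    (ht : ∀ y ≠ 0, (∀ i, eval y (baseSystem (pencilQuadrics F₀ F₁) (pencilCubics F₀ F₁) i) = 0) →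
      LinearIndependent ℂ (fun k i => eval y
        (pderiv i (baseSystem (pencilQuadrics F₀ F₁) (pencilCubics F₀ F₁) k)))) :
    IsBlowUp fstMap (fibreProduct F₀ F₁) (baseLocus F₀ F₁) (curvesX F₀ F₁) := by
  refine ⟨regularOn_fstMap _, fun w hw => hw.1, isIsoOn_fstMap h₀ h₁, fun a ha => ?_⟩
  obtain ⟨j, hj⟩ := exists_yPt_ne_zero a
  obtain ⟨α, β, hne, hrep⟩ := exists_rep_eq_liftVec ha.1
  have hli := ht (yPt a).rep (yPt a).rep_nonzero ha.2
  have hval : ∀ (i : Fin 6) (x : MP ![5, 4]), value (X (yVar j) * X (xVar i)) x =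
      (yPt x).rep j * (xPt x).rep i := fun i x => by rw [value_mul, value_yVar, value_xVar]
  by_cases hx0 : (xPt a).rep 0 = 0
  -- A point with x₀ = 0 has x_{j+1} ≠ 0, so the row of quadrics is used.
  · have hxj : (xPt a).rep j.succ ≠ 0 := by
      rw [hrep] at hx0 ⊢
      exact mul_ne_zero (hne.resolve_left (not_not.2 hx0)) hj
    refine exists_blowUpModel_baseLocus (p := pencilQuadrics F₀ F₁) (j := j)
      (H := X (yVar j) * X (xVar j.succ)) h₀ h₁
      ⟨_, (isMultihomogeneous_X _).mul (isMultihomogeneous_X _)⟩ (by rw [hval]; exact mul_ne_zero hj hxj)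
      (fun x hx => left_ne_zero_of_mul (hval j.succ x ▸ hx)) (isHomogeneous_pencilQuadrics h₀ h₁)
      (fun x hxX hx s t => ?_) ?_
    · rw [hval] at hx
      have h := (mem_baseLocus_iff_of_ne (left_ne_zero_of_mul hx)).1 hxX
      have h0 := h.2 0
      have h1 := h.2 1
      rw [value_strictEq] at h0 h1
      refine ⟨fun hst => Fin.forall_fin_two.2 ⟨hst, ?_⟩, fun hst => hst 0⟩
      refine (mul_eq_zero.1 (?_ : (xPt x).rep j.succ * _ = 0)).resolve_left (right_ne_zero_of_mul hx)
      change (xPt x).rep j.succ * (s * eval (yPt x).rep (pencilCubics F₀ F₁ 0) +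
        t * eval (yPt x).rep (pencilCubics F₀ F₁ 1)) = 0
      linear_combination s * h0 + t * h1 - (xPt x).rep 0 * (yPt x).rep j * hst
    · rw [Fintype.linearIndependent_iff]
      intro δ hδ
      obtain ⟨h1, h2⟩ := relation_blowUpEqs hj hδ
      obtain ⟨⟨hA0, hA1⟩, hB0, hB1⟩ := eq_zero_of_transverse hli
        (A := ![δ (Sum.inr 1), -δ (Sum.inr 0)])
        (B := fun k => δ (Sum.inl (Sum.inr k)) * (xPt a).rep j.succ) (fun i => by
          have := h2 i
          rw [hx0, Fin.sum_univ_two] at this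
          simp only [Matrix.cons_val_zero, Matrix.cons_val_one, Matrix.cons_val_fin_one]
          linear_combination this)
      have hB : ∀ k, δ (Sum.inl (Sum.inr k)) = 0 := Fin.forall_fin_two.2 ⟨(mul_eq_zero.1 hB0).resolve_right hxj,
        (mul_eq_zero.1 hB1).resolve_right hxj⟩
      rintro ((i | k) | k)
      exacts [h1 i, hB k, (Fin.forall_fin_two.2 ⟨neg_eq_zero.1 hA1, hA0⟩ :
        ∀ k, δ (Sum.inr k) = 0) k]
  · refine exists_blowUpModel_baseLocus (p := pencilCubics F₀ F₁) (j := j)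
      (H := X (yVar j) * X (xVar 0)) h₀ h₁
      ⟨_, (isMultihomogeneous_X _).mul (isMultihomogeneous_X _)⟩ (by rw [hval]; exact mul_ne_zero hj hx0)
      (fun x hx => left_ne_zero_of_mul (hval 0 x ▸ hx)) (isHomogeneous_pencilCubics h₀ h₁)
      (fun x hxX hx s t => ?_) ?_
    · rw [hval] at hx
      obtain ⟨l, -, h⟩ := mem_baseLocus_iff.1 hxX
      refine ⟨fun hst => Fin.forall_fin_two.2 ⟨?_, hst⟩, fun hst => hst 1⟩
      refine (mul_eq_zero.1 (?_ : (xPt x).rep 0 * _ = 0)).resolve_left (right_ne_zero_of_mul hx)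
      change (xPt x).rep 0 * (s * eval (yPt x).rep (pencilQuadrics F₀ F₁ 0) +
        t * eval (yPt x).rep (pencilQuadrics F₀ F₁ 1)) = 0
      linear_combination s * h 0 + t * h 1 - l * hst
    · rw [Fintype.linearIndependent_iff]
      intro δ hδ
      obtain ⟨h1, h2⟩ := relation_blowUpEqs hj hδ
      obtain ⟨⟨hA0, hA1⟩, hB0, hB1⟩ := eq_zero_of_transverse hli
        (A := fun k => δ (Sum.inl (Sum.inr k)) * ((xPt a).rep 0 * (yPt a).rep j))
        (B := ![δ (Sum.inl (Sum.inr 0)) * (xPt a).rep j.succ + δ (Sum.inr 1),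
          δ (Sum.inl (Sum.inr 1)) * (xPt a).rep j.succ - δ (Sum.inr 0)]) (fun i => by
          have := h2 i
          rw [Fin.sum_univ_two] at this
          simp only [Matrix.cons_val_zero, Matrix.cons_val_one, Matrix.cons_val_fin_one]
          linear_combination this)
      have hA : ∀ k, δ (Sum.inl (Sum.inr k)) = 0 := Fin.forall_fin_two.2 ⟨(mul_eq_zero.1 hA0).resolve_right (mul_ne_zero hx0 hj),
        (mul_eq_zero.1 hA1).resolve_right (mul_ne_zero hx0 hj)⟩
      have hB0' : δ (Sum.inl (Sum.inr 0)) * (xPt a).rep j.succ + δ (Sum.inr 1) = 0 := hB0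
      have hB1' : δ (Sum.inl (Sum.inr 1)) * (xPt a).rep j.succ - δ (Sum.inr 0) = 0 := hB1
      rw [hA 0, zero_mul, zero_add] at hB0'
      rw [hA 1, zero_mul, zero_sub, neg_eq_zero] at hB1'
      rintro ((i | k) | k)
      exacts [h1 i, hA k, (Fin.forall_fin_two.2 ⟨hB1', hB0'⟩ : ∀ k, δ (Sum.inr k) = 0) k]

/-- The map from the fibre product to a local model of the blow-up of `Y`. -/
lemma isIsoOn_blowUpModel_dualThreefold {H : CoordRing ![4, 1]} {G : Fin 2 → CoordRing ![4, 1]}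
    {j : Fin 5} {l : Fin 2} (hHj : ∀ b, value H b ≠ 0 → (zPt b).rep j ≠ 0)
    (hv0 : ∀ b, value (G 0) b = -eval (zPt b).rep (pencilCubics F₀ F₁ l))
    (hv1 : ∀ b, value (G 1) b = (zPt b).rep j * eval (zPt b).rep (pencilQuadrics F₀ F₁ l))
    (hker : ∀ b ∈ dualThreefold F₀ F₁, value H b ≠ 0 → ∀ s t : ℂ,
      s * eval (zPt b).rep (pencilQuadrics F₀ F₁ l) + t * eval (zPt b).rep (pencilCubics F₀ F₁ l) =
        0 → ∀ k, s * eval (zPt b).rep (pencilQuadrics F₀ F₁ k) +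
          t * eval (zPt b).rep (pencilCubics F₀ F₁ k) = 0) :
    IsIsoOn (fun w => prodPair (sndMap w)
        (fun _ => toProj ![(xPt (fstMap w)).rep 0, (xPt (fstMap w)).rep j.succ] : PSpace 1))
      {w ∈ fibreProduct F₀ F₁ | value H (sndMap w) ≠ 0}
      (blowUpModel (dualThreefold F₀ F₁) H G) := by
  have hne : ∀ w ∈ {w ∈ fibreProduct F₀ F₁ | value H (sndMap w) ≠ 0},
      ![(xPt (fstMap w)).rep 0, (xPt (fstMap w)).rep j.succ] ≠ 0 := by
    intro w hw h0
    obtain ⟨α, β, hne, hrep⟩ := exists_rep_eq_liftVec hw.1.1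
    have hj := hHj _ hw.2
    rw [← hw.1.2.2] at hj
    rw [hrep] at h0
    exact hne.elim (fun h => h (congrFun h0 0))
      fun h => h ((mul_eq_zero.1 (congrFun h0 1)).resolve_right hj)
  have hne' : ∀ v ∈ blowUpModel (dualThreefold F₀ F₁) H G,
      (sndMap v 0).rep 0 * (zPt (fstMap v)).rep j ≠ 0 ∨ (sndMap v 0).rep 1 ≠ 0 := fun v hv =>
    (rep_ne_zero_or (sndMap v 0)).imp_left fun h => mul_ne_zero h (hHj _ hv.2.1)
  refine ⟨regularOn_prodPair (regularOn_sndMap _) (regularOn_single (n := 1)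
      (f := fun w : MPProd ![5, 4] ![4, 1] =>
        toProj ![(xPt (fstMap w)).rep 0, (xPt (fstMap w)).rep j.succ]) ?_),
    fun w hw => ⟨hw.1.2.1, hw.2, ?_⟩,
    -- The coordinate of the model is (s : t) = (x₀ : x_{j+1}). As x_{i+1} = x_{j+1} y_i / y_j, the
    -- point of ℙ⁵ is recovered as [s y_j : t y].
    fun v => prodPair (pairX (toProj (liftVec ((sndMap v 0).rep 0 * (zPt (fstMap v)).rep j)
      ((sndMap v 0).rep 1) (zPt (fstMap v)).rep)) (zPt (fstMap v))) (fstMap v),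
    regularOn_prodPair (regularOn_pairX
      (f := fun v : MPProd ![4, 1] (fun _ : Fin 1 => 1) =>
        toProj (liftVec ((sndMap v 0).rep 0 * (zPt (fstMap v)).rep j)
          ((sndMap v 0).rep 1) (zPt (fstMap v)).rep))
      (g := fun v : MPProd ![4, 1] (fun _ : Fin 1 => 1) => zPt (fstMap v)) ?_
      (regularFactorOn_proj (d := Sum.elim ![4, 1] fun _ : Fin 1 => 1) (Sum.inl 0) _))
      (regularOn_fstMap _), fun v hv => ⟨⟨?_, hv.1, rfl⟩, hv.2.1⟩, fun w hw => ?_, fun v hv => ?_⟩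
  · let E : Fin 2 → CoordRing (Sum.elim ![5, 4] ![4, 1]) :=
      ![X ⟨Sum.inl 0, (0 : Fin 6)⟩, X ⟨Sum.inl 0, (j.succ : Fin 6)⟩]
    have hv : ∀ w : MPProd ![5, 4] ![4, 1], (fun k => value (E k) w) =
        ![(xPt (fstMap w)).rep 0, (xPt (fstMap w)).rep j.succ] := by
      intro w
      funext k
      fin_cases k
      · exact value_X _ _
      · exact value_X _ _
    refine regularFactorOn_of_eq (G := E) (m := Pi.single (Sum.inl 0) 1) (fun k => ?_)
      (fun w hw => ?_) fun w hw => ?_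
    · fin_cases k
      · exact isMultihomogeneous_X _
      · exact isMultihomogeneous_X _
    · rw [hv]
      exact hne w hw
    · rw [hv]
  · change (toProj ![(xPt (fstMap w)).rep 0, (xPt (fstMap w)).rep j.succ]).rep 0 * value (G 1) _ =
      (toProj ![(xPt (fstMap w)).rep 0, (xPt (fstMap w)).rep j.succ]).rep 1 * value (G 0) _
    obtain ⟨r, hr, hrep⟩ := exists_rep_toProj (hne w hw)
    have hj := hHj _ hw.2
    rw [← hw.1.2.2] at hj
    have h := ((mem_baseLocus_iff_of_ne hj).1 hw.1.1).2 l
    rw [value_strictEq] at h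
    rw [hrep, hv0, hv1, fstMap_prodPair, ← hw.1.2.2]
    simp only [Pi.smul_apply, Matrix.cons_val_zero, Matrix.cons_val_one, Matrix.cons_val_fin_one,
      smul_eq_mul]
    linear_combination r * h
  · let E : Fin 6 → CoordRing (Sum.elim ![4, 1] fun _ : Fin 1 => 1) :=
      Fin.cons (X ⟨Sum.inr 0, (0 : Fin 2)⟩ * X ⟨Sum.inl 0, j⟩) fun i : Fin 5 =>
        X ⟨Sum.inr 0, (1 : Fin 2)⟩ * X ⟨Sum.inl 0, i⟩
    have hv : ∀ v : MPProd ![4, 1] (fun _ : Fin 1 => 1), (fun k => value (E k) v) =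
        liftVec ((sndMap v 0).rep 0 * (zPt (fstMap v)).rep j)
          ((sndMap v 0).rep 1) (zPt (fstMap v)).rep := by
      intro v
      funext k
      refine Fin.cases ?_ (fun i => ?_) k
      · refine (value_mul _ _ _).trans ?_
        rw [value_X, value_X]
        rfl
      · refine (value_mul _ _ _).trans ?_
        rw [value_X, value_X]
        rfl
    refine regularFactorOn_of_eq (G := E) (m := Pi.single (Sum.inr 0) 1 + Pi.single (Sum.inl 0) 1)
      (fun k => ?_) (fun v hv' => ?_) fun v hv' => ?_
    · refine Fin.cases ?_ (fun i => ?_) k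
      · exact (isMultihomogeneous_X _).mul (isMultihomogeneous_X _)
      · exact (isMultihomogeneous_X _).mul (isMultihomogeneous_X _)
    · rw [hv]
      exact liftVec_ne_zero (zPt (fstMap v)).rep_nonzero (hne' v hv')
    · rw [hv]
  · obtain ⟨h1, h2, h3⟩ := hv
    rw [hv0, hv1] at h3
    exact pairX_mem_baseLocus (hne' v ⟨h1, h2, by rwa [hv0, hv1]⟩)
      (hker _ h1 h2 _ _ (by linear_combination h3))
  · change prodPair (pairX (toProj (liftVec ((toProj _).rep 0 * (zPt (sndMap w)).rep j)
      ((toProj _).rep 1) (zPt (sndMap w)).rep)) (zPt (sndMap w))) (sndMap w) = w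
    obtain ⟨r, hr, hrep⟩ := exists_rep_toProj (hne w hw)
    obtain ⟨α, β, -, hx⟩ := exists_rep_eq_liftVec hw.1.1
    have hj := hHj _ hw.2
    rw [← hw.1.2.2] at hj
    rw [hrep, ← hw.1.2.2]
    refine Eq.trans ?_ (prodPair_eta w)
    congr 1
    refine Eq.trans ?_ (pairX_eta (fstMap w))
    congr 1
    refine Eq.trans ?_ (toProj_rep (n := 5) (xPt (fstMap w)))
    refine toProj_eq_of_smul_eq_smul (b := r * (yPt (fstMap w)).rep j) one_ne_zero
      (mul_ne_zero hr hj) ?_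
    rw [hx, smul_liftVec, smul_liftVec]
    simp only [liftVec, Pi.smul_apply, Matrix.cons_val_zero, Matrix.cons_val_one,
      Matrix.cons_val_fin_one, Fin.cons_zero, Fin.cons_succ, smul_eq_mul]
    congr 1
    · ring
    · funext i
      ring
  · refine Eq.trans ?_ (prodPair_eta v)
    refine congrArg (prodPair (fstMap v)) (_root_.funext fun i => ?_)
    rw [Subsingleton.elim i 0, fstMap_prodPair, xPt_pairX]
    obtain ⟨r, hr, hrep⟩ := exists_rep_toProj
      (liftVec_ne_zero (zPt (fstMap v)).rep_nonzero (hne' v hv))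
    rw [hrep]
    refine Eq.trans ?_ (toProj_rep (n := 1) (sndMap v 0))
    refine toProj_eq_of_smul_eq_smul (b := r * (zPt (fstMap v)).rep j) one_ne_zero
      (mul_ne_zero hr (hHj _ hv.2.1)) ?_
    ext k
    fin_cases k
    · simp [liftVec]; ring
    · simp [liftVec]; ring

/-- A local model of the blow-up of `Y` where `u_{l'} ≠ 0`. -/
lemma exists_blowUpModel_dualThreefold (h₀ : F₀ ∈ doublePointCubics) (h₁ : F₁ ∈ doublePointCubics)
    {b : MP ![4, 1]} (hb : b ∈ curvesY F₀ F₁) {j : Fin 5} (hj : (zPt b).rep j ≠ 0) {l l' : Fin 2}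
    (hll : l ≠ l') (hu : (uPt b).rep l' ≠ 0)
    (ht : LinearIndependent ℂ (fun k i => eval (zPt b).rep
        (pderiv i (baseSystem (pencilQuadrics F₀ F₁) (pencilCubics F₀ F₁) k)))) :
    ∃ (r : ℕ) (H : CoordRing ![4, 1]) (g : Fin r → CoordRing ![4, 1])
      (G : Fin 2 → CoordRing ![4, 1])
      (φ : MPProd ![5, 4] ![4, 1] → MPProd ![4, 1] (fun _ : Fin 1 => 1)),
      (∃ m, IsMultihomogeneous H m) ∧ value H b ≠ 0 ∧
      (∃ m, ∀ k, IsMultihomogeneous (G k) m) ∧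
      CutsOutOn H g (dualThreefold F₀ F₁) ∧ CutsOutOn H (Sum.elim g G) (curvesY F₀ F₁) ∧
      LinearIndependent ℂ (fun k => grad (Sum.elim g G k) b) ∧
      IsIsoOn φ {w ∈ fibreProduct F₀ F₁ | value H (sndMap w) ≠ 0}
        (blowUpModel (dualThreefold F₀ F₁) H G) ∧
      ∀ w ∈ fibreProduct F₀ F₁, value H (sndMap w) ≠ 0 → fstMap (φ w) = sndMap w := by
  -- The indices l, l' are 0 and 1 in some order, so both charts of ℙ¹ are treated at once.
  have hsum : ∀ f : Fin 2 → ℂ, f 0 + f 1 = f l + f l' := fun f => by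
    fin_cases l <;> fin_cases l' <;> simp_all [add_comm]
  have hall : ∀ P : Fin 2 → Prop, P l → P l' → ∀ k, P k := fun P hl hl' k => by
    fin_cases l <;> fin_cases l' <;> fin_cases k <;> simp_all
  have hval : ∀ x : MP ![4, 1], value (X (zVar j) * X (uVar l')) x =
      (zPt x).rep j * (uPt x).rep l' := fun x => by rw [value_mul, value_zVar, value_uVar]
  -- Where u_{l'} ≠ 0, column l' is a multiple of column l, so the entries of column l cut out the
  -- curves. The factor y_j equalises their degrees.
  obtain ⟨G, hG⟩ : ∃ G : Fin 2 → CoordRing ![4, 1],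
      G = ![-rename zVar (pencilCubics F₀ F₁ l), X (zVar j) * rename zVar (pencilQuadrics F₀ F₁ l)] :=
    ⟨_, rfl⟩
  have hG0 : G 0 = -rename zVar (pencilCubics F₀ F₁ l) := by rw [hG]; rfl
  have hG1 : G 1 = X (zVar j) * rename zVar (pencilQuadrics F₀ F₁ l) := by rw [hG]; rfl
  have hv0 : ∀ b, value (G 0) b = -eval (zPt b).rep (pencilCubics F₀ F₁ l) := fun b => by
    rw [hG0, value_neg, value_rename_zVar]
  have hv1 : ∀ b, value (G 1) b = (zPt b).rep j * eval (zPt b).rep (pencilQuadrics F₀ F₁ l) :=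
    fun b => by rw [hG1, value_mul, value_zVar, value_rename_zVar]
  have hGm : ∀ k, IsMultihomogeneous (G k) (Pi.single 0 3) := by
    rw [Fin.forall_fin_two, hG0, hG1]
    exact ⟨(isMultihomogeneous_rename_zVar (isHomogeneous_pencilCubics h₀ h₁ l)).neg,
      isMultihomogeneous_zVar_mul (isHomogeneous_pencilQuadrics h₀ h₁ l) j⟩
  have hHj : ∀ x, value (X (zVar j) * X (uVar l')) x ≠ 0 → (zPt x).rep j ≠ 0 := fun x hx =>
    left_ne_zero_of_mul (hval x ▸ hx)
  have hcut := cutsOutOn_dualEqs h₀ h₁ (X (zVar j) * X (uVar l'))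
  have hmem : ∀ x ∈ dualThreefold F₀ F₁,
      (uPt x).rep l * eval (zPt x).rep (pencilQuadrics F₀ F₁ l) +
        (uPt x).rep l' * eval (zPt x).rep (pencilQuadrics F₀ F₁ l') = 0 ∧
      (uPt x).rep l * eval (zPt x).rep (pencilCubics F₀ F₁ l) +
        (uPt x).rep l' * eval (zPt x).rep (pencilCubics F₀ F₁ l') = 0 := by
    intro x hx
    obtain ⟨h1, h2⟩ := mem_dualThreefold_iff.1 hx
    exact ⟨(hsum fun k => (uPt x).rep k * eval (zPt x).rep (pencilQuadrics F₀ F₁ k)).symm.trans h1,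
      (hsum fun k => (uPt x).rep k * eval (zPt x).rep (pencilCubics F₀ F₁ k)).symm.trans h2⟩
  have hcut' : CutsOutOn (X (zVar j) * X (uVar l'))
      (Sum.elim (dualEqs (pencilQuadrics F₀ F₁) (pencilCubics F₀ F₁)) G) (curvesY F₀ F₁) := by
    refine ⟨?_, fun x hx => ?_⟩
    · rintro (k | k)
      exacts [hcut.1 k, ⟨_, hGm k⟩]
    · rw [Sum.forall]
      refine Iff.trans ?_ (and_congr_left' (hcut.2 x hx))
      refine and_congr_right fun hxX => ?_
      rw [Fin.forall_fin_two]
      change zPt x ∈ baseZeros F₀ F₁ ↔ value (G 0) x = 0 ∧ value (G 1) x = 0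
      rw [hv0, hv1, neg_eq_zero, mem_baseZeros_iff]
      refine ⟨fun h => ⟨h.2 l, by rw [h.1 l, mul_zero]⟩, fun ⟨h1, h2⟩ => ?_⟩
      have h2' := (mul_eq_zero.1 h2).resolve_left (hHj x hx)
      have hu' : (uPt x).rep l' ≠ 0 := right_ne_zero_of_mul (hval x ▸ hx)
      obtain ⟨h3, h4⟩ := hmem x hxX
      rw [h2', mul_zero, zero_add] at h3
      rw [h1, mul_zero, zero_add] at h4
      exact ⟨hall _ h2' ((mul_eq_zero.1 h3).resolve_left hu'),
        hall _ h1 ((mul_eq_zero.1 h4).resolve_left hu')⟩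
  refine ⟨2, X (zVar j) * X (uVar l'), dualEqs (pencilQuadrics F₀ F₁) (pencilCubics F₀ F₁), G, _,
    ⟨_, (isMultihomogeneous_X _).mul (isMultihomogeneous_X _)⟩, by rw [hval]; exact mul_ne_zero hj hu,
    ⟨_, hGm⟩, hcut, hcut', ?_, isIsoOn_blowUpModel_dualThreefold hHj hv0 hv1 ?_, fun _ _ _ => rfl⟩
  · rw [Fintype.linearIndependent_iff]
    intro δ hδ
    have hZ := mem_baseZeros_iff.1 (show zPt b ∈ baseZeros F₀ F₁ from hb.2)
    set ψ := δ (Sum.inr 0) • grad (G 0) b + δ (Sum.inr 1) • grad (G 1) b with hψ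
    have hψ0 : ∀ i, ψ (uVar i) = 0 := fun i => by
      simp [hψ, hG0, hG1, grad_neg, grad_mul, grad_rename_zVar_uVar, value_rename_zVar, hZ.1]
    have hψ1 : ∀ i, ψ (zVar i) = δ (Sum.inr 1) * ((zPt b).rep j *
        eval (zPt b).rep (pderiv i (pencilQuadrics F₀ F₁ l))) -
        δ (Sum.inr 0) * eval (zPt b).rep (pderiv i (pencilCubics F₀ F₁ l)) := fun i => by
      simp [hψ, hG0, hG1, grad_neg, grad_mul, grad_rename_zVar, value_rename_zVar, value_zVar, hZ.1]
      ring
    have hrel : ∑ k, δ (Sum.inl k) • grad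
        (dualEqs (pencilQuadrics F₀ F₁) (pencilCubics F₀ F₁) k) b + ψ = 0 := by
      rw [← hδ, Fintype.sum_sum_type, hψ, ← Fin.sum_univ_two fun k => δ (Sum.inr k) • grad (G k) b]
      rfl
    obtain ⟨-, h2⟩ := relation_dualEqs (α := fun k => δ (Sum.inl k)) hψ0 hrel
    -- A and B collect the coefficients of the differentials of the q_k and the c_k, which vanish by
    -- transversality. The index l' isolates the equations of Y, then l those of the curves.
    obtain ⟨A, hA⟩ : ∃ A : Fin 2 → ℂ, A = fun k => (uPt b).rep k * δ (Sum.inl 0) +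
      if k = l then δ (Sum.inr 1) * (zPt b).rep j else 0 := ⟨_, rfl⟩
    obtain ⟨B, hB⟩ : ∃ B : Fin 2 → ℂ, B = fun k => (uPt b).rep k * δ (Sum.inl 1) -
      if k = l then δ (Sum.inr 0) else 0 := ⟨_, rfl⟩
    have hAl : A l = (uPt b).rep l * δ (Sum.inl 0) + δ (Sum.inr 1) * (zPt b).rep j := by
      rw [hA]; simp
    have hAl' : A l' = (uPt b).rep l' * δ (Sum.inl 0) := by
      rw [hA]; simp [hll.symm]
    have hBl : B l = (uPt b).rep l * δ (Sum.inl 1) - δ (Sum.inr 0) := by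
      rw [hB]; simp
    have hBl' : B l' = (uPt b).rep l' * δ (Sum.inl 1) := by
      rw [hB]; simp [hll.symm]
    obtain ⟨hA', hB'⟩ := eq_zero_of_transverse ht (A := A) (B := B) (fun i => by
      have := h2 i
      rw [Fin.sum_univ_two, hψ1] at this
      have e1 := hsum fun k => (uPt b).rep k * (δ (Sum.inl 0) *
        eval (zPt b).rep (pderiv i (pencilQuadrics F₀ F₁ k)) +
        δ (Sum.inl 1) * eval (zPt b).rep (pderiv i (pencilCubics F₀ F₁ k)))
      have e2 := hsum fun k => A k * eval (zPt b).rep (pderiv i (pencilQuadrics F₀ F₁ k))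
      have e3 := hsum fun k => B k * eval (zPt b).rep (pderiv i (pencilCubics F₀ F₁ k))
      simp only [hAl, hAl', hBl, hBl'] at e1 e2 e3
      linear_combination this - e1 + e2 + e3)
    have hA0 : ∀ k, A k = 0 := Fin.forall_fin_two.2 hA'
    have hB0 : ∀ k, B k = 0 := Fin.forall_fin_two.2 hB'
    have d0 : δ (Sum.inl 0) = 0 := (mul_eq_zero.1 (hAl'.symm.trans (hA0 l'))).resolve_left hu
    have d1 : δ (Sum.inl 1) = 0 := (mul_eq_zero.1 (hBl'.symm.trans (hB0 l'))).resolve_left hu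
    have d2 := hAl.symm.trans (hA0 l)
    have d3 := hBl.symm.trans (hB0 l)
    rw [d0, mul_zero, zero_add] at d2
    rw [d1, mul_zero, zero_sub, neg_eq_zero] at d3
    rintro (k | k)
    exacts [(Fin.forall_fin_two.2 ⟨d0, d1⟩ : ∀ k, δ (Sum.inl k) = 0) k,
      (Fin.forall_fin_two.2 ⟨d3, (mul_eq_zero.1 d2).resolve_right hj⟩ : ∀ k, δ (Sum.inr k) = 0) k]
  · intro x hxX hx s t hst
    have hu' : (uPt x).rep l' ≠ 0 := right_ne_zero_of_mul (hval x ▸ hx)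
    obtain ⟨h3, h4⟩ := hmem x hxX
    refine hall _ hst ((mul_eq_zero.1 (?_ : (uPt x).rep l' * _ = 0)).resolve_left hu')
    linear_combination s * h3 + t * h4 - (uPt x).rep l * hst

theorem isBlowUp_sndMap (h₀ : F₀ ∈ doublePointCubics) (h₁ : F₁ ∈ doublePointCubics)
    (ht : ∀ y ≠ 0, (∀ i, eval y (baseSystem (pencilQuadrics F₀ F₁) (pencilCubics F₀ F₁) i) = 0) →
      LinearIndependent ℂ (fun k i => eval y
        (pderiv i (baseSystem (pencilQuadrics F₀ F₁) (pencilCubics F₀ F₁) k)))) :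
    IsBlowUp sndMap (fibreProduct F₀ F₁) (dualThreefold F₀ F₁) (curvesY F₀ F₁) := by
  refine ⟨regularOn_sndMap _, fun w hw => hw.2.1, isIsoOn_sndMap h₀ h₁, fun b hb => ?_⟩
  obtain ⟨j, hj⟩ := Function.ne_iff.1 (zPt b).rep_nonzero
  have hli := ht (zPt b).rep (zPt b).rep_nonzero hb.2
  rcases rep_ne_zero_or (uPt b) with hu | hu
  · exact exists_blowUpModel_dualThreefold h₀ h₁ hb hj one_ne_zero hu hli
  · exact exists_blowUpModel_dualThreefold h₀ h₁ hb hj zero_ne_one hu hli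

end CommonBlowUp

/-! ### Assembly of the flop -/

theorem isHomogeneous_quintic {F₀ F₁ : MvPolynomial (Fin 6) ℂ}
    (h₀ : F₀ ∈ doublePointCubics) (h₁ : F₁ ∈ doublePointCubics) :
    (quintic F₀ F₁).IsHomogeneous 5 := by
  rw [← detQuintic_pencil]
  exact isHomogeneous_detQuintic (isHomogeneous_pencilQuadrics h₀ h₁) (isHomogeneous_pencilCubics h₀ h₁)

theorem isFlop_of_hasExactlyODPs {F₀ F₁ : MvPolynomial (Fin 6) ℂ}
    (h₀ : F₀ ∈ doublePointCubics) (h₁ : F₁ ∈ doublePointCubics)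
    (h : HasExactlyODPs (n := 4) (quintic F₀ F₁) 36) :
    IsFlop (baseLocus F₀ F₁) rhoMap (dualThreefold F₀ F₁) projMap
      (hypersurface (n := 4) (quintic F₀ F₁)) (singularPoints (n := 4) (quintic F₀ F₁)) := by
  obtain ⟨hS, ht⟩ := singularPoints_eq_of_hasExactlyODPs h₀ h₁ h
  have hN : NoCriticalTriple (pencilQuadrics F₀ F₁) (pencilCubics F₀ F₁) := by
    refine noCriticalTriple_of_transverse (fun y hy h0 h1 => ?_) ht
    have hq := isHomogeneous_quintic h₀ h₁
    have hmem : (fun _ => Projectivization.mk ℂ y hy : PSpace 4) ∈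
        singularPoints (n := 4) (quintic F₀ F₁) :=
      ⟨(eval_mk_rep_eq_zero_iff hq hy).2 h0, fun i =>
        (eval_mk_rep_eq_zero_iff (hq.pderiv) hy).2 (h1 i)⟩
    rw [hS] at hmem
    intro i
    exact (eval_mk_rep_eq_zero_iff (isHomogeneous_baseSystem (isHomogeneous_pencilQuadrics h₀ h₁)
      (isHomogeneous_pencilCubics h₀ h₁) i) hy).1 (hmem i)
  have hsub : singularPoints (n := 4) (quintic F₀ F₁) ⊆ hypersurface (n := 4) (quintic F₀ F₁) :=
    fun p hp => hp.1
  rw [hS] at hsub ⊢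
  exact
    { closed_X := isZariskiClosed_baseLocus h₀ h₁
      closed_Y := isZariskiClosed_dualThreefold h₀ h₁
      smooth_X := isSmoothOfDim_baseLocus h₀ h₁ hN
      smooth_Y := isSmoothOfDim_dualThreefold h₀ h₁ hN
      regular_f := regularOn_rhoMap _
      regular_g := regularOn_projMap _
      image_f := image_rhoMap_baseLocus
      image_g := image_projMap_dualThreefold
      subset := hsub
      iso_f := isIsoOn_rhoMap h₀ h₁
      iso_g := isIsoOn_projMap h₀ h₁
      curve_f := fun p hp => isIsomorphic_fibre_rhoMap hp
      curve_g := fun p hp => isIsomorphic_fibre_projMap hp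
      common_blowUp := by
        -- The common blow-up is the fibre product over ℙ⁴; over a single point p it is the product
        -- of the two fibres.
        refine ⟨fibreProduct F₀ F₁, isBlowUp_fstMap h₀ h₁ ht, isBlowUp_sndMap h₀ h₁ ht,
          fun w hw => _root_.funext fun _ => hw.2.2, fun p _ => ?_⟩
        ext w
        constructor
        · rintro ⟨hw, hwp⟩
          exact ⟨⟨hw.1, hwp⟩, hw.2.1, by
            rw [← hwp]
            exact _root_.funext fun _ => hw.2.2.symm⟩
        · rintro ⟨⟨h1, h2⟩, h3, h4⟩
          exact ⟨⟨h1, h3, (congrFun h2 0).trans (congrFun h4 0).symm⟩, h2⟩ }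

end CubicPencil

end

theorem mainTheorem3 :
    (∀ F₀ ∈ CubicPencil.doublePointCubics, ∀ F₁ ∈ CubicPencil.doublePointCubics,
      CubicPencil.rhoMap '' CubicPencil.baseLocus F₀ F₁ =
          CubicPencil.hypersurface (n := 4) (CubicPencil.quintic F₀ F₁) ∧
        CubicPencil.projMap '' CubicPencil.dualThreefold F₀ F₁ =
          CubicPencil.hypersurface (n := 4) (CubicPencil.quintic F₀ F₁) ∧
        (CubicPencil.quintic F₀ F₁).IsHomogeneous 5 ∧
        (CubicPencil.IsSmoothOfDim (CubicPencil.baseLocus F₀ F₁) 3 →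
          CubicPencil.quintic F₀ F₁ ≠ 0)) ∧
    CubicPencil.ForGenericPencil (fun F₀ F₁ =>
      CubicPencil.HasExactlyODPs (n := 4) (CubicPencil.quintic F₀ F₁) 36) ∧
    (∀ F₀ ∈ CubicPencil.doublePointCubics, ∀ F₁ ∈ CubicPencil.doublePointCubics,
      CubicPencil.HasExactlyODPs (n := 4) (CubicPencil.quintic F₀ F₁) 36 →
        CubicPencil.IsFlop
          (CubicPencil.baseLocus F₀ F₁) CubicPencil.rhoMap
          (CubicPencil.dualThreefold F₀ F₁) CubicPencil.projMap
          (CubicPencil.hypersurface (n := 4) (CubicPencil.quintic F₀ F₁))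
          (CubicPencil.singularPoints (n := 4) (CubicPencil.quintic F₀ F₁))) := by
  refine ⟨fun F₀ h₀ F₁ h₁ => ⟨CubicPencil.image_rhoMap_baseLocus,
    CubicPencil.image_projMap_dualThreefold,
    CubicPencil.isHomogeneous_quintic h₀ h₁,
    CubicPencil.quintic_ne_zero_of_isSmoothOfDim h₀ h₁⟩,
    CubicPencil.forGenericPencil_hasExactlyODPs,
    fun F₀ h₀ F₁ h₁ h => CubicPencil.isFlop_of_hasExactlyODPs h₀ h₁ h⟩
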